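/- There exists a universal constant $C>0$ such that the following holds. Let $d,N\ge 1$ be integers, write $x\sim y$ for nearest neighbours in $\mathbb{Z}^d$, and let $H$ be the random operator acting on functions $\psi:\mathbb{Z}^d\to\mathbb{C}^N$ by $$(H\psi)(x)=V(x)\psi(x)+\sum_{y:\,y\sim x}W(x,y)\psi(y),\qquad x\in\mathbb{Z}^d,$$ where the $V(x)$ are random Hermitian $N\times N$ matrices and the $W(x,y)$ are random $N\times N$ matrices with $W(y,x)=W(x,y)^*$, such that the matrices $V(x)$, $x\in\mathbb{Z}^d$, and $W(x,y)$, $x\sim y$ with $x$ having even sum of coordinates, are jointly independent. Assume that either (orthogonal case) each $V(x)$ is distributed according to the GOE, with density proportional to $\exp\{-\frac N4\operatorname{tr}V^2\}$ with respect to Lebesgue measure on real symmetric matrices, and all $W(x,y)$ are real; or (unitary case) each $V(x)$ is distributed according to the GUE, with density proportional to $\exp\{-\frac N2\operatorname{tr}V^2\}$ with respect to Lebesgue measure on Hermitian matrices. For a finite $\Lambda\subset\mathbb{Z}^d$ let $H_\Lambda=P_\Lambda HP_\Lambda^*$ be the restriction of $H$ to $\Lambda$, where $P_\Lambda$ is the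 coordinate projection onto functions $\Lambda\to\mathbb{C}^N$, and let $\mathcal{N}(H_\Lambda,I)$ be the number of eigenvalues of $H_\Lambda$ in $I$, counted with multiplicity. Then for every finite $\Lambda\subset\mathbb{Z}^d$ and every interval $I\subset\mathbb{R}$ of length $|I|$, $$\mathbb{E}\,\mathcal{N}(H_\Lambda,I)\le C\,N\,|\Lambda|\,|I|.$$ In particular, with $\Lambda_L=\{-L,\dots,L\}^d$, if the limiting measure $$\rho_H(\cdot)=\lim_{L\to\infty}\frac{\mathbb{E}\,\mathcal{N}(H_{\Lambda_L},\cdot)}{N(2L+1)^d}$$ exists (as a locally finite measure, in the sense of vague convergence), then it has a density with respect to Lebesgue measure with values in $[0,C]$; in particular the density is bounded uniformly in $N$. -/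

import Mathlib

open MeasureTheory ProbabilityTheory Filter Topology
open scoped ENNReal

noncomputable section

namespace Orbital

/-! ### The Gaussian ensembles -/

/-- The positions strictly above the diagonal of an `N × N` matrix. -/
abbrev Upper (N : ℕ) : Type := {p : Fin N × Fin N // p.1 < p.2}

/-- The product (Borel) σ-algebra on matrices. -/
instance instMeasurableSpaceMatrix (N : ℕ) : MeasurableSpace (Matrix (Fin N) (Fin N) ℂ) :=
  inferInstanceAs (MeasurableSpace (Fin N → Fin N → ℂ))

/-- The Hermitian matrix with real diagonal `u.1` and complex entries `u.2` above the diagonal. -/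
def hermitianMatrix {N : ℕ} (u : (Fin N → ℝ) × (Upper N → ℂ)) : Matrix (Fin N) (Fin N) ℂ :=
  Matrix.of fun i j =>
    if h : i < j then u.2 ⟨(i, j), h⟩
    else if h : j < i then star (u.2 ⟨(j, i), h⟩)
    else (u.1 i : ℂ)

/-- The real symmetric matrix (regarded as a complex matrix) with diagonal `u.1` and real
entries `u.2` above the diagonal. -/
def symmetricMatrix {N : ℕ} (u : (Fin N → ℝ) × (Upper N → ℝ)) : Matrix (Fin N) (Fin N) ℂ :=
  hermitianMatrix (u.1, fun p => (u.2 p : ℂ))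

theorem measurable_hermitianMatrix {N : ℕ} : Measurable (hermitianMatrix (N := N)) := by
  refine measurable_pi_lambda _ fun i => measurable_pi_lambda _ fun j => ?_
  simp only [hermitianMatrix, Matrix.of_apply]
  split_ifs
  · fun_prop
  · exact continuous_star.measurable.comp (by fun_prop)
  · fun_prop

theorem measurable_symmetricMatrix {N : ℕ} : Measurable (symmetricMatrix (N := N)) :=
  measurable_hermitianMatrix.comp (by fun_prop)

/-- Lebesgue measure `∏_{i ≤ j} dV_{ij}` on the real symmetric `N × N` matrices. -/
def lebesgueSymmetric (N : ℕ) : Measure (Matrix (Fin N) (Fin N) ℂ) :=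
  (volume : Measure ((Fin N → ℝ) × (Upper N → ℝ))).map symmetricMatrix

/-- Lebesgue measure `∏_i dV_{ii} ∏_{i < j} d(Re V_{ij}) d(Im V_{ij})` on the Hermitian
`N × N` matrices. -/
def lebesgueHermitian (N : ℕ) : Measure (Matrix (Fin N) (Fin N) ℂ) :=
  (volume : Measure ((Fin N → ℝ) × (Upper N → ℂ))).map hermitianMatrix

/-- The measure with density `exp (-a tr V²)` with respect to `ν`, normalised to total mass one. -/
def gaussianWeight {N : ℕ} (ν : Measure (Matrix (Fin N) (Fin N) ℂ)) (a : ℝ) :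
    Measure (Matrix (Fin N) (Fin N) ℂ) :=
  let μ := ν.withDensity fun V => ENNReal.ofReal (Real.exp (-a * (Matrix.trace (V * V)).re))
  (μ Set.univ)⁻¹ • μ

/-- The Gaussian Orthogonal Ensemble: density proportional to `exp (-(N/4) tr V²)`. -/
def GOE (N : ℕ) : Measure (Matrix (Fin N) (Fin N) ℂ) :=
  gaussianWeight (lebesgueSymmetric N) ((N : ℝ) / 4)

/-- The Gaussian Unitary Ensemble: density proportional to `exp (-(N/2) tr V²)`. -/
def GUE (N : ℕ) : Measure (Matrix (Fin N) (Fin N) ℂ) :=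
  gaussianWeight (lebesgueHermitian N) ((N : ℝ) / 2)

/-! ### The lattice -/

/-- The lattice `ℤ^d`. -/
abbrev Site (d : ℕ) : Type := Fin d → ℤ

/-- `x ∼ y`: nearest neighbours in `ℤ^d`. -/
def Adj {d : ℕ} (x y : Site d) : Prop := ∑ i, |x i - y i| = 1

/-- The finite set of nearest neighbours of `x`. -/
def neighbors {d : ℕ} (x : Site d) : Finset (Site d) :=
  open Classical in (Finset.Icc (x - 1) (x + 1)).filter (Adj x)

theorem mem_neighbors {d : ℕ} (x y : Site d) : y ∈ neighbors x ↔ Adj x y := by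
  classical
  simp only [neighbors, Finset.mem_filter, Finset.mem_Icc, and_iff_right_iff_imp]
  intro h
  have key : ∀ i, |x i - y i| ≤ 1 := fun i => by
    rw [← h]
    exact Finset.single_le_sum (f := fun i => |x i - y i|)
      (fun j _ => abs_nonneg _) (Finset.mem_univ i)
  refine ⟨fun i => ?_, fun i => ?_⟩ <;>
  · have := abs_le.mp (key i)
    simp only [Pi.sub_apply, Pi.add_apply, Pi.one_apply]
    omega

/-- The box `{-L, …, L}^d`. -/
def box (d L : ℕ) : Finset (Site d) := Finset.Icc (fun _ => -(L : ℤ)) (fun _ => (L : ℤ))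

/-! ### Orbital operators -/

/-- Random Hermitian potential entries `V x` and random hopping terms `W x y` satisfying the
Hermitian constraint. Only the values `W x y` at nearest neighbours are ever used. -/
structure OrbitalModel (d N : ℕ) (Ω : Type*) [MeasurableSpace Ω] where
  V : Site d → Ω → Matrix (Fin N) (Fin N) ℂ
  W : Site d → Site d → Ω → Matrix (Fin N) (Fin N) ℂ
  measurable_V : ∀ x, Measurable (V x)
  measurable_W : ∀ x y, Adj x y → Measurable (W x y)
  hermitian_V : ∀ x ω, (V x ω).IsHermitian
  hermitian_W : ∀ x y, Adj x y → ∀ ω, W y x ω = (W x y ω).conjTranspose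

/-- Restriction `P_Λ` of a `ℂ^N`-valued function on `ℤ^d` to `Λ`. -/
def restrict {d N : ℕ} (Λ : Finset (Site d)) :
    (Site d → Fin N → ℂ) →ₗ[ℂ] (Λ → Fin N → ℂ) where
  toFun ψ x := ψ x
  map_add' _ _ := rfl
  map_smul' _ _ := rfl

/-- Extension by zero `P_Λ^*` of a `ℂ^N`-valued function on `Λ` to `ℤ^d`. -/
def extend {d N : ℕ} (Λ : Finset (Site d)) :
    (Λ → Fin N → ℂ) →ₗ[ℂ] (Site d → Fin N → ℂ) where
  toFun ψ x := if h : x ∈ Λ then ψ ⟨x, h⟩ else 0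
  map_add' φ ψ := by
    funext x
    by_cases h : x ∈ Λ <;> simp [h]
  map_smul' c ψ := by
    funext x
    by_cases h : x ∈ Λ <;> simp [h]

namespace OrbitalModel

variable {d N : ℕ} {Ω : Type*} [MeasurableSpace Ω]

/-- `(H ψ)(x) = V(x) ψ(x) + ∑_{y ∼ x} W(x, y) ψ(y)`. -/
def hamiltonian (H : OrbitalModel d N Ω) (ω : Ω) :
    (Site d → Fin N → ℂ) →ₗ[ℂ] (Site d → Fin N → ℂ) where
  toFun ψ x := (H.V x ω).mulVec (ψ x) + ∑ y ∈ neighbors x, (H.W x y ω).mulVec (ψ y)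
  map_add' φ ψ := by
    funext x
    simp only [Pi.add_apply, Matrix.mulVec_add, Finset.sum_add_distrib]
    abel
  map_smul' c ψ := by
    funext x
    simp only [Pi.smul_apply, Matrix.mulVec_smul, RingHom.id_apply, smul_add, Finset.smul_sum]

/-- The finite-volume restriction `H_Λ = P_Λ H P_Λ^*`. -/
def finiteVolume (H : OrbitalModel d N Ω) (Λ : Finset (Site d)) (ω : Ω) :
    Module.End ℂ (Λ → Fin N → ℂ) :=
  restrict Λ ∘ₗ H.hamiltonian ω ∘ₗ extend Λ

/-- Joint independence of all the `V x` and of all the `W x y` with `x ∼ y` and `x` having even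
sum of coordinates (each edge of `ℤ^d` has exactly one such orientation). -/
def IsIndependent (H : OrbitalModel d N Ω) (P : Measure Ω) : Prop :=
  iIndepFun (β := fun _ => Matrix (Fin N) (Fin N) ℂ)
    (Sum.elim H.V
      fun e : {e : Site d × Site d // Even (∑ i, e.1 i) ∧ Adj e.1 e.2} => H.W e.1.1 e.1.2) P

/-- The orthogonal case: each `V x` is a GOE matrix, and the hopping terms are real. -/
def IsOrthogonal (H : OrbitalModel d N Ω) (P : Measure Ω) : Prop :=
  (∀ x, P.map (H.V x) = GOE N) ∧ ∀ x y, Adj x y → ∀ ω i j, (H.W x y ω i j).im = 0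

/-- The unitary case: each `V x` is a GUE matrix. -/
def IsUnitary (H : OrbitalModel d N Ω) (P : Measure Ω) : Prop :=
  ∀ x, P.map (H.V x) = GUE N

end OrbitalModel

/-! ### Counting eigenvalues -/

section Count

variable {E : Type*} [AddCommGroup E] [Module ℂ E] [Module.Finite ℂ E] [Module.Free ℂ E]

/-- The eigenvalues, with multiplicity, of an operator `A` that is Hermitian for some inner
product; all of them are real, so that taking real parts only changes the ambient type. -/
def eigenvalues (A : Module.End ℂ E) : Multiset ℝ :=
  (LinearMap.charpoly A).roots.map Complex.re

/-- `𝒩(A, I)`: the number of eigenvalues of `A` in `I`, with multiplicity. -/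
def eigenvalueCount (A : Module.End ℂ E) (I : Set ℝ) : ℕ :=
  open Classical in (eigenvalues A).countP (· ∈ I)

/-- `𝒩(A, ·)` as a measure on `ℝ`: a unit mass at each eigenvalue. -/
def eigenvalueMeasure (A : Module.End ℂ E) : Measure ℝ :=
  ((eigenvalues A).map Measure.dirac).sum

theorem eigenvalueMeasure_apply (A : Module.End ℂ E) {B : Set ℝ} (hB : MeasurableSet B) :
    eigenvalueMeasure A B = eigenvalueCount A B := by
  classical
  unfold eigenvalueMeasure eigenvalueCount
  induction eigenvalues A using Multiset.induction_on with
  | empty => simp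
  | cons a s ih =>
    simp only [Multiset.map_cons, Multiset.sum_cons, Measure.add_apply, ih,
      Measure.dirac_apply' _ hB, Multiset.countP_cons]
    by_cases h : a ∈ B <;> simp [h, add_comm]

end Count

/-! ### The limiting measure -/

/-- The measure `𝔼 𝒩(H_Λ, ·)`. -/
def meanEigenvalueMeasure {d N : ℕ} {Ω : Type*} [MeasurableSpace Ω] (P : Measure Ω)
    (H : OrbitalModel d N Ω) (Λ : Finset (Site d)) : Measure ℝ :=
  P.bind fun ω => eigenvalueMeasure (H.finiteVolume Λ ω)

/-- Vague convergence of measures on `ℝ`: convergence of the integrals of all continuous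
compactly supported functions. -/
def VagueLimit (μ : ℕ → Measure ℝ) (ρ : Measure ℝ) : Prop :=
  ∀ f : ℝ → ℝ, Continuous f → HasCompactSupport f →
    Tendsto (fun L => ∫ t, f t ∂(μ L)) atTop (𝓝 (∫ t, f t ∂ρ))

/-- `ρ` is the limit of `𝔼 𝒩(H_{Λ_L}, ·) / (N (2L+1)^d)` as `L → ∞`, where
`Λ_L = {-L, …, L}^d`. -/
def IsLimitingMeasure {d N : ℕ} {Ω : Type*} [MeasurableSpace Ω] (P : Measure Ω)
    (H : OrbitalModel d N Ω) (ρ : Measure ℝ) : Prop :=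
  VagueLimit
    (fun L => ((N : ℝ≥0∞) * (2 * (L : ℝ≥0∞) + 1) ^ d)⁻¹ • meanEigenvalueMeasure P H (box d L)) ρ

end Orbital

end

/-! Wegner's estimate, with a constant that does not deteriorate as `N` grows. Up to an independent
Hermitian summand, each `V x` equals `σ (g + gᵀ)` with `g` a real matrix of independent standard
Gaussians: `σ = 1 / √(2N)` for the GOE, and `σ = 1 / (2√N)` for the GUE, where the imaginary parts
of the entries form the independent summand. With everything else frozen, the task is to count
eigenvalues of `A = K + σ • symBlocks g`, with `K` a fixed Hermitian matrix.

Averaging the resolvent. Let `φ` be a real unit vector and `z` non-real. The row `r = gᵀ φ` of a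
block is a Gaussian vector; take an independent copy `r'` and rotate the pair `(r, r')` by an angle
`θ`, which preserves the Gaussian law. Along the rotation `A - z` moves by rank-two terms, so its
determinant is a quadratic trigonometric polynomial in `θ`. With `t = tan (θ / 2)` it becomes, up to
a power of `1 + t²`, a polynomial of degree at most 4 without real zeros, since `A` stays Hermitian.
The imaginary part of the logarithmic derivative of such a polynomial has `L¹` norm at most `4π`,
because each root contributes exactly `π`. Dividing by the total angle `2π` gives `E |σ r' · B φ| ≤
2`, where `B` is the imaginary part of `G + Gᵀ` on the block and `G` is the resolvent at `z`. Since
`r'` is independent of `B`, this bounds `σ E ‖B φ‖` (`lintegral_imSym_mulVec_le`). Averaging over `φ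
= ε / √N` with random signs `ε`, Khintchine's inequality bounds the Frobenius norm: `E ‖B‖ ≤ const ·
√N / σ`, which is of order `N` (`lintegral_frob_imSym_le`).

Counting with a Frobenius norm. Near an isolated eigenvalue and for small `η = Im z`, the resolvent
is nearly of rank one, so little is lost in using the Frobenius norm instead of the trace. If all
eigenvalues are more than `2η` apart, each contributes at least 1 to the integral over energy of the
sum over blocks of these norms (`countIcc_le_lintegral_frob`). The spectrum is almost surely simple,
so `η → 0` and Fatou's lemma give the bound for closed intervals (`lintegral_countIcc_le`).

Closed intervals control all sets by outer regularity of Lebesgue measure, vague limits inherit the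
bound, and Radon–Nikodym supplies the density. -/

noncomputable section
namespace Orbital

/-! ### Standard Gaussian vectors -/

/-- The law of independent standard Gaussian variables indexed by `α`. -/
def gaussianPi (α : Type*) [Fintype α] : Measure (α → ℝ) :=
  Measure.pi fun _ => gaussianReal 0 1

instance (α : Type*) [Fintype α] : IsProbabilityMeasure (gaussianPi α) := by
  unfold gaussianPi; infer_instance

theorem charFun_gaussianPi {α : Type*} [Fintype α] (t : α → ℝ) :
    ∫ x, Complex.exp (((∑ a, x a * t a : ℝ) : ℂ) * Complex.I) ∂(gaussianPi α)
      = Complex.exp (-(∑ a, t a ^ 2 : ℝ) / 2) := by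
  have h := charFun_pi (μ := fun _ : α => gaussianReal 0 1) (WithLp.toLp 2 t)
  rw [charFun_apply, integral_map (by fun_prop) (by fun_prop)] at h
  simp only [charFun_gaussianReal] at h
  rw [gaussianPi]
  refine Eq.trans (integral_congr_ae (ae_of_all _ fun x => ?_)) (h.trans ?_)
  · simp [PiLp.inner_apply, mul_comm]
  · rw [← Complex.exp_sum]
    congr 1
    simp [Finset.sum_div, neg_div]

/-- `M` is the adjoint of `L` and is isometric, so the characteristic function of the image at `t`
is that of the source at `M t`. Since `L` need not be injective, this covers rotations, projections
onto a linear functional and symmetrisation alike. -/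
theorem gaussianPi_map {α β : Type*} [Fintype α] [Fintype β]
    (L : (α → ℝ) →ₗ[ℝ] (β → ℝ)) (M : (β → ℝ) → (α → ℝ))
    (hadj : ∀ x t, ∑ b, L x b * t b = ∑ a, x a * M t a)
    (hnorm : ∀ t, ∑ a, M t a ^ 2 = ∑ b, t b ^ 2) :
    (gaussianPi α).map L = gaussianPi β := by
  have hL : Measurable L := L.continuous_of_finiteDimensional.measurable
  have : IsProbabilityMeasure ((gaussianPi α).map L) :=
    Measure.isProbabilityMeasure_map hL.aemeasurable
  have key : ((gaussianPi α).map L).map (WithLp.toLp 2) = (gaussianPi β).map (WithLp.toLp 2) := by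
    have h1 : IsProbabilityMeasure (((gaussianPi α).map L).map (WithLp.toLp 2)) :=
      Measure.isProbabilityMeasure_map (by fun_prop)
    have h2 : IsProbabilityMeasure ((gaussianPi β).map (WithLp.toLp 2)) :=
      Measure.isProbabilityMeasure_map (by fun_prop)
    refine Measure.ext_of_charFun (E := EuclideanSpace ℝ β) (funext fun t => ?_)
    rw [charFun_apply, charFun_apply, integral_map (by fun_prop) (by fun_prop),
      integral_map hL.aemeasurable (by fun_prop), integral_map (by fun_prop) (by fun_prop)]
    have e1 := charFun_gaussianPi (fun b => t b)
    have e2 := charFun_gaussianPi (M fun b => t b)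
    rw [hnorm] at e2
    refine Eq.trans (integral_congr_ae (ae_of_all _ fun x => ?_)) (e2.trans (e1.symm.trans
      (integral_congr_ae (ae_of_all _ fun x => ?_))))
    · simp only
      rw [← hadj]
      simp [PiLp.inner_apply, mul_comm]
    · simp [PiLp.inner_apply, mul_comm]
  have hc : ∀ ν : Measure (β → ℝ), (ν.map (WithLp.toLp 2)).map WithLp.ofLp = ν := fun ν => by
    rw [Measure.map_map (by fun_prop) (by fun_prop)]
    exact Measure.map_id
  have := congrArg (Measure.map (WithLp.ofLp)) key
  rwa [hc, hc] at this

theorem gaussianPi_map_smul_sum {α : Type*} [Fintype α] (v : α → ℝ) (hv : ∑ a, v a ^ 2 = 1) :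
    (gaussianPi α).map (fun x => ∑ a, x a * v a) = gaussianReal 0 1 := by
  let L : (α → ℝ) →ₗ[ℝ] (Unit → ℝ) :=
    { toFun := fun x _ => ∑ a, x a * v a
      map_add' := fun x y => by funext _; simp [add_mul, Finset.sum_add_distrib]
      map_smul' := fun c x => by funext _; simp [Finset.mul_sum, mul_assoc] }
  have h := gaussianPi_map L (fun t a => t () * v a)
    (fun x t => by simp [L, Finset.sum_mul]; exact Finset.sum_congr rfl fun a _ => by ring)
    (fun t => by simp [mul_pow, ← Finset.mul_sum, hv])
  have h2 := congrArg (Measure.map fun y : Unit → ℝ => y ()) h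
  rw [Measure.map_map (by fun_prop) L.continuous_of_finiteDimensional.measurable] at h2
  refine h2.trans ?_
  exact (measurePreserving_eval (fun _ : Unit => gaussianReal 0 1) ()).map_eq

/-- The first absolute moment of a standard Gaussian variable. -/
def gaussianAbs : ℝ≥0∞ := ∫⁻ x, ‖x‖ₑ ∂(gaussianReal 0 1)

theorem gaussianAbs_ne_zero : gaussianAbs ≠ 0 := by
  unfold gaussianAbs
  rw [Ne, lintegral_eq_zero_iff (by fun_prop)]
  intro h
  have h0 : ∀ᵐ x ∂(gaussianReal 0 1), x = 0 := by
    filter_upwards [h] with x hx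
    simpa using hx
  have : NullSingletonClass (gaussianReal 0 1) := nullSingletonClass_gaussianReal one_ne_zero
  have h1 : ∀ᵐ x ∂(gaussianReal 0 1), x ≠ 0 := by
    simp only [ae_iff, not_not, Set.ofPred_eq_eq_singleton, measure_singleton]
  have := (h0.and h1).mono fun x hx => hx.2 hx.1
  exact IsProbabilityMeasure.ne_zero _ (by simpa using this)

theorem lintegral_gaussianPi_enorm_sum {α : Type*} [Fintype α] (v : α → ℝ) :
    ∫⁻ x, ‖∑ a, x a * v a‖ₑ ∂(gaussianPi α)
      = ENNReal.ofReal (√(∑ a, v a ^ 2)) * gaussianAbs := by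
  set s := √(∑ a, v a ^ 2) with hs
  have hs2 : s ^ 2 = ∑ a, v a ^ 2 := Real.sq_sqrt (Finset.sum_nonneg fun _ _ => sq_nonneg _)
  rcases eq_or_ne s 0 with h0 | h0
  · have hv : ∀ a, v a = 0 := fun a => by
      have := (Finset.sum_eq_zero_iff_of_nonneg (fun a _ => sq_nonneg (v a))).1
        (by rw [← hs2, h0]; simp) a (Finset.mem_univ a)
      simpa using this
    simp [hv, h0]
  · have hsp : 0 ≤ s := Real.sqrt_nonneg _
    have h1 : ∑ a, (v a / s) ^ 2 = 1 := by
      simp only [div_pow, ← Finset.sum_div]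
      rw [← hs2, div_self (pow_ne_zero 2 h0)]
    have e : ∀ x : α → ℝ, ‖∑ a, x a * v a‖ₑ = ENNReal.ofReal s * ‖∑ a, x a * (v a / s)‖ₑ := by
      intro x
      rw [← Real.enorm_of_nonneg hsp, ← enorm_mul, Finset.mul_sum]
      congr 1
      exact Finset.sum_congr rfl fun a _ => by field_simp
    simp_rw [e]
    rw [lintegral_const_mul _ (by fun_prop), gaussianAbs, ← gaussianPi_map_smul_sum _ h1,
      lintegral_map (by fun_prop) (by fun_prop)]

/-! ### Logarithmic derivatives on the real line -/

theorem lintegral_im_inv_sub (ρ : ℂ) (hρ : ρ.im ≠ 0) :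
    ∫⁻ t : ℝ, ‖(1 / ((t : ℂ) - ρ)).im‖ₑ = ENNReal.ofReal Real.pi := by
  have hy : 0 < |ρ.im| := abs_pos.2 hρ
  have e : ∀ t : ℝ, ‖(1 / ((t : ℂ) - ρ)).im‖ₑ
      = ENNReal.ofReal (|ρ.im|⁻¹ * (1 + ((t - ρ.re) / |ρ.im|) ^ 2)⁻¹) := by
    intro t
    rw [← ofReal_norm]
    congr 1
    have h1 : ((t : ℂ) - ρ).im = -ρ.im := by simp
    have h2 : Complex.normSq ((t : ℂ) - ρ) = (t - ρ.re) ^ 2 + |ρ.im| ^ 2 := by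
      rw [sq_abs, Complex.normSq_apply]; simp; ring
    rw [one_div, Complex.inv_im, h1, h2, neg_neg, norm_div, Real.norm_eq_abs, Real.norm_eq_abs,
      abs_of_nonneg (a := (t - ρ.re) ^ 2 + |ρ.im| ^ 2) (by positivity)]
    field_simp
    ring
  simp_rw [e]
  have hint : Integrable fun t : ℝ => |ρ.im|⁻¹ * (1 + ((t - ρ.re) / |ρ.im|) ^ 2)⁻¹ :=
    ((integrable_inv_one_add_sq.comp_div hy.ne').comp_sub_right ρ.re).const_mul _
  rw [← ofReal_integral_eq_lintegral_ofReal hint (ae_of_all _ fun t => by positivity),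
    integral_const_mul,
    integral_sub_right_eq_self (fun t : ℝ => (1 + (t / |ρ.im|) ^ 2)⁻¹) ρ.re,
    Measure.integral_comp_div (fun t : ℝ => (1 + t ^ 2)⁻¹), integral_univ_inv_one_add_sq,
    abs_abs, smul_eq_mul, ← mul_assoc, inv_mul_cancel₀ hy.ne', one_mul]

open Polynomial in
-- `P' / P` is the sum of `1 / (t - ρ)` over the roots, and each summand contributes exactly `π`
-- wherever the non-real root `ρ` lies. Hence the bound sees only the degree.
theorem lintegral_im_logDeriv_le (P : ℂ[X]) (hP : ∀ t : ℝ, P.eval (t : ℂ) ≠ 0) :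
    ∫⁻ t : ℝ, ‖(P.derivative.eval (t : ℂ) / P.eval (t : ℂ)).im‖ₑ
      ≤ P.natDegree * ENNReal.ofReal Real.pi := by
  have hP0 : P ≠ 0 := fun h => hP 0 (by simp [h])
  have hroot : ∀ ρ ∈ P.roots, ρ.im ≠ 0 := by
    intro ρ hρ h
    refine hP ρ.re ?_
    have : (ρ.re : ℂ) = ρ := Complex.ext (by simp) (by simp [h])
    rw [this]
    exact (mem_roots hP0).1 hρ
  have e : ∀ t : ℝ, ‖(P.derivative.eval (t : ℂ) / P.eval (t : ℂ)).im‖ₑ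
      ≤ (P.roots.map fun ρ => ‖(1 / ((t : ℂ) - ρ)).im‖ₑ).sum := by
    intro t
    rw [(IsAlgClosed.splits P).eval_derivative_div_eval_of_ne_zero (hP t)]
    induction P.roots using Multiset.induction_on with
    | empty => simp
    | cons a s ih =>
      simp only [Multiset.map_cons, Multiset.sum_cons, Complex.add_im]
      exact (enorm_add_le _ _).trans (add_le_add le_rfl ih)
  refine (lintegral_mono e).trans ?_
  have h2 : ∀ s : Multiset ℂ, (∀ ρ ∈ s, ρ.im ≠ 0) →
      ∫⁻ t : ℝ, (s.map fun ρ => ‖(1 / ((t : ℂ) - ρ)).im‖ₑ).sum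
        = Multiset.card s * ENNReal.ofReal Real.pi := by
    intro s
    induction s using Multiset.induction_on with
    | empty => simp
    | cons a s ih =>
      intro hs
      simp only [Multiset.map_cons, Multiset.sum_cons]
      rw [lintegral_add_left (by fun_prop), ih fun ρ h => hs ρ (Multiset.mem_cons_of_mem h),
        lintegral_im_inv_sub a (hs a (Multiset.mem_cons_self a s)), Multiset.card_cons]
      push_cast
      ring
  rw [h2 _ hroot]
  gcongr
  exact P.card_roots'

/-! ### Determinants along a circle of rank-two perturbations -/

section RankTwo

open Matrix

variable {n : Type*} [Fintype n] [DecidableEq n]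

/-- The symmetric rank-two perturbation `A + u vᵀ + v uᵀ`. -/
def rankTwo (A : Matrix n n ℂ) (u v : n → ℂ) : Matrix n n ℂ :=
  A + (vecMulVec u v + vecMulVec v u)

/-- The derivative of `log det` at `A` in the direction `u wᵀ + w uᵀ`. -/
def logDetDeriv (A : Matrix n n ℂ) (u w : n → ℂ) : ℂ := w ⬝ᵥ A⁻¹ *ᵥ u + u ⬝ᵥ A⁻¹ *ᵥ w

/-- The first coordinate of the rational parametrisation of the unit circle. -/
def rotCos (t : ℝ) : ℝ := (1 - t ^ 2) / (1 + t ^ 2)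

/-- The second coordinate of the rational parametrisation of the unit circle. -/
def rotSin (t : ℝ) : ℝ := 2 * t / (1 + t ^ 2)

theorem rotCos_sq_add_rotSin_sq (t : ℝ) : rotCos t ^ 2 + rotSin t ^ 2 = 1 := by
  have : (1 + t ^ 2) ≠ 0 := by positivity
  unfold rotCos rotSin
  field_simp
  ring

omit [Fintype n] [DecidableEq n] in
theorem rankTwo_add (A : Matrix n n ℂ) (u v w : n → ℂ) :
    rankTwo A u (v + w) = rankTwo (rankTwo A u v) u w := by
  simp only [rankTwo, vecMulVec_add, add_vecMulVec]
  abel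

/-- The perturbation factors through a two-dimensional space, so the matrix determinant lemma
reduces the ratio of determinants to a 2 × 2 determinant. It is a polynomial of degree two in `v`.
-/
theorem det_rankTwo (A : Matrix n n ℂ) (hA : A.det ≠ 0) (u v : n → ℂ) :
    (rankTwo A u v).det = A.det * ((1 + v ⬝ᵥ A⁻¹ *ᵥ u) * (1 + u ⬝ᵥ A⁻¹ *ᵥ v)
      - (u ⬝ᵥ A⁻¹ *ᵥ u) * (v ⬝ᵥ A⁻¹ *ᵥ v)) := by
  have h : rankTwo A u v = A + (Matrix.of ![u, v])ᵀ * Matrix.of ![v, u] := by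
    ext i j
    simp [rankTwo, vecMulVec_apply, Matrix.mul_apply, Fin.sum_univ_two]
  have hA' : IsUnit A.det := isUnit_iff_ne_zero.2 hA
  rw [h, det_add_mul _ _ hA', det_fin_two]
  have e : ∀ i j : Fin 2, (Matrix.of ![v, u] * A⁻¹ * (Matrix.of ![u, v])ᵀ) i j
      = (![v, u] i) ⬝ᵥ A⁻¹ *ᵥ (![u, v] j) := by
    intro i j
    rw [Matrix.mul_assoc, Matrix.mul_apply]
    simp [dotProduct, Matrix.mul_apply, mulVec]
  simp only [Matrix.add_apply, e, one_apply]
  refine congrArg (A.det * ·) ?_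
  simp
  ring

/-- The derivative of `log det` in a rank-two direction. -/
theorem rankTwo_linear_coeff (A : Matrix n n ℂ) (hA : A.det ≠ 0) (u v w : n → ℂ)
    (hv : (rankTwo A u v).det ≠ 0) :
    (w ⬝ᵥ A⁻¹ *ᵥ u) * (1 + u ⬝ᵥ A⁻¹ *ᵥ v) + (1 + v ⬝ᵥ A⁻¹ *ᵥ u) * (u ⬝ᵥ A⁻¹ *ᵥ w)
        - (u ⬝ᵥ A⁻¹ *ᵥ u) * (v ⬝ᵥ A⁻¹ *ᵥ w + w ⬝ᵥ A⁻¹ *ᵥ v)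
      = ((1 + v ⬝ᵥ A⁻¹ *ᵥ u) * (1 + u ⬝ᵥ A⁻¹ *ᵥ v) - (u ⬝ᵥ A⁻¹ *ᵥ u) * (v ⬝ᵥ A⁻¹ *ᵥ v))
        * logDetDeriv (rankTwo A u v) u w := by
  -- The determinants at `v + w` and `v - w` are expanded both from `A` and from `rankTwo A u v`;
  -- half their difference isolates the part linear in `w`.
  have h1 := det_rankTwo A hA u (v + w)
  have h2 := det_rankTwo A hA u (v + -w)
  rw [rankTwo_add, det_rankTwo _ hv, det_rankTwo A hA u v, mul_assoc] at h1 h2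
  have h1 := mul_left_cancel₀ hA h1
  have h2 := mul_left_cancel₀ hA h2
  simp only [add_dotProduct, mulVec_add, dotProduct_add, mulVec_neg, dotProduct_neg,
    neg_dotProduct] at h1 h2
  unfold logDetDeriv
  linear_combination (h2 - h1) / 2

open Polynomial in
-- Here `t = tan (θ / 2)` and `2 / (1 + t²) dt = dθ`: the integrand is the imaginary part of the
-- derivative of `log det` with respect to the angle as `r` is rotated towards `r'`.
theorem lintegral_im_rankTwo_le (A : Matrix n n ℂ) (u r r' : n → ℂ)
    (hA : ∀ c s : ℝ, (rankTwo A u ((c : ℂ) • r + (s : ℂ) • r')).det ≠ 0) :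
    ∫⁻ t : ℝ, ENNReal.ofReal (2 / (1 + t ^ 2)) *
      ‖(logDetDeriv (rankTwo A u ((rotCos t : ℂ) • r + (rotSin t : ℂ) • r')) u
        (-(rotSin t : ℂ) • r + (rotCos t : ℂ) • r')).im‖ₑ
      ≤ 4 * ENNReal.ofReal Real.pi := by
  have hA0 : A.det ≠ 0 := by simpa [rankTwo] using hA 0 0
  set G := A⁻¹ with hG
  -- `P` is the ratio of determinants given by `det_rankTwo`, multiplied by `(1 + t²)²` to clear
  -- denominators.
  let P : ℂ[X] := ((1 + X ^ 2) + (1 - X ^ 2) * C (r ⬝ᵥ G *ᵥ u) + 2 * X * C (r' ⬝ᵥ G *ᵥ u))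
      * ((1 + X ^ 2) + (1 - X ^ 2) * C (u ⬝ᵥ G *ᵥ r) + 2 * X * C (u ⬝ᵥ G *ᵥ r'))
    - C (u ⬝ᵥ G *ᵥ u) * ((1 - X ^ 2) * (1 - X ^ 2) * C (r ⬝ᵥ G *ᵥ r)
      + 2 * X * (1 - X ^ 2) * C (r ⬝ᵥ G *ᵥ r' + r' ⬝ᵥ G *ᵥ r)
      + 4 * X ^ 2 * C (r' ⬝ᵥ G *ᵥ r'))
  have hdeg : P.natDegree ≤ 4 := by
    simp only [P]
    compute_degree
  have key : ∀ t : ℝ, P.eval (t : ℂ) ≠ 0 ∧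
      (P.derivative.eval (t : ℂ) / P.eval (t : ℂ)).im = 2 / (1 + t ^ 2) *
      (logDetDeriv (rankTwo A u ((rotCos t : ℂ) • r + (rotSin t : ℂ) • r')) u
        (-(rotSin t : ℂ) • r + (rotCos t : ℂ) • r')).im := by
    intro t
    have ht : (1 + (t : ℂ) ^ 2) ≠ 0 := by
      have : ((1 + t ^ 2 : ℝ) : ℂ) ≠ 0 := Complex.ofReal_ne_zero.2 (by positivity)
      simpa using this
    have hc : (rotCos t : ℂ) = (1 - (t : ℂ) ^ 2) / (1 + (t : ℂ) ^ 2) := by simp [rotCos]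
    have hs : (rotSin t : ℂ) = 2 * (t : ℂ) / (1 + (t : ℂ) ^ 2) := by simp [rotSin]
    have hdet := hA (rotCos t) (rotSin t)
    set v := (rotCos t : ℂ) • r + (rotSin t : ℂ) • r' with hv
    set w := -(rotSin t : ℂ) • r + (rotCos t : ℂ) • r' with hw
    have hlin := rankTwo_linear_coeff A hA0 u v w hdet
    rw [← hG] at hlin
    have hq : (1 + v ⬝ᵥ G *ᵥ u) * (1 + u ⬝ᵥ G *ᵥ v) - (u ⬝ᵥ G *ᵥ u) * (v ⬝ᵥ G *ᵥ v) ≠ 0 := by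
      intro h
      rw [det_rankTwo A hA0, ← hG, h, mul_zero] at hdet
      exact hdet rfl
    set τ := logDetDeriv (rankTwo A u v) u w with hτ
    have e1 : P.eval (t : ℂ) = (1 + (t : ℂ) ^ 2) ^ 2 *
        ((1 + v ⬝ᵥ G *ᵥ u) * (1 + u ⬝ᵥ G *ᵥ v) - (u ⬝ᵥ G *ᵥ u) * (v ⬝ᵥ G *ᵥ v)) := by
      simp only [P, hv, hc, hs, add_dotProduct, mulVec_add, dotProduct_add, smul_dotProduct,
        mulVec_smul, dotProduct_smul, smul_eq_mul]
      simp
      field_simp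
      ring
    have e2 : P.derivative.eval (t : ℂ) = 4 * t * (1 + (t : ℂ) ^ 2) *
        ((1 + v ⬝ᵥ G *ᵥ u) * (1 + u ⬝ᵥ G *ᵥ v) - (u ⬝ᵥ G *ᵥ u) * (v ⬝ᵥ G *ᵥ v))
        + 2 * (1 + (t : ℂ) ^ 2) * ((w ⬝ᵥ G *ᵥ u) * (1 + u ⬝ᵥ G *ᵥ v)
          + (1 + v ⬝ᵥ G *ᵥ u) * (u ⬝ᵥ G *ᵥ w)
          - (u ⬝ᵥ G *ᵥ u) * (v ⬝ᵥ G *ᵥ w + w ⬝ᵥ G *ᵥ v)) := by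
      simp only [P, hv, hw, hc, hs, add_dotProduct, mulVec_add, dotProduct_add, smul_dotProduct,
        mulVec_smul, dotProduct_smul, smul_eq_mul]
      simp
      field_simp
      ring
    refine ⟨by rw [e1]; exact mul_ne_zero (pow_ne_zero 2 ht) hq, ?_⟩
    rw [hlin] at e2
    -- The factor `(1 + t²)²` only adds a real term to the logarithmic derivative, which the
    -- imaginary part ignores.
    have e3 : P.derivative.eval (t : ℂ) / P.eval (t : ℂ)
        = ((4 * t / (1 + t ^ 2) : ℝ) : ℂ) + ((2 / (1 + t ^ 2) : ℝ) : ℂ) * τ := by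
      rw [e1, e2]
      push_cast
      field_simp
    rw [e3, Complex.add_im, Complex.ofReal_im, zero_add, Complex.im_ofReal_mul]
  refine le_trans (le_of_eq (lintegral_congr fun t => ?_))
    ((lintegral_im_logDeriv_le P fun t => (key t).1).trans ?_)
  · have h2 : 0 ≤ 2 / (1 + t ^ 2) := by positivity
    rw [(key t).2, enorm_mul, Real.enorm_of_nonneg h2]
  · gcongr
    exact_mod_cast hdeg

end RankTwo

open Matrix

/-! ### Measurability of determinants and inverses -/

section Measurability

variable {T n : Type*} [MeasurableSpace T] [Fintype n] [DecidableEq n]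

theorem measurable_det {A : T → Matrix n n ℂ} (hA : ∀ i j, Measurable fun t => A t i j) :
    Measurable fun t => (A t).det := by
  simp only [Matrix.det_apply]
  fun_prop

theorem measurable_inv_apply {A : T → Matrix n n ℂ} (hA : ∀ i j, Measurable fun t => A t i j)
    (i j : n) : Measurable fun t => (A t)⁻¹ i j := by
  simp only [Matrix.inv_def, Ring.inverse_eq_inv', Matrix.smul_apply, smul_eq_mul,
    Matrix.adjugate_apply]
  refine (measurable_det hA).inv.mul (measurable_det fun a b => ?_)
  by_cases h : a = j
  · subst h; simp
  · simpa [Matrix.updateRow_ne h] using hA a b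

theorem measurable_logDetDeriv {A : T → Matrix n n ℂ} (hA : ∀ i j, Measurable fun t => A t i j)
    (u : n → ℂ) {w : T → n → ℂ} (hw : ∀ i, Measurable fun t => w t i) :
    Measurable fun t => logDetDeriv (A t) u (w t) := by
  have := measurable_inv_apply hA
  simp only [logDetDeriv, dotProduct, mulVec]
  refine Measurable.add ?_ ?_
  · exact Finset.measurable_sum _ fun i _ => (hw i).mul
      (Finset.measurable_sum _ fun j _ => (this i j).mul_const _)
  · exact Finset.measurable_sum _ fun i _ => Measurable.const_mul
      (Finset.measurable_sum _ fun j _ => (this i j).mul (hw j)) _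

end Measurability

/-! ### Symmetrised Gaussian blocks and the rotation of a row -/

section Blocks

variable {X ι : Type*} [Fintype X] [DecidableEq X] [Fintype ι] [DecidableEq ι]

/-- The block diagonal matrix with blocks `g_x + g_xᵀ`. -/
def symBlocks (g : X × ι × ι → ℝ) : Matrix (X × ι) (X × ι) ℂ :=
  Matrix.of fun p q => if p.1 = q.1 then ((g (p.1, p.2, q.2) + g (p.1, q.2, p.2) : ℝ) : ℂ) else 0

/-- A real vector placed in the block `x`. -/
def blockVec (x : X) (v : ι → ℝ) : X × ι → ℂ := fun p => if p.1 = x then (v p.2 : ℂ) else 0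

/-- Add the rank-one matrix `φ δᵀ` to the block `x`. -/
def addRankOne (x : X) (φ : ι → ℝ) (g : X × ι × ι → ℝ) (δ : ι → ℝ) : X × ι × ι → ℝ :=
  fun p => g p + if p.1 = x then φ p.2.1 * δ p.2.2 else 0

/-- The row `g_xᵀ φ` of the block `x` in the direction `φ`. -/
def blockRow (x : X) (φ : ι → ℝ) (g : X × ι × ι → ℝ) : ι → ℝ :=
  fun k => ∑ i, φ i * g (x, i, k)

omit [Fintype X] [Fintype ι] [DecidableEq ι] in
theorem symBlocks_addRankOne (x : X) (φ δ : ι → ℝ) (g : X × ι × ι → ℝ) :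
    symBlocks (addRankOne x φ g δ) = rankTwo (symBlocks g) (blockVec x φ) (blockVec x δ) := by
  ext ⟨a, i⟩ ⟨b, j⟩
  simp only [symBlocks, addRankOne, rankTwo, blockVec, Matrix.of_apply, Matrix.add_apply,
    vecMulVec_apply]
  by_cases h : a = b
  · subst h
    by_cases h2 : a = x
    · simp [h2]; ring
    · simp [h2]
  · by_cases h2 : a = x
    · have : b ≠ x := fun h3 => h (h2.trans h3.symm)
      simp [h, this]
    · simp [h, h2]

omit [Fintype X] [Fintype ι] [DecidableEq ι] in
theorem addRankOne_add (x : X) (φ δ δ' : ι → ℝ) (g : X × ι × ι → ℝ) :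
    addRankOne x φ g (δ + δ') = addRankOne x φ (addRankOne x φ g δ) δ' := by
  funext p
  simp only [addRankOne, Pi.add_apply]
  split_ifs <;> ring

omit [Fintype X] [DecidableEq ι] in
-- Adding `φ δᵀ` to a block is adjoint to extracting the row in the direction `φ`; this yields both
-- the adjoint and the isometry property of `rotateRow`.
theorem sum_addRankOne_mul [Fintype X] (x : X) (φ δ : ι → ℝ) (g h : X × ι × ι → ℝ) :
    ∑ p, addRankOne x φ g δ p * h p = ∑ p, g p * h p + ∑ k, δ k * blockRow x φ h k := by
  simp only [addRankOne, add_mul, Finset.sum_add_distrib, Fintype.sum_prod_type, blockRow,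
    Finset.mul_sum, ite_mul, zero_mul]
  congr 1
  rw [Finset.sum_eq_single x (by intro b _ hb; simp [hb]) (by simp)]
  simp only [if_true]
  rw [Finset.sum_comm]
  exact Finset.sum_congr rfl fun k _ => Finset.sum_congr rfl fun i _ => by ring

omit [Fintype X] [DecidableEq ι] in
theorem blockRow_addRankOne (x : X) (φ δ : ι → ℝ) (hφ : ∑ i, φ i ^ 2 = 1) (g : X × ι × ι → ℝ) :
    blockRow x φ (addRankOne x φ g δ) = blockRow x φ g + δ := by
  funext k
  simp only [blockRow, addRankOne, if_true, mul_add, Finset.sum_add_distrib, Pi.add_apply]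
  congr 1
  calc ∑ i, φ i * (φ i * δ k) = (∑ i, φ i ^ 2) * δ k := by
        rw [Finset.sum_mul]
        exact Finset.sum_congr rfl fun i _ => by ring
    _ = δ k := by rw [hφ, one_mul]

/-- Rotation of the row `g_xᵀ φ` into an auxiliary vector. -/
def rotateRow (x : X) (φ : ι → ℝ) (c s : ℝ) :
    ((X × ι × ι) ⊕ ι → ℝ) →ₗ[ℝ] ((X × ι × ι) ⊕ ι → ℝ) where
  toFun y := Sum.elim
    (addRankOne x φ (y ∘ Sum.inl) ((c - 1) • blockRow x φ (y ∘ Sum.inl) + s • (y ∘ Sum.inr)))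
    (-s • blockRow x φ (y ∘ Sum.inl) + c • (y ∘ Sum.inr))
  map_add' y z := by
    funext p
    rcases p with p | k
    · simp only [Sum.elim_inl, addRankOne, blockRow, Pi.add_apply, Pi.smul_apply,
        Function.comp_apply, mul_add, Finset.sum_add_distrib, smul_eq_mul]
      split_ifs <;> ring
    · simp only [Sum.elim_inr, blockRow, Pi.add_apply, Pi.smul_apply,
        Function.comp_apply, mul_add, Finset.sum_add_distrib, smul_eq_mul]
      ring
  map_smul' a y := by
    have h : blockRow x φ ((a • y) ∘ Sum.inl) = a • blockRow x φ (y ∘ Sum.inl) := by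
      funext k
      simp only [blockRow, Pi.smul_apply, Function.comp_apply, smul_eq_mul, Finset.mul_sum]
      exact Finset.sum_congr rfl fun i _ => by ring
    funext p
    rcases p with p | k
    · simp only [Sum.elim_inl, addRankOne, Pi.add_apply, Pi.smul_apply, h,
        Function.comp_apply, smul_eq_mul, RingHom.id_apply]
      split_ifs <;> ring
    · simp only [Sum.elim_inr, Pi.add_apply, Pi.smul_apply, h,
        Function.comp_apply, smul_eq_mul, RingHom.id_apply]
      ring

omit [DecidableEq ι] in
-- For a unit vector `φ` this is an orthogonal map: it rotates the pair (row, auxiliary vector) and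
-- fixes the part of `g` orthogonal to it. Its adjoint is the rotation by the opposite angle, hence
-- `-s`.
theorem gaussianPi_map_rotateRow (x : X) (φ : ι → ℝ) (hφ : ∑ i, φ i ^ 2 = 1) (c s : ℝ)
    (hcs : c ^ 2 + s ^ 2 = 1) :
    (gaussianPi ((X × ι × ι) ⊕ ι)).map (rotateRow x φ c s) = gaussianPi ((X × ι × ι) ⊕ ι) := by
  refine gaussianPi_map _ (rotateRow x φ c (-s)) (fun y t => ?_) (fun t => ?_)
  · have h2 : ∀ p, y p * rotateRow x φ c (-s) t p = rotateRow x φ c (-s) t p * y p :=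
      fun p => mul_comm _ _
    simp_rw [h2]
    simp only [Fintype.sum_sum_type, rotateRow, LinearMap.coe_mk, AddHom.coe_mk, Sum.elim_inl,
      Sum.elim_inr]
    have e1 := sum_addRankOne_mul x φ
      ((c - 1) • blockRow x φ (y ∘ Sum.inl) + s • (y ∘ Sum.inr)) (y ∘ Sum.inl) (t ∘ Sum.inl)
    have e2 := sum_addRankOne_mul x φ
      ((c - 1) • blockRow x φ (t ∘ Sum.inl) + -s • (t ∘ Sum.inr)) (t ∘ Sum.inl) (y ∘ Sum.inl)
    simp only [Function.comp_apply] at e1 e2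
    rw [e1, e2]
    simp only [Pi.add_apply, Pi.smul_apply, smul_eq_mul, Function.comp_apply, add_assoc]
    rw [← Finset.sum_add_distrib, ← Finset.sum_add_distrib]
    congr 1
    · exact Finset.sum_congr rfl fun p _ => mul_comm _ _
    · exact Finset.sum_congr rfl fun k _ => by ring
  · simp only [Fintype.sum_sum_type, rotateRow, LinearMap.coe_mk, AddHom.coe_mk, Sum.elim_inl,
      Sum.elim_inr, sq]
    set δ := (c - 1) • blockRow x φ (t ∘ Sum.inl) + -s • (t ∘ Sum.inr) with hδ
    have e1 := sum_addRankOne_mul x φ δ (t ∘ Sum.inl) (addRankOne x φ (t ∘ Sum.inl) δ)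
    have e2 := sum_addRankOne_mul x φ δ (t ∘ Sum.inl) (t ∘ Sum.inl)
    have e3 : ∑ p, (t ∘ Sum.inl) p * addRankOne x φ (t ∘ Sum.inl) δ p
        = ∑ p, addRankOne x φ (t ∘ Sum.inl) δ p * (t ∘ Sum.inl) p :=
      Finset.sum_congr rfl fun p _ => mul_comm _ _
    rw [e1, e3, e2, blockRow_addRankOne x φ δ hφ, add_assoc, add_assoc]
    simp only [Function.comp_apply]
    congr 1
    rw [← Finset.sum_add_distrib, ← Finset.sum_add_distrib]
    refine Finset.sum_congr rfl fun k _ => ?_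
    simp only [hδ, Pi.add_apply, Pi.smul_apply, smul_eq_mul, Function.comp_apply]
    linear_combination (blockRow x φ (t ∘ Sum.inl) k ^ 2 + t (Sum.inr k) ^ 2) * hcs

/-- The imaginary part of the symmetrised block `x` of a matrix. -/
def imSym (G : Matrix (X × ι) (X × ι) ℂ) (x : X) : Matrix ι ι ℝ :=
  Matrix.of fun k j => (G (x, k) (x, j) + G (x, j) (x, k)).im

/-- A symmetric real perturbation tests the inverse only through its symmetrisation, which is why
`imSym` appears and not the imaginary part of the block itself. -/
theorem logDetDeriv_im (A : Matrix (X × ι) (X × ι) ℂ) (σ : ℝ) (x : X) (φ r : ι → ℝ) :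
    (logDetDeriv A ((σ : ℂ) • blockVec x φ) (blockVec x r)).im
      = ∑ k, r k * (σ * ∑ j, imSym A⁻¹ x k j * φ j) := by
  have e : ∀ (G : Matrix (X × ι) (X × ι) ℂ) (a b : ι → ℝ),
      blockVec x a ⬝ᵥ G *ᵥ blockVec x b = ∑ k, ∑ j, (a k : ℂ) * (b j : ℂ) * G (x, k) (x, j) := by
    intro G a b
    simp only [dotProduct, mulVec, blockVec, Fintype.sum_prod_type, ite_mul, zero_mul, mul_ite,
      mul_zero]
    simp only [Finset.sum_ite_irrel, Finset.sum_const_zero, Finset.sum_ite_eq', Finset.mem_univ,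
      if_true, Finset.mul_sum]
    exact Finset.sum_congr rfl fun k _ => Finset.sum_congr rfl fun j _ => by ring
  rw [logDetDeriv, mulVec_smul, dotProduct_smul, smul_dotProduct, e, e, ← smul_add, smul_eq_mul,
    Complex.im_ofReal_mul, Finset.sum_comm (f := fun k j => (φ k : ℂ) * (r j : ℂ) * _),
    ← Finset.sum_add_distrib, Complex.im_sum, Finset.mul_sum]
  refine Finset.sum_congr rfl fun k _ => ?_
  rw [← Finset.sum_add_distrib, Complex.im_sum, Finset.mul_sum, Finset.mul_sum, Finset.mul_sum]
  refine Finset.sum_congr rfl fun j _ => ?_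
  have : (r k : ℂ) * (φ j : ℂ) * A⁻¹ (x, k) (x, j) + (φ j : ℂ) * (r k : ℂ) * A⁻¹ (x, j) (x, k)
      = ((r k * φ j : ℝ) : ℂ) * (A⁻¹ (x, k) (x, j) + A⁻¹ (x, j) (x, k)) := by push_cast; ring
  rw [this, Complex.im_ofReal_mul]
  simp only [imSym, Matrix.of_apply]
  ring

end Blocks

/-! ### Spectral representation of the resolvent -/

section Resolvent

variable {n : Type*} [Fintype n] [DecidableEq n]

theorem resolvent_mul {A : Matrix n n ℂ} (hA : A.IsHermitian) {z : ℂ} (hz : z.im ≠ 0) :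
    (A - z • (1 : Matrix n n ℂ)) * ((hA.eigenvectorUnitary : Matrix n n ℂ)
      * diagonal (fun i => ((hA.eigenvalues i : ℂ) - z)⁻¹)
      * star (hA.eigenvectorUnitary : Matrix n n ℂ)) = 1 := by
  set U := (hA.eigenvectorUnitary : Matrix n n ℂ) with hU
  have hUU : star U * U = 1 := Unitary.coe_star_mul_self hA.eigenvectorUnitary
  have hUU' : U * star U = 1 := Unitary.coe_mul_star_self hA.eigenvectorUnitary
  have h1 : A - z • (1 : Matrix n n ℂ)
      = U * diagonal (fun i => (hA.eigenvalues i : ℂ) - z) * star U := by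
    have h2 : A = U * diagonal (fun i => (hA.eigenvalues i : ℂ)) * star U := by
      conv_lhs => rw [hA.spectral_theorem, Unitary.conjStarAlgAut_apply]
      rfl
    have h3 : diagonal (fun i => (hA.eigenvalues i : ℂ) - z)
        = diagonal (fun i => (hA.eigenvalues i : ℂ)) - z • (1 : Matrix n n ℂ) := by
      ext i j
      by_cases h : i = j
      · subst h; simp
      · simp [h]
    rw [h3, Matrix.mul_sub, Matrix.sub_mul, ← h2]
    simp [hUU']
  have hne : ∀ i, (hA.eigenvalues i : ℂ) - z ≠ 0 := by
    intro i h
    apply hz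
    have := congrArg Complex.im h
    simpa using this
  calc (A - z • (1 : Matrix n n ℂ)) * (U * diagonal (fun i => ((hA.eigenvalues i : ℂ) - z)⁻¹)
        * star U)
      = U * diagonal (fun i => (hA.eigenvalues i : ℂ) - z) * (star U * U)
          * diagonal (fun i => ((hA.eigenvalues i : ℂ) - z)⁻¹) * star U := by
        rw [h1]; simp only [Matrix.mul_assoc]
    _ = 1 := by
        rw [hUU, Matrix.mul_one, Matrix.mul_assoc U, diagonal_mul_diagonal]
        simp [mul_inv_cancel₀ (hne _), hUU']

theorem det_sub_smul_ne_zero {A : Matrix n n ℂ} (hA : A.IsHermitian) {z : ℂ} (hz : z.im ≠ 0) :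
    (A - z • (1 : Matrix n n ℂ)).det ≠ 0 := by
  intro h
  have := congrArg Matrix.det (resolvent_mul hA hz)
  rw [det_mul, h, zero_mul, det_one] at this
  exact zero_ne_one this

theorem resolvent_apply {A : Matrix n n ℂ} (hA : A.IsHermitian) {z : ℂ} (hz : z.im ≠ 0) (i j : n) :
    (A - z • (1 : Matrix n n ℂ))⁻¹ i j = ∑ k, (hA.eigenvectorUnitary : Matrix n n ℂ) i k
      * star ((hA.eigenvectorUnitary : Matrix n n ℂ) j k) * ((hA.eigenvalues k : ℂ) - z)⁻¹ := by
  rw [inv_eq_right_inv (resolvent_mul hA hz), Matrix.mul_apply]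
  refine Finset.sum_congr rfl fun k _ => ?_
  rw [mul_diagonal, star_apply]
  ring

end Resolvent

/-! ### Averaging over rotations -/

section Rotation

variable {X ι : Type*} [Fintype X] [DecidableEq X] [Fintype ι] [DecidableEq ι]

omit [Fintype X] [Fintype ι] [DecidableEq ι] in
theorem isHermitian_symBlocks (g : X × ι × ι → ℝ) : (symBlocks g).IsHermitian := by
  ext ⟨a, i⟩ ⟨b, j⟩
  by_cases h : a = b
  · subst h; simp [symBlocks, add_comm]
  · simp [symBlocks, h, Ne.symm h]

omit [Fintype X] [Fintype ι] [DecidableEq ι] in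
theorem isHermitian_add_symBlocks {K : Matrix (X × ι) (X × ι) ℂ} (hK : K.IsHermitian) (σ : ℝ)
    (g : X × ι × ι → ℝ) : (K + (σ : ℂ) • symBlocks g).IsHermitian :=
  hK.add (by
    rw [IsHermitian, conjTranspose_smul, (isHermitian_symBlocks g).eq]
    simp)

omit [Fintype X] [Fintype ι] [DecidableEq ι] in
theorem blockVec_combination (x : X) (a b : ℝ) (r r' : ι → ℝ) :
    blockVec x (a • r + b • r') = (a : ℂ) • blockVec x r + (b : ℂ) • blockVec x r' := by
  funext p
  simp only [blockVec, Pi.add_apply, Pi.smul_apply, smul_eq_mul]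
  split_ifs <;> simp

theorem measurable_symBlocks_apply {X ι : Type*} [DecidableEq X] (p q : X × ι) :
    Measurable fun g : X × ι × ι → ℝ => symBlocks g p q := by
  simp only [symBlocks, Matrix.of_apply]
  split_ifs <;> fun_prop

/-- Once the row in the direction `φ` is removed, the remaining matrix does not depend on the angle;
all the dependence sits in one vector running along the circle, as `lintegral_im_rankTwo_le`
requires. -/
theorem rotate_resolvent {X ι : Type*} [DecidableEq X] [Fintype ι] [DecidableEq ι]
    (K : Matrix (X × ι) (X × ι) ℂ) (σ : ℝ) (z : ℂ) (x : X)
    (φ : ι → ℝ) (c s : ℝ) (y : (X × ι × ι) ⊕ ι → ℝ) :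
    K + (σ : ℂ) • symBlocks (rotateRow x φ c s y ∘ Sum.inl) - z • (1 : Matrix (X × ι) (X × ι) ℂ)
      = rankTwo (K + (σ : ℂ) • symBlocks (addRankOne x φ (y ∘ Sum.inl)
          (-blockRow x φ (y ∘ Sum.inl))) - z • (1 : Matrix (X × ι) (X × ι) ℂ))
        ((σ : ℂ) • blockVec x φ)
        ((c : ℂ) • blockVec x (blockRow x φ (y ∘ Sum.inl))
          + (s : ℂ) • blockVec x (y ∘ Sum.inr)) := by
  have h1 : rotateRow x φ c s y ∘ Sum.inl = addRankOne x φ (addRankOne x φ (y ∘ Sum.inl)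
      (-blockRow x φ (y ∘ Sum.inl))) (c • blockRow x φ (y ∘ Sum.inl) + s • (y ∘ Sum.inr)) := by
    rw [← addRankOne_add]
    change addRankOne x φ (y ∘ Sum.inl) _ = _
    congr 1
    module
  rw [h1, symBlocks_addRankOne, blockVec_combination]
  simp only [rankTwo, smul_add, vecMulVec_smul, smul_vecMulVec]
  abel

/-- The integrand controlled by rotating a row of a Gaussian block. -/
theorem lintegral_logDetDeriv_le {K : Matrix (X × ι) (X × ι) ℂ} (hK : K.IsHermitian) (σ : ℝ)
    {z : ℂ} (hz : z.im ≠ 0) (x : X) (φ : ι → ℝ) (hφ : ∑ i, φ i ^ 2 = 1) :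
    ∫⁻ y, ‖(logDetDeriv (K + (σ : ℂ) • symBlocks (y ∘ Sum.inl) - z • 1) ((σ : ℂ) • blockVec x φ)
      (blockVec x (y ∘ Sum.inr))).im‖ₑ ∂(gaussianPi ((X × ι × ι) ⊕ ι)) ≤ 2 := by
  set Ψ : ((X × ι × ι) ⊕ ι → ℝ) → ℝ≥0∞ := fun y =>
    ‖(logDetDeriv (K + (σ : ℂ) • symBlocks (y ∘ Sum.inl) - z • 1) ((σ : ℂ) • blockVec x φ)
      (blockVec x (y ∘ Sum.inr))).im‖ₑ with hΨ
  have hmΨ : Measurable Ψ := by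
    refine (Complex.measurable_im.comp (measurable_logDetDeriv (fun i j => ?_) _ fun i => ?_)).enorm
    · simp only [Matrix.sub_apply, Matrix.add_apply, Matrix.smul_apply]
      have := (measurable_symBlocks_apply i j).comp
        (show Measurable fun y : (X × ι × ι) ⊕ ι → ℝ => y ∘ Sum.inl from
          measurable_pi_lambda _ fun p => measurable_pi_apply _)
      exact ((this.const_smul (σ : ℂ)).const_add _).sub_const _
    · simp only [blockVec]
      split_ifs <;> fun_prop
  have hrot : ∀ t : ℝ, MeasurePreserving (rotateRow x φ (rotCos t) (rotSin t))
      (gaussianPi ((X × ι × ι) ⊕ ι)) (gaussianPi ((X × ι × ι) ⊕ ι)) := fun t =>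
    ⟨(LinearMap.continuous_of_finiteDimensional _).measurable,
      gaussianPi_map_rotateRow x φ hφ _ _ (rotCos_sq_add_rotSin_sq t)⟩
  have hmcs : Measurable rotCos ∧ Measurable rotSin := by
    constructor
    · unfold rotCos; fun_prop
    · unfold rotSin; fun_prop
  have hmj : Measurable fun p : ℝ × ((X × ι × ι) ⊕ ι → ℝ) =>
      rotateRow x φ (rotCos p.1) (rotSin p.1) p.2 := by
    obtain ⟨hc, hs⟩ := hmcs
    refine measurable_pi_lambda _ fun q => ?_
    rcases q with q | k
    · simp only [rotateRow, LinearMap.coe_mk, AddHom.coe_mk, Sum.elim_inl, addRankOne, blockRow,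
        Pi.add_apply, Pi.smul_apply, Function.comp_apply, smul_eq_mul]
      split_ifs <;> fun_prop
    · simp only [rotateRow, LinearMap.coe_mk, AddHom.coe_mk, Sum.elim_inr, blockRow,
        Pi.add_apply, Pi.smul_apply, Function.comp_apply, smul_eq_mul]
      fun_prop
  have hw : Measurable fun t : ℝ => ENNReal.ofReal (2 / (1 + t ^ 2)) := by fun_prop
  -- The bound over the circle holds for every fixed sample; no probability enters yet.
  have hpt : ∀ y, ∫⁻ t : ℝ, ENNReal.ofReal (2 / (1 + t ^ 2))
      * Ψ (rotateRow x φ (rotCos t) (rotSin t) y) ≤ 4 * ENNReal.ofReal Real.pi := by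
    intro y
    refine le_trans (le_of_eq (lintegral_congr fun t => ?_))
      (lintegral_im_rankTwo_le (K + (σ : ℂ) • symBlocks (addRankOne x φ (y ∘ Sum.inl)
          (-blockRow x φ (y ∘ Sum.inl))) - z • 1) ((σ : ℂ) • blockVec x φ)
          (blockVec x (blockRow x φ (y ∘ Sum.inl))) (blockVec x (y ∘ Sum.inr)) fun c s => ?_)
    · rw [hΨ]
      simp only
      rw [rotate_resolvent]
      have : rotateRow x φ (rotCos t) (rotSin t) y ∘ Sum.inr
          = -rotSin t • blockRow x φ (y ∘ Sum.inl) + rotCos t • (y ∘ Sum.inr) := rfl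
      rw [this, blockVec_combination]
      simp
    · rw [← rotate_resolvent]
      exact det_sub_smul_ne_zero (isHermitian_add_symBlocks hK σ _) hz
  have hcauchy : ∫⁻ t : ℝ, ENNReal.ofReal (2 / (1 + t ^ 2)) = 2 * ENNReal.ofReal Real.pi := by
    have e : ∀ t : ℝ, 2 / (1 + t ^ 2) = 2 * (1 + t ^ 2)⁻¹ := fun t => by ring
    simp_rw [e]
    rw [← ofReal_integral_eq_lintegral_ofReal (integrable_inv_one_add_sq.const_mul 2)
      (ae_of_all _ fun t => by positivity), integral_const_mul, integral_univ_inv_one_add_sq,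
      ENNReal.ofReal_mul (by norm_num)]
    simp
  -- By rotation invariance the expectation of `Ψ` is the same at every angle, so it may be averaged
  -- over the circle of total angle `2π` and the order of integration exchanged. This gives `4π / 2π
  -- = 2`.
  have hmain : 2 * ENNReal.ofReal Real.pi * ∫⁻ y, Ψ y ∂(gaussianPi ((X × ι × ι) ⊕ ι))
      ≤ 4 * ENNReal.ofReal Real.pi := by
    calc 2 * ENNReal.ofReal Real.pi * ∫⁻ y, Ψ y ∂(gaussianPi ((X × ι × ι) ⊕ ι))
        = ∫⁻ t : ℝ, ENNReal.ofReal (2 / (1 + t ^ 2)) *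
            ∫⁻ y, Ψ y ∂(gaussianPi ((X × ι × ι) ⊕ ι)) := by
          rw [lintegral_mul_const _ hw, hcauchy]
      _ = ∫⁻ t : ℝ, ∫⁻ y, ENNReal.ofReal (2 / (1 + t ^ 2)) *
            Ψ (rotateRow x φ (rotCos t) (rotSin t) y) ∂(gaussianPi ((X × ι × ι) ⊕ ι)) := by
          refine lintegral_congr fun t => ?_
          rw [lintegral_const_mul _ (show Measurable fun y =>
            Ψ (rotateRow x φ (rotCos t) (rotSin t) y) from hmΨ.comp (hrot t).measurable), (hrot t).lintegral_comp hmΨ]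
      _ = ∫⁻ y, (∫⁻ t : ℝ, ENNReal.ofReal (2 / (1 + t ^ 2)) *
            Ψ (rotateRow x φ (rotCos t) (rotSin t) y)) ∂(gaussianPi ((X × ι × ι) ⊕ ι)) := by
          refine lintegral_lintegral_swap (Measurable.aemeasurable ?_)
          exact (hw.comp measurable_fst).mul (hmΨ.comp hmj)
      _ ≤ ∫⁻ y, 4 * ENNReal.ofReal Real.pi ∂(gaussianPi ((X × ι × ι) ⊕ ι)) :=
          lintegral_mono hpt
      _ = 4 * ENNReal.ofReal Real.pi := by simp
  have hpi : ENNReal.ofReal Real.pi ≠ 0 := by simp [Real.pi_pos]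
  have h4 : (4 : ℝ≥0∞) * ENNReal.ofReal Real.pi = 2 * ENNReal.ofReal Real.pi * 2 := by ring
  rw [h4] at hmain
  exact (ENNReal.mul_le_mul_iff_right (by simp [hpi]) (ENNReal.mul_ne_top (by simp) (by simp))).1
    hmain

/-- The auxiliary vector is independent of `g`. Integrating it out first turns the absolute value of
its inner product with a vector into `gaussianAbs` times the length of that vector. -/
theorem lintegral_imSym_mulVec_le {K : Matrix (X × ι) (X × ι) ℂ} (hK : K.IsHermitian) {σ : ℝ}
    (hσ : 0 ≤ σ) {z : ℂ} (hz : z.im ≠ 0) (x : X) (φ : ι → ℝ) (hφ : ∑ i, φ i ^ 2 = 1) :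
    ENNReal.ofReal σ * gaussianAbs * ∫⁻ g, ENNReal.ofReal (√(∑ k, (∑ j,
      imSym (K + (σ : ℂ) • symBlocks g - z • 1)⁻¹ x k j * φ j) ^ 2)) ∂(gaussianPi (X × ι × ι))
      ≤ 2 := by
  refine le_trans (le_of_eq ?_) (lintegral_logDetDeriv_le hK σ hz x φ hφ)
  have hm : ∀ k j, Measurable fun g : X × ι × ι → ℝ =>
      imSym (K + (σ : ℂ) • symBlocks g - z • 1)⁻¹ x k j := by
    intro k j
    have := measurable_inv_apply (A := fun g : X × ι × ι → ℝ => K + (σ : ℂ) • symBlocks g - z • 1)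
      (fun a b => (((measurable_symBlocks_apply a b).const_smul (σ : ℂ)).const_add _).sub_const _)
    exact Complex.measurable_im.comp ((this _ _).add (this _ _))
  have hmp : MeasurePreserving (MeasurableEquiv.sumPiEquivProdPi fun _ : (X × ι × ι) ⊕ ι => ℝ)
      (gaussianPi ((X × ι × ι) ⊕ ι)) ((gaussianPi (X × ι × ι)).prod (gaussianPi ι)) :=
    measurePreserving_sumPiEquivProdPi fun _ => gaussianReal 0 1
  simp_rw [logDetDeriv_im]
  symm
  calc ∫⁻ y, ‖∑ k, (y ∘ Sum.inr) k * (σ * ∑ j,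
          imSym (K + (σ : ℂ) • symBlocks (y ∘ Sum.inl) - z • 1)⁻¹ x k j * φ j)‖ₑ
          ∂(gaussianPi ((X × ι × ι) ⊕ ι))
      = ∫⁻ p, ‖∑ k, p.2 k * (σ * ∑ j,
          imSym (K + (σ : ℂ) • symBlocks p.1 - z • 1)⁻¹ x k j * φ j)‖ₑ
          ∂((gaussianPi (X × ι × ι)).prod (gaussianPi ι)) :=
        hmp.lintegral_comp_emb (MeasurableEquiv.measurableEmbedding _)
          (fun p : (X × ι × ι → ℝ) × (ι → ℝ) => ‖∑ k, p.2 k * (σ * ∑ j,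
          imSym (K + (σ : ℂ) • symBlocks p.1 - z • 1)⁻¹ x k j * φ j)‖ₑ)
    _ = ∫⁻ g, ∫⁻ r, ‖∑ k, r k * (σ * ∑ j,
          imSym (K + (σ : ℂ) • symBlocks g - z • 1)⁻¹ x k j * φ j)‖ₑ
          ∂(gaussianPi ι) ∂(gaussianPi (X × ι × ι)) := by
        refine lintegral_prod _ (Measurable.aemeasurable ?_)
        refine (Finset.measurable_sum _ fun k _ => ?_).enorm
        refine Measurable.mul (by fun_prop) (Measurable.const_mul
          (Finset.measurable_sum _ fun j _ => ?_) _)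
        exact ((hm k j).comp measurable_fst).mul_const _
    _ = ∫⁻ g, ENNReal.ofReal σ * gaussianAbs * ENNReal.ofReal (√(∑ k, (∑ j,
          imSym (K + (σ : ℂ) • symBlocks g - z • 1)⁻¹ x k j * φ j) ^ 2))
          ∂(gaussianPi (X × ι × ι)) := by
        refine lintegral_congr fun g => ?_
        rw [lintegral_gaussianPi_enorm_sum]
        simp only [mul_pow, ← Finset.mul_sum]
        rw [Real.sqrt_mul (sq_nonneg σ), Real.sqrt_sq hσ, ENNReal.ofReal_mul hσ]
        ring
    _ = _ := by
        refine lintegral_const_mul _ (Measurable.ennreal_ofReal (Measurable.sqrt ?_))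
        exact Finset.measurable_sum _ fun k _ =>
          (Finset.measurable_sum _ fun j _ => (hm k j).mul_const _).pow_const 2

end Rotation

/-! ### Khintchine's inequality by Riesz products -/

section Khintchine

/-- The real number `1` or `-1` encoded by a Boolean. -/
def boolSign (b : Bool) : ℝ := if b then 1 else -1

theorem boolSign_sq (b : Bool) : boolSign b ^ 2 = 1 := by cases b <;> simp [boolSign]

variable {ι : Type*} [Fintype ι] [DecidableEq ι]

/-- The sum over signs factorises over coordinates. In the term of index `j`, every factor `k ≠ j`
averages to 1, and the factor `j` averages to `I * a j ^ 2` because the sign squares to 1. -/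
theorem riesz_product_sum (a : ι → ℝ) :
    ∑ ε : ι → Bool, ((∑ j, boolSign (ε j) * a j : ℝ) : ℂ)
        * ∏ k, (1 + Complex.I * (a k * boolSign (ε k) : ℝ))
      = 2 ^ Fintype.card ι * (Complex.I * (∑ j, a j ^ 2 : ℝ)) := by
  have h1 : ∀ j, ∑ ε : ι → Bool, ((boolSign (ε j) * a j : ℝ) : ℂ)
      * ∏ k, (1 + Complex.I * (a k * boolSign (ε k) : ℝ))
      = 2 ^ Fintype.card ι * (Complex.I * (a j ^ 2 : ℝ)) := by
    intro j
    have h2 : ∀ ε : ι → Bool, ((boolSign (ε j) * a j : ℝ) : ℂ)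
        * ∏ k, (1 + Complex.I * (a k * boolSign (ε k) : ℝ))
        = ∏ k, ((if k = j then ((boolSign (ε k) * a k : ℝ) : ℂ) else 1)
          * (1 + Complex.I * (a k * boolSign (ε k) : ℝ))) := by
      intro ε
      rw [Finset.prod_mul_distrib, Finset.prod_ite_eq' Finset.univ j]
      simp
    simp_rw [h2]
    have h3 := Finset.prod_univ_sum (fun _ : ι => (Finset.univ : Finset Bool))
      (fun k b => (if k = j then ((boolSign b * a k : ℝ) : ℂ) else 1)
          * (1 + Complex.I * (a k * boolSign b : ℝ)))
    rw [Fintype.piFinset_univ] at h3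
    rw [← h3]
    have h4 : ∀ k, ∑ b : Bool, (if k = j then ((boolSign b * a k : ℝ) : ℂ) else 1)
          * (1 + Complex.I * (a k * boolSign b : ℝ))
        = 2 * (if k = j then Complex.I * (a k ^ 2 : ℝ) else 1) := by
      intro k
      split_ifs
      · simp [boolSign]; ring
      · simp [boolSign]; ring
    simp_rw [h4]
    rw [Finset.prod_mul_distrib, Finset.prod_ite_eq' Finset.univ j]
    simp
  simp_rw [Complex.ofReal_sum, Finset.sum_mul]
  rw [Finset.sum_comm]
  simp_rw [h1]
  rw [Finset.mul_sum, Finset.mul_sum]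

omit [DecidableEq ι] in
-- Each factor has modulus `√(1 + a²) ≤ exp (a² / 2)`.
theorem norm_riesz_product_le (a : ι → ℝ) (ε : ι → Bool) :
    ‖∏ k, (1 + Complex.I * ((a k * boolSign (ε k) : ℝ) : ℂ))‖
      ≤ Real.exp ((∑ k, a k ^ 2) / 2) := by
  rw [norm_prod, Finset.sum_div, Real.exp_sum]
  refine Finset.prod_le_prod (fun _ _ => norm_nonneg _) fun k _ => ?_
  refine le_of_sq_le_sq ?_ (Real.exp_pos _).le
  rw [← Complex.normSq_eq_norm_sq, ← Real.exp_nat_mul]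
  have : Complex.normSq (1 + Complex.I * ((a k * boolSign (ε k) : ℝ) : ℂ)) = a k ^ 2 + 1 := by
    rw [Complex.normSq_apply]
    simp
    linear_combination (a k ^ 2) * boolSign_sq (ε k)
  rw [this]
  refine (Real.add_one_le_exp _).trans (le_of_eq ?_)
  congr 1
  push_cast
  ring

/-- Khintchine's inequality in `L¹`. -/
theorem khintchine (a : ι → ℝ) :
    2 ^ Fintype.card ι * (Real.exp (-1 / 2) * √(∑ j, a j ^ 2))
      ≤ ∑ ε : ι → Bool, |∑ j, boolSign (ε j) * a j| := by
  -- The exponential bound on the Riesz product is not homogeneous, so the vector is first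
  -- normalised; this is where `exp (-1 / 2)` comes from.
  have unit : ∀ b : ι → ℝ, ∑ j, b j ^ 2 = 1 → 2 ^ Fintype.card ι * Real.exp (-1 / 2)
      ≤ ∑ ε : ι → Bool, |∑ j, boolSign (ε j) * b j| := by
    intro b hb
    have h := congrArg norm (riesz_product_sum b)
    rw [hb] at h
    simp only [Complex.ofReal_one, mul_one, norm_mul, norm_pow, Complex.norm_I] at h
    have h2 : (2 : ℝ) ^ Fintype.card ι
        ≤ ∑ ε : ι → Bool, |∑ j, boolSign (ε j) * b j| * Real.exp (1 / 2) := by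
      calc (2 : ℝ) ^ Fintype.card ι = _ := by rw [h]; simp
        _ ≤ _ := (norm_sum_le _ _).trans (Finset.sum_le_sum fun ε _ => by
          rw [norm_mul, Complex.norm_real, Real.norm_eq_abs]
          refine mul_le_mul_of_nonneg_left ?_ (abs_nonneg _)
          have := norm_riesz_product_le b ε
          rwa [hb] at this)
    rw [← Finset.sum_mul] at h2
    calc 2 ^ Fintype.card ι * Real.exp (-1 / 2)
        ≤ (∑ ε : ι → Bool, |∑ j, boolSign (ε j) * b j|) * Real.exp (1 / 2) * Real.exp (-1 / 2) :=
          mul_le_mul_of_nonneg_right h2 (Real.exp_pos _).le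
      _ = _ := by rw [mul_assoc, ← Real.exp_add]; norm_num
  set s := √(∑ j, a j ^ 2) with hs
  have hs2 : s ^ 2 = ∑ a_1, a a_1 ^ 2 := Real.sq_sqrt (Finset.sum_nonneg fun _ _ => sq_nonneg _)
  rcases eq_or_ne s 0 with h0 | h0
  · rw [h0, mul_zero, mul_zero]
    exact Finset.sum_nonneg fun _ _ => abs_nonneg _
  · have hsp : 0 < s := lt_of_le_of_ne (Real.sqrt_nonneg _) h0.symm
    have h1 := unit (fun j => a j / s) (by
      simp only [div_pow, ← Finset.sum_div]
      rw [← hs2, div_self (pow_ne_zero 2 h0)])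
    simp only [← mul_div_assoc, ← Finset.sum_div, abs_div, abs_of_pos hsp] at h1
    rw [le_div_iff₀ hsp] at h1
    linarith

/-- The Frobenius norm of a real matrix. -/
def frob (A : Matrix ι ι ℝ) : ℝ := √(∑ k, ∑ j, A k j ^ 2)

omit [DecidableEq ι] in
theorem frob_sq (A : Matrix ι ι ℝ) : frob A ^ 2 = ∑ k, ∑ j, A k j ^ 2 :=
  Real.sq_sqrt (Finset.sum_nonneg fun _ _ => Finset.sum_nonneg fun _ _ => sq_nonneg _)

/-- Khintchine is applied to each row and weighted by the norm of that row. Cauchy–Schwarz over rows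
then bounds the weighted sum by `frob A` times `‖A ε‖`, and one factor `frob A` cancels. -/
theorem khintchine_frob (A : Matrix ι ι ℝ) :
    2 ^ Fintype.card ι * (Real.exp (-1 / 2) * frob A)
      ≤ ∑ ε : ι → Bool, √(∑ k, (∑ j, A k j * boolSign (ε j)) ^ 2) := by
  rcases eq_or_ne (frob A) 0 with h0 | h0
  · rw [h0, mul_zero, mul_zero]
    exact Finset.sum_nonneg fun _ _ => Real.sqrt_nonneg _
  have hp : 0 < frob A := lt_of_le_of_ne (Real.sqrt_nonneg _) h0.symm
  have h1 : ∀ ε : ι → Bool, ∑ k, √(∑ j, A k j ^ 2) * |∑ j, boolSign (ε j) * A k j|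
      ≤ frob A * √(∑ k, (∑ j, A k j * boolSign (ε j)) ^ 2) := by
    intro ε
    refine (Real.sum_mul_le_sqrt_mul_sqrt _ _ _).trans (le_of_eq ?_)
    unfold frob
    congr 2
    · exact Finset.sum_congr rfl fun k _ =>
        Real.sq_sqrt (Finset.sum_nonneg fun _ _ => sq_nonneg _)
    · refine Finset.sum_congr rfl fun k _ => ?_
      rw [sq_abs]
      simp only [mul_comm]
  have h2 := Finset.sum_le_sum fun ε (_ : ε ∈ (Finset.univ : Finset (ι → Bool))) => h1 ε
  rw [Finset.sum_comm, ← Finset.mul_sum] at h2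
  simp_rw [← Finset.mul_sum] at h2
  have h3 : 2 ^ Fintype.card ι * Real.exp (-1 / 2) * frob A ^ 2
      ≤ ∑ k, √(∑ j, A k j ^ 2) * ∑ ε : ι → Bool, |∑ j, boolSign (ε j) * A k j| := by
    rw [frob_sq, Finset.mul_sum]
    refine Finset.sum_le_sum fun k _ => ?_
    have := mul_le_mul_of_nonneg_left (khintchine (A k)) (Real.sqrt_nonneg (∑ j, A k j ^ 2))
    have h4 := Real.mul_self_sqrt (Finset.sum_nonneg fun j (_ : j ∈ Finset.univ) =>
      sq_nonneg (A k j))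
    calc _ = √(∑ j, A k j ^ 2)
          * (2 ^ Fintype.card ι * (Real.exp (-1 / 2) * √(∑ j, A k j ^ 2))) := by
            conv_lhs => rw [← h4]
            ring
      _ ≤ _ := this
  have h5 := h3.trans h2
  refine le_of_mul_le_mul_left ?_ hp
  linarith

end Khintchine

/-! ### Expected Frobenius norm of a resolvent block -/

section Frobenius

variable {X ι : Type*} [Fintype X] [DecidableEq X] [Fintype ι] [DecidableEq ι]

theorem measurable_imSym_apply {T : Type*} [MeasurableSpace T]
    {A : T → Matrix (X × ι) (X × ι) ℂ} (hA : ∀ p q, Measurable fun t => A t p q) (x : X) (k j : ι) :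
    Measurable fun t => imSym (A t)⁻¹ x k j :=
  Complex.measurable_im.comp ((measurable_inv_apply hA _ _).add (measurable_inv_apply hA _ _))

theorem measurable_frob_imSym {T : Type*} [MeasurableSpace T]
    {A : T → Matrix (X × ι) (X × ι) ℂ} (hA : ∀ p q, Measurable fun t => A t p q) (x : X) :
    Measurable fun t => frob (imSym (A t)⁻¹ x) :=
  Measurable.sqrt (Finset.measurable_sum _ fun k _ => Finset.measurable_sum _ fun j _ =>
    (measurable_imSym_apply hA x k j).pow_const 2)

/-- The bound for a fixed direction is averaged over the unit vectors `ε / √(card ι)` with `ε` a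
vector of signs; the normalisation costs the factor `√(card ι)`. -/
theorem lintegral_frob_imSym_le [Nonempty ι] {K : Matrix (X × ι) (X × ι) ℂ} (hK : K.IsHermitian)
    {σ : ℝ} (hσ : 0 ≤ σ) {z : ℂ} (hz : z.im ≠ 0) (x : X) :
    ENNReal.ofReal (σ * Real.exp (-1 / 2) / √(Fintype.card ι)) * gaussianAbs
      * ∫⁻ g, ENNReal.ofReal (frob (imSym (K + (σ : ℂ) • symBlocks g - z • 1)⁻¹ x))
        ∂(gaussianPi (X × ι × ι)) ≤ 2 := by
  set s := √(Fintype.card ι : ℝ) with hs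
  have hs0 : 0 < s := Real.sqrt_pos.2 (by exact_mod_cast Fintype.card_pos)
  have hs2 : s ^ 2 = Fintype.card ι := Real.sq_sqrt (Nat.cast_nonneg _)
  have hmA : ∀ p q, Measurable fun g : X × ι × ι → ℝ =>
      (K + (σ : ℂ) • symBlocks g - z • (1 : Matrix (X × ι) (X × ι) ℂ)) p q := fun a b =>
    (((measurable_symBlocks_apply a b).const_smul (σ : ℂ)).const_add _).sub_const _
  set B : (X × ι × ι → ℝ) → Matrix ι ι ℝ := fun g =>
    imSym (K + (σ : ℂ) • symBlocks g - z • 1)⁻¹ x with hB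
  have hφ : ∀ ε : ι → Bool, ∑ i, (boolSign (ε i) / s) ^ 2 = 1 := by
    intro ε
    simp only [div_pow, boolSign_sq, hs2]
    simp
  have h1 : ∀ ε : ι → Bool, ENNReal.ofReal σ * gaussianAbs * ∫⁻ g, ENNReal.ofReal
      (√(∑ k, (∑ j, B g k j * (boolSign (ε j) / s)) ^ 2)) ∂(gaussianPi (X × ι × ι)) ≤ 2 :=
    fun ε => lintegral_imSym_mulVec_le hK hσ hz x _ (hφ ε)
  have h2 : ∀ g, ENNReal.ofReal (2 ^ Fintype.card ι * (Real.exp (-1 / 2) / s * frob (B g)))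
      ≤ ∑ ε : ι → Bool, ENNReal.ofReal
      (√(∑ k, (∑ j, B g k j * (boolSign (ε j) / s)) ^ 2)) := by
    intro g
    rw [← ENNReal.ofReal_sum_of_nonneg fun _ _ => Real.sqrt_nonneg _]
    refine ENNReal.ofReal_le_ofReal ?_
    have e : ∀ ε : ι → Bool, √(∑ k, (∑ j, B g k j * (boolSign (ε j) / s)) ^ 2)
        = √(∑ k, (∑ j, B g k j * boolSign (ε j)) ^ 2) / s := by
      intro ε
      simp only [← mul_div_assoc, ← Finset.sum_div, div_pow]
      rw [Real.sqrt_div' _ (sq_nonneg s), Real.sqrt_sq hs0.le]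
    simp_rw [e]
    rw [← Finset.sum_div, le_div_iff₀ hs0]
    refine le_trans (le_of_eq ?_) (khintchine_frob (B g))
    field_simp
  have hm : ∀ ε : ι → Bool, Measurable fun g => ENNReal.ofReal
      (√(∑ k, (∑ j, B g k j * (boolSign (ε j) / s)) ^ 2)) := fun ε =>
    (Measurable.sqrt (Finset.measurable_sum _ fun k _ => (Finset.measurable_sum _ fun j _ =>
      (measurable_imSym_apply hmA x k j).mul_const _).pow_const 2)).ennreal_ofReal
  have h3 := lintegral_mono (μ := gaussianPi (X × ι × ι)) h2
  rw [lintegral_finsetSum _ fun ε _ => hm ε] at h3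
  have h4 : ∀ g, ENNReal.ofReal (2 ^ Fintype.card ι * (Real.exp (-1 / 2) / s * frob (B g)))
      = ENNReal.ofReal (2 ^ Fintype.card ι) * (ENNReal.ofReal (Real.exp (-1 / 2) / s)
        * ENNReal.ofReal (frob (B g))) := fun g => by
    rw [ENNReal.ofReal_mul (by positivity), ENNReal.ofReal_mul (by positivity)]
  simp_rw [h4] at h3
  rw [lintegral_const_mul _ ((measurable_frob_imSym hmA x).ennreal_ofReal.const_mul _),
    lintegral_const_mul _ (measurable_frob_imSym hmA x).ennreal_ofReal] at h3
  have h5 := mul_le_mul_right h3 (ENNReal.ofReal σ * gaussianAbs)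
  rw [Finset.mul_sum] at h5
  have h6 := h5.trans (Finset.sum_le_sum fun ε _ => h1 ε)
  have h7 : (∑ _ε : ι → Bool, (2 : ℝ≥0∞)) = ENNReal.ofReal (2 ^ Fintype.card ι) * 2 := by
    simp [ENNReal.ofReal_pow]
  rw [h7] at h6
  refine (ENNReal.mul_le_mul_iff_right (a := ENNReal.ofReal (2 ^ Fintype.card ι))
    (by simp) (by simp)).1 (le_trans (le_of_eq ?_) h6)
  rw [mul_div_assoc, ENNReal.ofReal_mul hσ]
  ring

end Frobenius

/-! ### An eigenvalue forces a large resolvent block -/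

section LowerBound

variable {X ι : Type*} [Fintype X] [DecidableEq X] [Fintype ι] [DecidableEq ι]

theorem imSym_resolvent_apply {A : Matrix (X × ι) (X × ι) ℂ} (hA : A.IsHermitian) {E η : ℝ}
    (hη : 0 < η) (x : X) (k j : ι) :
    imSym (A - (⟨E, η⟩ : ℂ) • (1 : Matrix (X × ι) (X × ι) ℂ))⁻¹ x k j
      = ∑ m, 2 * (η / ((hA.eigenvalues m - E) ^ 2 + η ^ 2)) *
        (((hA.eigenvectorUnitary : Matrix (X × ι) (X × ι) ℂ) (x, k) m).re
            * ((hA.eigenvectorUnitary : Matrix (X × ι) (X × ι) ℂ) (x, j) m).re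
          + ((hA.eigenvectorUnitary : Matrix (X × ι) (X × ι) ℂ) (x, k) m).im
            * ((hA.eigenvectorUnitary : Matrix (X × ι) (X × ι) ℂ) (x, j) m).im) := by
  have hz : (⟨E, η⟩ : ℂ).im ≠ 0 := hη.ne'
  simp only [imSym, Matrix.of_apply, resolvent_apply hA hz]
  rw [← Finset.sum_add_distrib, Complex.im_sum]
  refine Finset.sum_congr rfl fun m _ => ?_
  set a := (hA.eigenvectorUnitary : Matrix (X × ι) (X × ι) ℂ) (x, k) m
  set b := (hA.eigenvectorUnitary : Matrix (X × ι) (X × ι) ℂ) (x, j) m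
  have h1 : a * star b + b * star a = ((2 * (a.re * b.re + a.im * b.im) : ℝ) : ℂ) := by
    apply Complex.ext
    · simp; ring
    · simp; ring
  have h2 : (((hA.eigenvalues m : ℂ) - ⟨E, η⟩)⁻¹).im
      = η / ((hA.eigenvalues m - E) ^ 2 + η ^ 2) := by
    rw [Complex.inv_im, Complex.normSq_apply]
    simp
    ring
  rw [← add_mul, h1, Complex.im_ofReal_mul, h2]
  ring

/-- `S` is a combination, with positive weights `2 w m`, of the matrices `p pᵀ + q qᵀ` built from
the real and imaginary parts of the eigenvectors on the block. Pairing it with the matrix `B` of the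
eigenvector `i` gives nonnegative terms, of which only `m = i` is kept, and `frob B ≤ W`. -/
theorem le_frob_imSym {A : Matrix (X × ι) (X × ι) ℂ} (hA : A.IsHermitian) {E η : ℝ} (hη : 0 < η)
    (x : X) (i : X × ι) :
    η / ((hA.eigenvalues i - E) ^ 2 + η ^ 2)
        * ∑ k, ‖(hA.eigenvectorUnitary : Matrix (X × ι) (X × ι) ℂ) (x, k) i‖ ^ 2
      ≤ frob (imSym (A - (⟨E, η⟩ : ℂ) • (1 : Matrix (X × ι) (X × ι) ℂ))⁻¹ x) := by
  set U := (hA.eigenvectorUnitary : Matrix (X × ι) (X × ι) ℂ) with hU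
  set S := imSym (A - (⟨E, η⟩ : ℂ) • (1 : Matrix (X × ι) (X × ι) ℂ))⁻¹ x with hS
  set w : (X × ι) → ℝ := fun m => η / ((hA.eigenvalues m - E) ^ 2 + η ^ 2) with hw
  have hw0 : ∀ m, 0 ≤ w m := fun m => by positivity
  let p : (X × ι) → ι → ℝ := fun m k => (U (x, k) m).re
  let q : (X × ι) → ι → ℝ := fun m k => (U (x, k) m).im
  set W := ∑ k, ‖U (x, k) i‖ ^ 2 with hW
  have hWpq : W = ∑ k, p i k ^ 2 + ∑ k, q i k ^ 2 := by
    rw [hW, ← Finset.sum_add_distrib]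
    refine Finset.sum_congr rfl fun k _ => ?_
    rw [← Complex.normSq_eq_norm_sq, Complex.normSq_apply]
    ring
  have hW0 : 0 ≤ W := Finset.sum_nonneg fun _ _ => sq_nonneg _
  let B : Matrix ι ι ℝ := Matrix.of fun k j => p i k * p i j + q i k * q i j
  have expand : ∀ a b c d : ι → ℝ, ∑ k, ∑ j, (a k * a j + b k * b j) * (c k * c j + d k * d j)
      = (∑ k, a k * c k) ^ 2 + (∑ k, a k * d k) ^ 2 + (∑ k, b k * c k) ^ 2
        + (∑ k, b k * d k) ^ 2 := by
    intro a b c d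
    simp only [sq, Finset.sum_mul_sum, ← Finset.sum_add_distrib]
    exact Finset.sum_congr rfl fun k _ => Finset.sum_congr rfl fun j _ => by ring
  have cs : (∑ k, p i k * q i k) ^ 2 ≤ (∑ k, p i k ^ 2) * ∑ k, q i k ^ 2 :=
    Finset.sum_mul_sq_le_sq_mul_sq _ _ _
  have hBB := expand (p i) (q i) (p i) (q i)
  have hqp : ∑ k, q i k * p i k = ∑ k, p i k * q i k :=
    Finset.sum_congr rfl fun k _ => mul_comm _ _
  simp only [← sq] at hBB
  rw [hqp] at hBB
  have hBW : frob B ≤ W := by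
    refine Real.sqrt_le_iff.2 ⟨hW0, ?_⟩
    simp only [B, Matrix.of_apply]
    rw [hBB, hWpq]
    nlinarith
  have hSB : w i * W ^ 2 ≤ ∑ k, ∑ j, S k j * B k j := by
    have e : ∑ k, ∑ j, S k j * B k j = ∑ m, 2 * w m * ((∑ k, p m k * p i k) ^ 2
        + (∑ k, p m k * q i k) ^ 2 + (∑ k, q m k * p i k) ^ 2 + (∑ k, q m k * q i k) ^ 2) := by
      simp_rw [hS, imSym_resolvent_apply hA hη, ← expand, Finset.sum_mul, Finset.mul_sum]
      rw [Finset.sum_comm]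
      simp_rw [Finset.sum_comm (s := (Finset.univ : Finset (X × ι)))]
      rw [Finset.sum_comm]
      exact Finset.sum_congr rfl fun k _ => Finset.sum_congr rfl fun j _ =>
        Finset.sum_congr rfl fun m _ => by simp only [B, Matrix.of_apply, p, q, hw]; ring
    rw [e]
    refine le_trans ?_ (Finset.single_le_sum (f := fun m => 2 * w m * ((∑ k, p m k * p i k) ^ 2
        + (∑ k, p m k * q i k) ^ 2 + (∑ k, q m k * p i k) ^ 2 + (∑ k, q m k * q i k) ^ 2))
        (fun m _ => mul_nonneg (mul_nonneg zero_le_two (hw0 m)) (by positivity))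
        (Finset.mem_univ i))
    simp only [← sq, hqp]
    rw [hWpq, mul_assoc, mul_left_comm]
    refine mul_le_mul_of_nonneg_left ?_ (hw0 i)
    -- With `a = ∑ p²`, `b = ∑ q²` and `c = ∑ p q`, the claim is `(a + b)² ≤ 2 (a² + 2 c² + b²)`.
    nlinarith [sq_nonneg (∑ k, p i k ^ 2 - ∑ k, q i k ^ 2), sq_nonneg (∑ k, p i k * q i k)]
  have hCS : ∑ k, ∑ j, S k j * B k j ≤ frob S * frob B := by
    have := Real.sum_mul_le_sqrt_mul_sqrt (Finset.univ : Finset (ι × ι)) (fun r => S r.1 r.2)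
      fun r => B r.1 r.2
    simpa only [Fintype.sum_prod_type, frob] using this
  have hS0 : 0 ≤ frob S := Real.sqrt_nonneg _
  rcases hW0.eq_or_lt with h0 | h0
  · rw [← h0, mul_zero]; exact hS0
  · refine le_of_mul_le_mul_right ?_ h0
    calc w i * W * W = w i * W ^ 2 := by ring
      _ ≤ frob S * frob B := hSB.trans hCS
      _ ≤ frob S * W := mul_le_mul_of_nonneg_left hBW hS0

/-- The masses of a normalised eigenvector on the blocks add up to 1, and `η / (s² + η²) ≥ 1 / (2η)`
when `|s| ≤ η`. -/
theorem inv_two_mul_le_sum_frob {A : Matrix (X × ι) (X × ι) ℂ} (hA : A.IsHermitian) {E η : ℝ}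
    (hη : 0 < η) (i : X × ι) (hi : |hA.eigenvalues i - E| ≤ η) :
    (2 * η)⁻¹ ≤ ∑ x, frob (imSym (A - (⟨E, η⟩ : ℂ) • (1 : Matrix (X × ι) (X × ι) ℂ))⁻¹ x) := by
  refine le_trans ?_ (Finset.sum_le_sum fun x _ => le_frob_imSym hA hη x i)
  have h1 : ∑ x, ∑ k, ‖(hA.eigenvectorUnitary : Matrix (X × ι) (X × ι) ℂ) (x, k) i‖ ^ 2 = 1 := by
    have h2 := congrFun (congrFun (Unitary.coe_star_mul_self hA.eigenvectorUnitary) i) i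
    rw [Matrix.mul_apply, Fintype.sum_prod_type] at h2
    have h3 := congrArg Complex.re h2
    rw [Matrix.one_apply_eq, Complex.one_re, Complex.re_sum] at h3
    rw [← h3]
    refine Finset.sum_congr rfl fun x _ => ?_
    rw [Complex.re_sum]
    refine Finset.sum_congr rfl fun k _ => ?_
    rw [star_apply, ← Complex.normSq_eq_norm_sq, Complex.normSq_apply]
    simp
  rw [← Finset.mul_sum, h1, mul_one, inv_eq_one_div, div_le_div_iff₀ (by positivity) (by positivity)]
  have := sq_abs (hA.eigenvalues i - E)
  nlinarith [abs_nonneg (hA.eigenvalues i - E), mul_self_le_mul_self (abs_nonneg _) hi]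

end LowerBound

/-! ### Densities of product Gaussians -/

section PiDensity

variable {α : Type*} [Fintype α]

theorem pi_withDensity_ofReal (f : α → ℝ → ℝ) (hf : ∀ a, Integrable (f a))
    (h0 : ∀ a x, 0 ≤ f a x) [∀ a, SigmaFinite (volume.withDensity fun x => ENNReal.ofReal (f a x))] :
    Measure.pi (fun a => volume.withDensity fun x => ENNReal.ofReal (f a x))
      = (volume : Measure (α → ℝ)).withDensity fun x => ENNReal.ofReal (∏ a, f a (x a)) := by
  refine Measure.pi_eq fun s hs => ?_
  rw [withDensity_apply _ (MeasurableSet.univ_pi hs), ← lintegral_indicator (MeasurableSet.univ_pi hs)]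
  have e1 : ∀ x : α → ℝ, (Set.univ.pi s).indicator
      (fun x : α → ℝ => ENNReal.ofReal (∏ a, f a (x a))) x
      = ENNReal.ofReal (∏ a, (s a).indicator (f a) (x a)) := by
    intro x
    by_cases hx : x ∈ Set.univ.pi s
    · rw [Set.indicator_of_mem hx]
      congr 1
      exact Finset.prod_congr rfl fun a _ => by rw [Set.indicator_of_mem (hx a (Set.mem_univ a))]
    · rw [Set.indicator_of_notMem hx]
      obtain ⟨a, ha⟩ : ∃ a, x a ∉ s a := by simpa [Set.mem_pi] using hx
      rw [Finset.prod_eq_zero (Finset.mem_univ a) (Set.indicator_of_notMem ha _)]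
      simp
  have hi : ∀ a, Integrable ((s a).indicator (f a)) := fun a => (hf a).indicator (hs a)
  have hn : ∀ a x, 0 ≤ (s a).indicator (f a) x := fun a x =>
    Set.indicator_nonneg (fun y _ => h0 a y) x
  simp_rw [e1]
  rw [volume_pi, ← ofReal_integral_eq_lintegral_ofReal (Integrable.fintype_prod hi)
    (ae_of_all _ fun x => Finset.prod_nonneg fun a _ => hn a _),
    integral_fintype_prod_eq_prod, ENNReal.ofReal_prod_of_nonneg
      fun a _ => integral_nonneg (hn a)]
  refine Finset.prod_congr rfl fun a _ => ?_
  rw [withDensity_apply _ (hs a), ← lintegral_indicator (hs a),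
    ofReal_integral_eq_lintegral_ofReal (hi a) (ae_of_all _ (hn a))]
  refine lintegral_congr fun x => ?_
  by_cases hx : x ∈ s a
  · simp [hx]
  · simp [hx]

theorem pi_gaussianReal_eq_withDensity (v : α → NNReal) (hv : ∀ a, v a ≠ 0) :
    Measure.pi (fun a => gaussianReal 0 (v a))
      = (volume : Measure (α → ℝ)).withDensity
        fun x => ENNReal.ofReal (∏ a, gaussianPDFReal 0 (v a) (x a)) := by
  have e : ∀ a, gaussianReal 0 (v a)
      = volume.withDensity fun x => ENNReal.ofReal (gaussianPDFReal 0 (v a) x) := fun a =>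
    gaussianReal_of_var_ne_zero 0 (hv a)
  have : ∀ a, SigmaFinite (volume.withDensity fun x =>
      ENNReal.ofReal (gaussianPDFReal 0 (v a) x)) := fun a => by
    rw [← e a]; infer_instance
  rw [← pi_withDensity_ofReal _ (fun a => integrable_gaussianPDFReal 0 (v a))
    fun a x => gaussianPDFReal_nonneg 0 (v a) x]
  congr 1
  funext a
  exact e a

theorem gaussianPi_absolutelyContinuous : gaussianPi α ≪ (volume : Measure (α → ℝ)) := by
  have := pi_gaussianReal_eq_withDensity (fun _ : α => (1 : NNReal)) fun _ => one_ne_zero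
  rw [gaussianPi, this]
  exact withDensity_absolutelyContinuous _ _

end PiDensity

/-! ### Almost sure simplicity of the spectrum -/

section SimpleSpectrum

variable {n : Type*} [Fintype n] [DecidableEq n]

theorem trace_pow_eq_sum {A : Matrix n n ℂ} (hA : A.IsHermitian) (k : ℕ) :
    (A ^ k).trace = ∑ i, ((hA.eigenvalues i : ℂ)) ^ k := by
  have h : A ^ k = Unitary.conjStarAlgAut ℂ _ hA.eigenvectorUnitary
      ((diagonal fun i => (hA.eigenvalues i : ℂ)) ^ k) := by
    conv_lhs => rw [hA.spectral_theorem]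
    rw [map_pow]
    rfl
  rw [h, Unitary.conjStarAlgAut_apply, Matrix.mul_assoc, Matrix.trace_mul_comm, Matrix.mul_assoc,
    Unitary.coe_star_mul_self, Matrix.mul_one, diagonal_pow, trace_diagonal]
  rfl

/-- The determinant of the matrix of power traces; for a diagonalisable matrix it is the
discriminant of the characteristic polynomial. -/
def powDisc {R : Type*} [CommRing R] (A : Matrix n n R) : R :=
  (Matrix.of fun i j : Fin (Fintype.card n) => (A ^ (i + j : ℕ)).trace).det

/-- The Hankel matrix of power sums is `VᵀV` for the Vandermonde matrix `V` of the eigenvalues. -/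
theorem powDisc_ne_zero_iff {A : Matrix n n ℂ} (v : n → ℂ) (hv : ∀ k, (A ^ k).trace = ∑ i, v i ^ k) :
    powDisc A ≠ 0 ↔ Function.Injective v := by
  let e := (Fintype.equivFin n).symm
  have h : (Matrix.of fun i j : Fin (Fintype.card n) => (A ^ (i + j : ℕ)).trace)
      = (vandermonde (v ∘ e))ᵀ * vandermonde (v ∘ e) := by
    ext i j
    simp only [Matrix.of_apply, hv, Matrix.mul_apply, transpose_apply, vandermonde_apply,
      Function.comp_apply, ← pow_add]
    exact (e.sum_comp fun m => v m ^ (i + j : ℕ)).symm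
  rw [powDisc, h, det_mul, det_transpose, mul_self_ne_zero, det_vandermonde_ne_zero_iff]
  exact e.injective_comp v

theorem powDisc_ne_zero_iff_eigenvalues {A : Matrix n n ℂ} (hA : A.IsHermitian) :
    powDisc A ≠ 0 ↔ Function.Injective hA.eigenvalues := by
  rw [powDisc_ne_zero_iff (fun i => (hA.eigenvalues i : ℂ)) fun k => trace_pow_eq_sum hA k]
  exact ⟨fun h i j hij => h (by simp [hij]), fun h i j hij => h (Complex.ofReal_injective hij)⟩

theorem powDisc_smul (c : ℂ) (A : Matrix n n ℂ) :
    ∃ m : ℕ, powDisc (c • A) = c ^ m * powDisc A := by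
  refine ⟨(∑ i : Fin (Fintype.card n), (i : ℕ)) + ∑ i : Fin (Fintype.card n), (i : ℕ), ?_⟩
  have h1 := det_mul_column (fun i : Fin (Fintype.card n) => c ^ (i : ℕ))
    (Matrix.of fun i j : Fin (Fintype.card n) => c ^ (j : ℕ) * (A ^ (i + j : ℕ)).trace)
  have h2 := det_mul_row (fun j : Fin (Fintype.card n) => c ^ (j : ℕ))
    (Matrix.of fun i j : Fin (Fintype.card n) => (A ^ (i + j : ℕ)).trace)
  simp only [Matrix.of_apply] at h1 h2
  rw [h2, ← mul_assoc, Finset.prod_pow_eq_pow_sum, ← pow_add] at h1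
  rw [powDisc, powDisc, ← h1]
  congr 1
  ext i j
  simp only [Matrix.of_apply, smul_pow, trace_smul, smul_eq_mul]
  ring

theorem powDisc_map {R S : Type*} [CommRing R] [CommRing S] (f : R →+* S) (A : Matrix n n R) :
    powDisc (A.map f) = f (powDisc A) := by
  rw [powDisc, powDisc, RingHom.map_det]
  congr 1
  ext i j
  simp only [Matrix.of_apply, RingHom.mapMatrix_apply, Matrix.map_apply]
  rw [← Matrix.map_pow, trace, trace, map_sum]
  rfl

open Polynomial in
-- By homogeneity `A + s D` may be replaced by `D + s⁻¹ A`. The discriminant of the latter is a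
-- polynomial in `s⁻¹` whose value at 0 is `powDisc D ≠ 0`.
theorem finite_powDisc_add_smul_eq_zero (A D : Matrix n n ℂ) (hD : powDisc D ≠ 0) :
    {s : ℝ | powDisc (A + (s : ℂ) • D) = 0}.Finite := by
  let Q : Matrix n n ℂ[X] := D.map C + (X : ℂ[X]) • A.map C
  have hQ : ∀ t : ℂ, (powDisc Q).eval t = powDisc (D + t • A) := by
    intro t
    rw [← coe_evalRingHom, ← powDisc_map]
    congr 1
    ext i j
    simp [Q]
    exact mul_comm _ _
  have hQ0 : powDisc Q ≠ 0 := by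
    intro h
    apply hD
    have := hQ 0
    rw [h] at this
    simpa using this.symm
  have hfin : {t : ℂ | (powDisc Q).eval t = 0}.Finite := by
    refine (powDisc Q).roots.toFinset.finite_toSet.subset fun t ht => ?_
    simpa [mem_roots hQ0] using ht
  refine ((hfin.preimage (f := fun s : ℝ => ((s : ℂ))⁻¹) ?_).union (Set.finite_singleton 0)).subset ?_
  · intro a _ b _ hab
    simpa using hab
  · intro s hs
    by_cases h0 : s = 0
    · right; exact h0
    · left
      have h0' : (s : ℂ) ≠ 0 := by exact_mod_cast h0
      obtain ⟨m, hm⟩ := powDisc_smul (s : ℂ) (D + (s : ℂ)⁻¹ • A)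
      have e : (s : ℂ) • (D + (s : ℂ)⁻¹ • A) = A + (s : ℂ) • D := by
        rw [smul_add, smul_smul, mul_inv_cancel₀ h0', one_smul, add_comm]
      rw [e, show powDisc (A + (s : ℂ) • D) = 0 from hs] at hm
      change (powDisc Q).eval ((s : ℂ)⁻¹) = 0
      rw [hQ]
      rcases mul_eq_zero.1 hm.symm with h | h
      · exact absurd h (pow_ne_zero m h0')
      · exact h

theorem measurable_pow_apply {T : Type*} [MeasurableSpace T] {A : T → Matrix n n ℂ}
    (hA : ∀ i j, Measurable fun t => A t i j) (k : ℕ) (i j : n) :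
    Measurable fun t => (A t ^ k) i j := by
  induction k generalizing i j with
  | zero => simp
  | succ k ih =>
    simp only [pow_succ, Matrix.mul_apply]
    exact Finset.measurable_sum _ fun m _ => (ih i m).mul (hA m j)

theorem measurable_trace_pow {T : Type*} [MeasurableSpace T] {A : T → Matrix n n ℂ}
    (hA : ∀ i j, Measurable fun t => A t i j) (k : ℕ) :
    Measurable fun t => (A t ^ k).trace := by
  simp only [trace, diag_apply]
  exact Finset.measurable_sum _ fun m _ => measurable_pow_apply hA k m m

theorem measurable_powDisc {T : Type*} [MeasurableSpace T] {A : T → Matrix n n ℂ}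
    (hA : ∀ i j, Measurable fun t => A t i j) : Measurable fun t => powDisc (A t) :=
  measurable_det fun i j => measurable_trace_pow hA (i + j)

variable {X ι : Type*} [Fintype X] [DecidableEq X] [Fintype ι] [DecidableEq ι]

theorem ae_injective_eigenvalues {K : Matrix (X × ι) (X × ι) ℂ} (hK : K.IsHermitian) {σ : ℝ}
    (hσ : σ ≠ 0) :
    ∀ᵐ g ∂(gaussianPi (X × ι × ι)),
      Function.Injective (isHermitian_add_symBlocks hK σ g).eigenvalues := by
  simp_rw [← powDisc_ne_zero_iff_eigenvalues]
  refine gaussianPi_absolutelyContinuous.ae_le ?_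
  let f : X × ι → ℝ := fun p => ((Fintype.equivFin (X × ι) p : ℕ) : ℝ)
  have hf : Function.Injective f := fun p q h =>
    (Fintype.equivFin (X × ι)).injective (Fin.ext (Nat.cast_injective h))
  -- A direction in which the perturbation is diagonal with distinct entries. Every line parallel to
  -- `d` meets the degenerate set in finitely many points, so this set is Lebesgue null.
  let d : X × ι × ι → ℝ := fun p => if p.2.1 = p.2.2 then f (p.1, p.2.1) else 0
  have hd : (σ : ℂ) • symBlocks d = diagonal fun p => ((σ * (2 * f p) : ℝ) : ℂ) := by
    ext ⟨a, i⟩ ⟨b, j⟩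
    by_cases h1 : a = b
    · subst h1
      by_cases h2 : i = j
      · subst h2; simp [symBlocks, d, two_mul]
      · simp [symBlocks, d, h2, Ne.symm h2]
    · simp [symBlocks, h1]
  have hD : powDisc ((σ : ℂ) • symBlocks d) ≠ 0 := by
    rw [hd, powDisc_ne_zero_iff (fun p => ((σ * (2 * f p) : ℝ) : ℂ)) fun k => by
      rw [diagonal_pow, trace_diagonal]; rfl]
    intro p q h
    refine hf ?_
    have h' : σ * (2 * f p) = σ * (2 * f q) := Complex.ofReal_injective h
    have := mul_left_cancel₀ hσ h'
    linarith
  have hadd : ∀ (g : X × ι × ι → ℝ) (s : ℝ), K + (σ : ℂ) • symBlocks (g + s • d)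
      = (K + (σ : ℂ) • symBlocks g) + (s : ℂ) • ((σ : ℂ) • symBlocks d) := by
    intro g s
    ext ⟨a, i⟩ ⟨b, j⟩
    simp only [symBlocks, Matrix.add_apply, Matrix.smul_apply, Matrix.of_apply, Pi.add_apply,
      Pi.smul_apply, smul_eq_mul]
    split_ifs
    · push_cast; ring
    · ring
  have hm : MeasurableSet {g : X × ι × ι → ℝ | powDisc (K + (σ : ℂ) • symBlocks g) ≠ 0} :=
    (measurableSet_eq_fun (measurable_powDisc fun a b =>
      ((measurable_symBlocks_apply a b).const_smul (σ : ℂ)).const_add _) measurable_const).compl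
  refine ae_mem_of_ae_add_linearMap_mem (LinearMap.toSpanSingleton ℝ (X × ι × ι → ℝ) d)
    (volume : Measure ℝ) volume hm fun g => ?_
  have hfin := finite_powDisc_add_smul_eq_zero (K + (σ : ℂ) • symBlocks g) _ hD
  rw [ae_iff]
  refine measure_mono_null (fun s hs => ?_) (hfin.measure_zero volume)
  by_contra h
  refine hs ?_
  change powDisc (K + (σ : ℂ) • symBlocks (g + s • d)) ≠ 0
  rw [hadd]
  exact h

end SimpleSpectrum

/-! ### Wegner estimate for a Gaussian perturbation -/

section Wegner

variable {X ι : Type*} [Fintype X] [DecidableEq X] [Fintype ι] [DecidableEq ι]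

/-- The number of eigenvalues of a Hermitian matrix in a closed interval. -/
def countIcc {n : Type*} [Fintype n] [DecidableEq n] {A : Matrix n n ℂ} (hA : A.IsHermitian)
    (a b : ℝ) : ℕ :=
  open Classical in (Finset.univ.filter fun i => hA.eigenvalues i ∈ Set.Icc a b).card

/-- The separation makes the intervals of radius `η` around the eigenvalues disjoint. Each has
length `2η` and carries an integrand of at least `1 / (2η)`. -/
theorem countIcc_le_lintegral_frob {A : Matrix (X × ι) (X × ι) ℂ} (hA : A.IsHermitian) {a b η : ℝ}
    (hη : 0 < η) (hsep : ∀ i j, i ≠ j → 2 * η < |hA.eigenvalues i - hA.eigenvalues j|) :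
    (countIcc hA a b : ℝ≥0∞) ≤ ∫⁻ E in Set.Icc (a - η) (b + η), ENNReal.ofReal
      (∑ x, frob (imSym (A - (⟨E, η⟩ : ℂ) • (1 : Matrix (X × ι) (X × ι) ℂ))⁻¹ x)) := by
  classical
  set F : ℝ → ℝ≥0∞ := fun E => ENNReal.ofReal
    (∑ x, frob (imSym (A - (⟨E, η⟩ : ℂ) • (1 : Matrix (X × ι) (X × ι) ℂ))⁻¹ x)) with hF
  unfold countIcc
  set S := Finset.univ.filter fun i => hA.eigenvalues i ∈ Set.Icc a b with hS
  have hdisj : Set.PairwiseDisjoint (S : Set (X × ι))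
      fun i => Set.Icc (hA.eigenvalues i - η) (hA.eigenvalues i + η) := by
    intro i _ j _ hij
    refine Set.disjoint_left.2 fun E h1 h2 => ?_
    refine absurd (hsep i j hij) (not_lt.2 (abs_le.2 ⟨?_, ?_⟩))
    · linarith [h1.2, h2.1, h1.1, h2.2]
    · linarith [h1.2, h2.1, h1.1, h2.2]
  have hsub : (⋃ i ∈ S, Set.Icc (hA.eigenvalues i - η) (hA.eigenvalues i + η))
      ⊆ Set.Icc (a - η) (b + η) := by
    refine Set.iUnion₂_subset fun i hi => ?_
    have := (Finset.mem_filter.1 hi).2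
    exact Set.Icc_subset_Icc (by linarith [this.1]) (by linarith [this.2])
  have hone : ∀ i, 1 ≤ ∫⁻ E in Set.Icc (hA.eigenvalues i - η) (hA.eigenvalues i + η), F E := by
    intro i
    calc (1 : ℝ≥0∞) = ∫⁻ _ in Set.Icc (hA.eigenvalues i - η) (hA.eigenvalues i + η),
          ENNReal.ofReal (2 * η)⁻¹ := by
          rw [setLIntegral_const, Real.volume_Icc, ← ENNReal.ofReal_mul (by positivity)]
          rw [← ENNReal.ofReal_one]
          congr 1
          field_simp
          ring
      _ ≤ _ := by
          refine setLIntegral_mono' measurableSet_Icc fun E hE => ?_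
          refine ENNReal.ofReal_le_ofReal (inv_two_mul_le_sum_frob hA hη i (abs_le.2 ⟨?_, ?_⟩))
          · linarith [hE.2]
          · linarith [hE.1]
  calc (S.card : ℝ≥0∞) = ∑ i ∈ S, 1 := by simp
    _ ≤ ∑ i ∈ S, ∫⁻ E in Set.Icc (hA.eigenvalues i - η) (hA.eigenvalues i + η), F E :=
        Finset.sum_le_sum fun i _ => hone i
    _ = ∫⁻ E in ⋃ i ∈ S, Set.Icc (hA.eigenvalues i - η) (hA.eigenvalues i + η), F E :=
        (lintegral_biUnion_finset hdisj (fun i _ => measurableSet_Icc) F).symm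
    _ ≤ _ := lintegral_mono_set hsub

theorem measurable_frob_resolvent (K : Matrix (X × ι) (X × ι) ℂ) (σ η : ℝ) (x : X) :
    Measurable fun p : (X × ι × ι → ℝ) × ℝ => frob (imSym (K + (σ : ℂ) • symBlocks p.1
      - (⟨p.2, η⟩ : ℂ) • (1 : Matrix (X × ι) (X × ι) ℂ))⁻¹ x) := by
  refine measurable_frob_imSym (fun a b => ?_) x
  have h1 : ∀ E : ℝ, (⟨E, η⟩ : ℂ) = (E : ℂ) + η * Complex.I := fun E =>
    Complex.ext (by simp) (by simp)
  have h2 : Measurable fun p : (X × ι × ι → ℝ) × ℝ =>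
      (K + (σ : ℂ) • symBlocks p.1 : Matrix (X × ι) (X × ι) ℂ) a b :=
    (((measurable_symBlocks_apply a b).const_smul (σ : ℂ)).const_add (K a b)).comp measurable_fst
  simp only [h1, Matrix.sub_apply, Matrix.smul_apply, smul_eq_mul]
  refine Measurable.sub ?_ (by fun_prop)
  exact h2

/-- The constant in the Wegner estimate for a Gaussian perturbation of strength `σ`. -/
def wegnerConst (ι : Type*) [Fintype ι] (σ : ℝ) : ℝ≥0∞ :=
  2 / (ENNReal.ofReal (σ * Real.exp (-1 / 2) / √(Fintype.card ι)) * gaussianAbs)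

theorem lintegral_frob_resolvent_le [Nonempty ι] {K : Matrix (X × ι) (X × ι) ℂ}
    (hK : K.IsHermitian) {σ : ℝ} (hσ : 0 < σ) {η : ℝ} (hη : 0 < η) (E : ℝ) (x : X) :
    ∫⁻ g, ENNReal.ofReal (frob (imSym (K + (σ : ℂ) • symBlocks g
      - (⟨E, η⟩ : ℂ) • (1 : Matrix (X × ι) (X × ι) ℂ))⁻¹ x)) ∂(gaussianPi (X × ι × ι))
      ≤ wegnerConst ι σ := by
  have h := lintegral_frob_imSym_le hK hσ.le (z := ⟨E, η⟩) hη.ne' x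
  have hc : 0 < σ * Real.exp (-1 / 2) / √(Fintype.card ι) := by
    have : (0 : ℝ) < Fintype.card ι := by exact_mod_cast Fintype.card_pos
    positivity
  rw [wegnerConst, ENNReal.le_div_iff_mul_le
    (Or.inl (mul_ne_zero (by simpa using hc) gaussianAbs_ne_zero)) (Or.inr (by simp))]
  rwa [mul_comm]

omit [DecidableEq ι] in
theorem wegnerConst_ne_top [Nonempty ι] {σ : ℝ} (hσ : 0 < σ) : wegnerConst ι σ ≠ ∞ := by
  have hc : 0 < σ * Real.exp (-1 / 2) / √(Fintype.card ι) := by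
    have : (0 : ℝ) < Fintype.card ι := by exact_mod_cast Fintype.card_pos
    positivity
  exact ENNReal.div_ne_top (by simp) (mul_ne_zero (by simpa using hc) gaussianAbs_ne_zero)

theorem lintegral_countIcc_le [Nonempty ι] {K : Matrix (X × ι) (X × ι) ℂ} (hK : K.IsHermitian)
    {σ : ℝ} (hσ : 0 < σ) (a b : ℝ) :
    ∫⁻ g, (countIcc (isHermitian_add_symBlocks hK σ g) a b : ℝ≥0∞) ∂(gaussianPi (X × ι × ι))
      ≤ Fintype.card X * wegnerConst ι σ * ENNReal.ofReal (b - a) := by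
  let η : ℕ → ℝ := fun k => 1 / ((k : ℝ) + 1)
  have hη : ∀ k, 0 < η k := fun k => by positivity
  have hη0 : Tendsto η atTop (𝓝 0) := tendsto_one_div_add_atTop_nhds_zero_nat
  let F : ℕ → (X × ι × ι → ℝ) → ℝ≥0∞ := fun k g =>
    ∫⁻ E in Set.Icc (a - η k) (b + η k), ENNReal.ofReal (∑ x, frob (imSym
      (K + (σ : ℂ) • symBlocks g - (⟨E, η k⟩ : ℂ) • (1 : Matrix (X × ι) (X × ι) ℂ))⁻¹ x))
  have hmj : ∀ k, Measurable fun p : (X × ι × ι → ℝ) × ℝ => ENNReal.ofReal (∑ x, frob (imSym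
      (K + (σ : ℂ) • symBlocks p.1 - (⟨p.2, η k⟩ : ℂ) • (1 : Matrix (X × ι) (X × ι) ℂ))⁻¹ x)) :=
    fun k => (Finset.measurable_sum _ fun x _ =>
      measurable_frob_resolvent K σ (η k) x).ennreal_ofReal
  have hFm : ∀ k, Measurable (F k) := fun k => (hmj k).lintegral_prod_right'
  have hbound : ∀ k, ∫⁻ g, F k g ∂(gaussianPi (X × ι × ι))
      ≤ Fintype.card X * wegnerConst ι σ * ENNReal.ofReal (b - a + 2 * η k) := by
    intro k
    have h1 : ∫⁻ g, F k g ∂(gaussianPi (X × ι × ι))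
        = ∫⁻ E in Set.Icc (a - η k) (b + η k), (∫⁻ g, ENNReal.ofReal (∑ x, frob (imSym
      (K + (σ : ℂ) • symBlocks g - (⟨E, η k⟩ : ℂ) • (1 : Matrix (X × ι) (X × ι) ℂ))⁻¹ x))
        ∂(gaussianPi (X × ι × ι))) :=
      lintegral_lintegral_swap (hmj k).aemeasurable
    rw [h1]
    calc _ ≤ ∫⁻ _ in Set.Icc (a - η k) (b + η k), (Fintype.card X * wegnerConst ι σ) := by
          refine lintegral_mono fun E => ?_
          have e : ∀ g : X × ι × ι → ℝ, ENNReal.ofReal (∑ x, frob (imSym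
              (K + (σ : ℂ) • symBlocks g - (⟨E, η k⟩ : ℂ) • 1)⁻¹ x))
              = ∑ x, ENNReal.ofReal (frob (imSym
              (K + (σ : ℂ) • symBlocks g - (⟨E, η k⟩ : ℂ) • 1)⁻¹ x)) := fun g =>
            ENNReal.ofReal_sum_of_nonneg fun x _ => Real.sqrt_nonneg _
          simp_rw [e]
          have hm : ∀ x, Measurable fun g : X × ι × ι → ℝ => ENNReal.ofReal (frob (imSym
              (K + (σ : ℂ) • symBlocks g - (⟨E, η k⟩ : ℂ) • 1)⁻¹ x)) := fun x =>
            ((measurable_frob_resolvent K σ (η k) x).comp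
              (measurable_id.prodMk (measurable_const (a := E)))).ennreal_ofReal
          rw [lintegral_finsetSum _ fun x _ => hm x]
          refine (Finset.sum_le_sum fun x _ =>
            lintegral_frob_resolvent_le hK hσ (hη k) E x).trans (le_of_eq ?_)
          simp
      _ = _ := by
          rw [setLIntegral_const, Real.volume_Icc]
          congr 2
          ring
  -- For simple spectrum the separation condition holds once `η k` is small enough, with a threshold
  -- depending on `g`; Fatou's lemma absorbs this lack of uniformity.
  have hlim : ∀ᵐ g ∂(gaussianPi (X × ι × ι)),
      (countIcc (isHermitian_add_symBlocks hK σ g) a b : ℝ≥0∞)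
        ≤ liminf (fun k => F k g) atTop := by
    filter_upwards [ae_injective_eigenvalues hK hσ.ne'] with g hg
    set lam := (isHermitian_add_symBlocks hK σ g).eigenvalues with hlam
    refine le_liminf_of_le (by isBoundedDefault) ?_
    have hev : ∀ i j, i ≠ j → ∀ᶠ k in atTop, 2 * η k < |lam i - lam j| := by
      intro i j hij
      have hpos : 0 < |lam i - lam j| := abs_pos.2 (sub_ne_zero.2 fun h => hij (hg h))
      have h2 : Tendsto (fun k => 2 * η k) atTop (𝓝 0) := by simpa using hη0.const_mul 2
      exact h2.eventually_lt_const hpos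
    have hev' : ∀ᶠ k in atTop, ∀ i j, i ≠ j → 2 * η k < |lam i - lam j| := by
      simp only [eventually_all]
      exact hev
    filter_upwards [hev'] with k hk
    exact countIcc_le_lintegral_frob (isHermitian_add_symBlocks hK σ g) (hη k) hk
  calc _ ≤ ∫⁻ g, liminf (fun k => F k g) atTop ∂(gaussianPi (X × ι × ι)) := lintegral_mono_ae hlim
    _ ≤ liminf (fun k => ∫⁻ g, F k g ∂(gaussianPi (X × ι × ι))) atTop := lintegral_liminf_le hFm
    _ ≤ liminf (fun k => Fintype.card X * wegnerConst ι σ * ENNReal.ofReal (b - a + 2 * η k))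
          atTop := liminf_le_liminf (Eventually.of_forall hbound)
    _ = Fintype.card X * wegnerConst ι σ * ENNReal.ofReal (b - a) := by
        refine Tendsto.liminf_eq (ENNReal.Tendsto.const_mul ?_ (Or.inr ?_))
        · refine (ENNReal.continuous_ofReal.tendsto _).comp ?_
          simpa using (hη0.const_mul 2).const_add (b - a)
        · exact ENNReal.mul_ne_top (by simp) (wegnerConst_ne_top hσ)

end Wegner

/-! ### Gaussian measures up to normalisation -/

section Normalised

variable {E F : Type*} [MeasurableSpace E] [MeasurableSpace F]

/-- The measure `exp (-h) dν` is a finite non-zero multiple of `G`. -/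
def IsNormalised (ν : Measure E) (h : E → ℝ) (G : Measure E) : Prop :=
  ∃ c : ℝ≥0∞, c ≠ 0 ∧ c ≠ ⊤ ∧
    ν.withDensity (fun x => ENNReal.ofReal (Real.exp (-h x))) = c • G

theorem IsNormalised.prod {ν : Measure E} {ν' : Measure F} [SigmaFinite ν] [SigmaFinite ν']
    {h : E → ℝ} {h' : F → ℝ} {G : Measure E} {G' : Measure F} [SigmaFinite G] [SigmaFinite G']
    (hh : Measurable h) (hh' : Measurable h')
    (H : IsNormalised ν h G) (H' : IsNormalised ν' h' G') :
    IsNormalised (ν.prod ν') (fun p => h p.1 + h' p.2) (G.prod G') := by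
  obtain ⟨c, hc, hc', e⟩ := H
  obtain ⟨d, hd, hd', e'⟩ := H'
  refine ⟨c * d, mul_ne_zero hc hd, ENNReal.mul_ne_top hc' hd', ?_⟩
  have h1 : (fun p : E × F => ENNReal.ofReal (Real.exp (-(h p.1 + h' p.2))))
      = fun p => ENNReal.ofReal (Real.exp (-h p.1)) * ENNReal.ofReal (Real.exp (-h' p.2)) := by
    funext p
    rw [← ENNReal.ofReal_mul (Real.exp_nonneg _), ← Real.exp_add, neg_add]
  have h2 := prod_withDensity (μ := ν) (ν := ν')
    (f := fun x => ENNReal.ofReal (Real.exp (-h x)))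
    (g := fun x => ENNReal.ofReal (Real.exp (-h' x))) (by fun_prop) (by fun_prop)
  rw [h1, ← h2, e, e', Measure.prod_smul_left, Measure.prod_smul_right, smul_smul]

theorem IsNormalised.map {ν : Measure E} {ν' : Measure F} {f : E → F} (hf : MeasurePreserving f ν ν')
    {h : F → ℝ} (hh : Measurable h) {G : Measure E} (H : IsNormalised ν (h ∘ f) G) :
    IsNormalised ν' h (G.map f) := by
  obtain ⟨c, hc, hc', e⟩ := H
  refine ⟨c, hc, hc', ?_⟩
  rw [← Measure.map_smul, ← e, ← hf.map_eq]
  ext s hs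
  rw [withDensity_apply _ hs, setLIntegral_map hs (by fun_prop) hf.measurable,
    Measure.map_apply hf.measurable hs, withDensity_apply _ (hf.measurable hs)]
  rfl

/-- The weight `exp (-s x²)` is that of a centred Gaussian of variance `1 / (2s)`. -/
theorem isNormalised_gaussian (α : Type*) [Fintype α] {s : ℝ} (hs : 0 < s) :
    IsNormalised (volume : Measure (α → ℝ)) (fun x => s * ∑ a, x a ^ 2)
      ((gaussianPi α).map fun x a => (√(2 * s))⁻¹ * x a) := by
  have hv : (.mk ((√(2 * s))⁻¹ ^ 2) (sq_nonneg _) * 1 : NNReal) ≠ 0 := by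
    rw [mul_one, Ne, ← NNReal.coe_inj]
    simp only [NNReal.coe_mk, NNReal.coe_zero]
    positivity
  have e : (gaussianPi α).map (fun x a => (√(2 * s))⁻¹ * x a)
      = Measure.pi fun _ => gaussianReal 0 (.mk ((√(2 * s))⁻¹ ^ 2) (sq_nonneg _) * 1) := by
    rw [gaussianPi]
    have : ∀ a : α, SigmaFinite ((gaussianReal 0 1).map fun x => (√(2 * s))⁻¹ * x) := fun a => by
      rw [gaussianReal_map_const_mul]; infer_instance
    rw [Measure.pi_map_pi (fun a => by fun_prop)]
    simp only [gaussianReal_map_const_mul, mul_zero]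
  rw [e, pi_gaussianReal_eq_withDensity _ fun _ => hv]
  set v : NNReal := .mk ((√(2 * s))⁻¹ ^ 2) (sq_nonneg _) * 1 with hvdef
  have hv' : (v : ℝ) = (2 * s)⁻¹ := by
    rw [hvdef, mul_one]
    simp only [NNReal.coe_mk, inv_pow]
    rw [Real.sq_sqrt (by positivity)]
  have hpos : 0 < √(2 * Real.pi * v) := by
    rw [hv']; positivity
  refine ⟨ENNReal.ofReal (√(2 * Real.pi * v) ^ Fintype.card α), ?_, ENNReal.ofReal_ne_top, ?_⟩
  · rw [Ne, ENNReal.ofReal_eq_zero, not_le]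
    positivity
  · have hm : Measurable fun x : α → ℝ => ENNReal.ofReal (∏ a, gaussianPDFReal 0 v (x a)) :=
      Measurable.ennreal_ofReal (Finset.measurable_prod _ fun a _ =>
        (measurable_gaussianPDFReal 0 v).comp (measurable_pi_apply a))
    rw [← withDensity_smul _ hm]
    congr 1
    funext x
    simp only [Pi.smul_apply, smul_eq_mul]
    rw [← ENNReal.ofReal_mul (by positivity)]
    congr 1
    simp only [gaussianPDFReal, Finset.prod_mul_distrib, Finset.prod_const, Finset.card_univ,
      sub_zero, ← Real.exp_sum]
    rw [← mul_assoc, ← mul_pow, mul_inv_cancel₀ hpos.ne', one_pow, one_mul, Finset.mul_sum,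
      ← Finset.sum_neg_distrib]
    congr 1
    refine Finset.sum_congr rfl fun a _ => ?_
    rw [hv']
    field_simp

/-- Assemble complex vectors from their real and imaginary parts. -/
def complexOfParts (α : Type*) (p : (α → ℝ) × (α → ℝ)) : α → ℂ := fun a => ⟨p.1 a, p.2 a⟩

theorem measurePreserving_complexOfParts (α : Type*) [Fintype α] :
    MeasurePreserving (complexOfParts α) := by
  have h1 := (volume_measurePreserving_arrowProdEquivProdArrow ℝ ℝ α).symm
  have h2 := volume_preserving_pi (ι := α) (fun _ => Complex.volume_preserving_equiv_real_prod.symm)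
  exact h2.comp h1

end Normalised

/-! ### Symmetrised real Gaussian part of the GOE and of the GUE -/

variable {N : ℕ}

theorem gaussianWeight_eq {ν G : Measure (Matrix (Fin N) (Fin N) ℂ)} [IsProbabilityMeasure G]
    {a : ℝ} (H : IsNormalised ν (fun V => a * (Matrix.trace (V * V)).re) G) :
    gaussianWeight ν a = G := by
  obtain ⟨c, hc, hc', e⟩ := H
  simp only [← neg_mul] at e
  simp only [gaussianWeight, e]
  simp [smul_smul, ENNReal.inv_mul_cancel hc hc']

theorem sum_eq_diag_add_upper {M : Type*} [AddCommMonoid M] (F : Fin N → Fin N → M) :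
    ∑ i, ∑ j, F i j = ∑ i, F i i
      + ∑ p : Upper N, (F p.1.1 p.1.2 + F p.1.2 p.1.1) := by
  classical
  rw [← Fintype.sum_prod_type']
  have h1 : ∀ p : Fin N × Fin N, F p.1 p.2
      = (if p.1 = p.2 then F p.1 p.2 else 0)
        + ((if p.1 < p.2 then F p.1 p.2 else 0) + if p.2 < p.1 then F p.1 p.2 else 0) := by
    rintro ⟨i, j⟩
    rcases lt_trichotomy i j with h | h | h
    · simp [h, h.ne, not_lt.2 h.le]
    · simp [h]
    · simp [h, h.ne', not_lt.2 h.le]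
  rw [Finset.sum_congr rfl fun p _ => h1 p, Finset.sum_add_distrib, Finset.sum_add_distrib]
  congr 1
  · rw [Fintype.sum_prod_type]
    simp
  · rw [Finset.sum_add_distrib]
    have h2 : ∀ f : Fin N × Fin N → M,
        ∑ p : Fin N × Fin N, (if p.1 < p.2 then f p else 0) = ∑ p : Upper N, f p.1 := fun f => by
      rw [← Finset.sum_filter, ← Finset.sum_subtype_eq_sum_filter]
      simp [Finset.subtype_univ]
    congr 1
    · exact h2 fun p => F p.1 p.2
    · rw [← h2 fun p => F p.2 p.1, ← (Equiv.prodComm (Fin N) (Fin N)).sum_comp]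
      rfl

theorem trace_hermitianMatrix_sq (u : (Fin N → ℝ) × (Upper N → ℂ)) :
    (Matrix.trace (hermitianMatrix u * hermitianMatrix u)).re
      = ∑ i, u.1 i ^ 2 + 2 * ∑ p, Complex.normSq (u.2 p) := by
  simp only [Matrix.trace, Matrix.diag, Matrix.mul_apply]
  rw [sum_eq_diag_add_upper, Complex.add_re, Complex.re_sum, Complex.re_sum, Finset.mul_sum]
  congr 1
  · refine Finset.sum_congr rfl fun i _ => ?_
    simp [hermitianMatrix, sq]
  · refine Finset.sum_congr rfl fun p _ => ?_
    have := p.2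
    simp only [hermitianMatrix, Matrix.of_apply, this, not_lt.2 this.le, dif_pos, dif_neg,
      not_false_iff, Complex.add_re, Complex.mul_re, Complex.star_def, Complex.conj_re,
      Complex.conj_im, Complex.normSq_apply]
    ring

theorem isHermitian_hermitianMatrix (u : (Fin N → ℝ) × (Upper N → ℂ)) :
    (hermitianMatrix u).IsHermitian := by
  ext i j
  simp only [Matrix.conjTranspose_apply, hermitianMatrix, Matrix.of_apply]
  rcases lt_trichotomy i j with h | h | h
  · simp [h, not_lt.2 h.le]
  · simp [h]
  · simp [h, not_lt.2 h.le]

theorem measurable_trace_sq :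
    Measurable fun V : Matrix (Fin N) (Fin N) ℂ => (Matrix.trace (V * V)).re := by
  simp only [Matrix.trace, Matrix.diag, Matrix.mul_apply]
  have : ∀ i j, Measurable fun V : Matrix (Fin N) (Fin N) ℂ => V i j := fun i j =>
    (measurable_pi_apply j).comp (measurable_pi_apply i)
  exact Complex.measurable_re.comp (Finset.measurable_sum _ fun i _ =>
    Finset.measurable_sum _ fun j _ => (this i j).mul (this j i))

/-- The real symmetric matrix `g + gᵀ`. -/
def symPart (g : Fin N × Fin N → ℝ) : Matrix (Fin N) (Fin N) ℂ :=
  Matrix.of fun i j => ((g (i, j) + g (j, i) : ℝ) : ℂ)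

/-- The diagonal and the normalised symmetrised upper triangle of a real square matrix. -/
def diagUpper (N : ℕ) : (Fin N × Fin N → ℝ) →ₗ[ℝ] (Fin N ⊕ Upper N → ℝ) where
  toFun g := Sum.elim (fun i => g (i, i)) fun p => (g p.1 + g p.1.swap) / √2
  map_add' g g' := by
    funext s
    rcases s with i | p <;> simp
    ring
  map_smul' c g := by
    funext s
    rcases s with i | p <;> simp
    ring

/-- For `i < j` the sum of two independent standard Gaussians has variance 2, and distinct positions
above the diagonal use disjoint entries; hence the division by `√2`. -/
theorem gaussianPi_map_diagUpper :
    (gaussianPi (Fin N × Fin N)).map (diagUpper N) = gaussianPi (Fin N ⊕ Upper N) := by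
  have h2 : (√2)⁻¹ ^ 2 = (2 : ℝ)⁻¹ := by rw [inv_pow, Real.sq_sqrt (by norm_num)]
  refine gaussianPi_map (diagUpper N) (fun t p =>
    if h : p.1 < p.2 then t (.inr ⟨p, h⟩) / √2
    else if h : p.2 < p.1 then t (.inr ⟨p.swap, h⟩) / √2
    else t (.inl p.1)) (fun x t => ?_) fun t => ?_
  · rw [Fintype.sum_prod_type (f := fun p => _), sum_eq_diag_add_upper, Fintype.sum_sum_type]
    congr 1
    · simp [diagUpper]
    · refine Finset.sum_congr rfl fun p _ => ?_
      have := p.2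
      simp only [diagUpper, LinearMap.coe_mk, AddHom.coe_mk, Sum.elim_inr, this, dif_pos,
        not_lt.2 this.le, dif_neg, not_false_iff, Prod.swap_prod_mk]
      rw [Prod.swap]
      ring
  · rw [Fintype.sum_prod_type (f := fun p => _), sum_eq_diag_add_upper, Fintype.sum_sum_type]
    congr 1
    · simp
    · refine Finset.sum_congr rfl fun p _ => ?_
      have := p.2
      simp only [this, dif_pos, not_lt.2 this.le, dif_neg, not_false_iff, Prod.swap_prod_mk,
        div_eq_mul_inv, mul_pow, h2]
      ring

theorem measurePreserving_diagUpper :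
    MeasurePreserving
      (fun g : Fin N × Fin N → ℝ =>
        ((fun i => g (i, i), fun p => (g p.1 + g p.1.swap) / √2) : (Fin N → ℝ) × (Upper N → ℝ)))
      (gaussianPi (Fin N × Fin N)) ((gaussianPi (Fin N)).prod (gaussianPi (Upper N))) := by
  have h1 : MeasurePreserving (diagUpper N) (gaussianPi (Fin N × Fin N))
      (gaussianPi (Fin N ⊕ Upper N)) :=
    ⟨(diagUpper N).continuous_of_finiteDimensional.measurable, gaussianPi_map_diagUpper⟩
  have h2 := measurePreserving_sumPiEquivProdPi (X := fun _ : Fin N ⊕ Upper N => ℝ)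
    fun _ => gaussianReal 0 1
  exact h2.comp h1

theorem measurePreserving_scale (α : Type*) [Fintype α] (c : ℝ) :
    MeasurePreserving (fun (x : α → ℝ) a => c * x a) (gaussianPi α)
      ((gaussianPi α).map fun x a => c * x a) :=
  ⟨by fun_prop, rfl⟩

instance (α : Type*) [Fintype α] (c : ℝ) :
    IsProbabilityMeasure ((gaussianPi α).map fun x a => c * x a) :=
  Measure.isProbabilityMeasure_map (measurePreserving_scale α c).measurable.aemeasurable

/-- The GOE weight gives variance `2 / N` on the diagonal and `1 / N` above it. The matrix `σ (g +
gᵀ)` has variances `4σ²` and `2σ²`, so `σ² = 1 / (2N)` matches both. -/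
theorem measurePreserving_GOE (hN : 0 < N) :
    MeasurePreserving (fun g => (((√2)⁻¹ / √N : ℝ) : ℂ) • symPart g)
      (gaussianPi (Fin N × Fin N)) (GOE N) := by
  have hN' : (0 : ℝ) < N := Nat.cast_pos.2 hN
  have h1 := isNormalised_gaussian (Fin N) (s := N / 4) (by positivity)
  have h2 := isNormalised_gaussian (Upper N) (s := N / 2) (by positivity)
  have h3 := h1.prod (by fun_prop) (by fun_prop) h2
  have hs : MeasurePreserving (symmetricMatrix (N := N)) volume (lebesgueSymmetric N) :=
    ⟨measurable_symmetricMatrix, rfl⟩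
  have h4 := IsNormalised.map hs (h := fun V => (N : ℝ) / 4 * (Matrix.trace (V * V)).re)
    (measurable_trace_sq.const_mul _) (G := _) (by
      refine Eq.mp ?_ h3
      congr 1
      funext u
      simp only [Function.comp, symmetricMatrix, trace_hermitianMatrix_sq, Complex.normSq_ofReal]
      simp only [← sq]
      ring)
  have hp := Measure.isProbabilityMeasure_map (μ := ((gaussianPi (Fin N)).map
      fun x a => (√(2 * ((N : ℝ) / 4)))⁻¹ * x a).prod ((gaussianPi (Upper N)).map
      fun x a => (√(2 * ((N : ℝ) / 2)))⁻¹ * x a))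
      (measurable_symmetricMatrix (N := N)).aemeasurable
  have h5 := gaussianWeight_eq h4
  have h6 : MeasurePreserving (symmetricMatrix (N := N)) _ (GOE N) :=
    ⟨measurable_symmetricMatrix, h5.symm⟩
  have h7 := (h6.comp ((measurePreserving_scale (Fin N) _).prod
    (measurePreserving_scale (Upper N) _))).comp measurePreserving_diagUpper
  refine (congrArg (fun f => MeasurePreserving f (gaussianPi (Fin N × Fin N)) (GOE N)) ?_).mp h7
  funext g
  have e1 : √(2 * ((N : ℝ) / 4)) = √N / √2 := by
    rw [← Real.sqrt_div' _ (by norm_num)]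
    congr 1
    ring
  have e2 : √(2 * ((N : ℝ) / 2)) = √N := by
    congr 1
    ring
  have e3 : √2 * √2 = (2 : ℝ) := Real.mul_self_sqrt (by norm_num)
  have hsN : √(N : ℝ) ≠ 0 := by positivity
  ext i j
  simp only [Function.comp, Prod.map, symmetricMatrix, hermitianMatrix, Matrix.of_apply,
    Matrix.smul_apply, symPart, smul_eq_mul, Complex.star_def, Complex.conj_ofReal, e1, e2,
    Prod.swap_prod_mk]
  rcases lt_trichotomy i j with h | h | h
  · simp only [h, dif_pos, ← Complex.ofReal_mul]
    congr 1
    field_simp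
  · subst h
    simp only [lt_irrefl, dif_neg, not_false_iff, ← Complex.ofReal_mul]
    congr 1
    field_simp
    linear_combination g (i, i) * e3
  · simp only [h, not_lt.2 h.le, dif_neg, not_false_iff, dif_pos, ← Complex.ofReal_mul]
    congr 1
    field_simp
    ring

/-- The part of a GUE matrix made of the imaginary parts of its entries. -/
def skewPart (h : Upper N → ℝ) : Matrix (Fin N) (Fin N) ℂ :=
  hermitianMatrix (0, fun p => ⟨0, h p⟩)

/-- The diagonal has variance `1 / N`, and the real and imaginary parts above it have variance `1 /
(2N)` each. The diagonal and the real parts together form `σ (g + gᵀ)` with `σ² = 1 / (4N)`; the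
imaginary parts are independent of them. -/
theorem measurePreserving_GUE (hN : 0 < N) :
    MeasurePreserving (fun p : (Upper N → ℝ) × (Fin N × Fin N → ℝ) =>
        skewPart (fun q => (√(2 * (N : ℝ)))⁻¹ * p.1 q) + ((2⁻¹ / √N : ℝ) : ℂ) • symPart p.2)
      ((gaussianPi (Upper N)).prod (gaussianPi (Fin N × Fin N))) (GUE N) := by
  have hN' : (0 : ℝ) < N := Nat.cast_pos.2 hN
  have h1 := isNormalised_gaussian (Fin N) (s := N / 2) (by positivity)
  have h2 := isNormalised_gaussian (Upper N) (s := N) hN'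
  have h2' := IsNormalised.map (measurePreserving_complexOfParts (Upper N))
    (h := fun z => (N : ℝ) * ∑ p, Complex.normSq (z p)) (by fun_prop) (G := _) (by
      refine Eq.mp ?_ (h2.prod (by fun_prop) (by fun_prop) h2)
      congr 1
      funext u
      simp only [Function.comp, complexOfParts, Complex.normSq_mk, Finset.sum_add_distrib]
      simp only [← sq]
      ring)
  have hp' := Measure.isProbabilityMeasure_map (μ := ((gaussianPi (Upper N)).map
      fun x a => (√(2 * (N : ℝ)))⁻¹ * x a).prod ((gaussianPi (Upper N)).map
      fun x a => (√(2 * (N : ℝ)))⁻¹ * x a))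
      (measurePreserving_complexOfParts (Upper N)).measurable.aemeasurable
  have h3 := h1.prod (by fun_prop) (by fun_prop) h2'
  have hs : MeasurePreserving (hermitianMatrix (N := N)) volume (lebesgueHermitian N) :=
    ⟨measurable_hermitianMatrix, rfl⟩
  have h4 := IsNormalised.map hs (h := fun V => (N : ℝ) / 2 * (Matrix.trace (V * V)).re)
    (measurable_trace_sq.const_mul _) (G := _) (by
      refine Eq.mp ?_ h3
      congr 1
      funext u
      simp only [Function.comp, trace_hermitianMatrix_sq]
      ring)
  have hp := Measure.isProbabilityMeasure_map (μ := ((gaussianPi (Fin N)).map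
      fun x a => (√(2 * ((N : ℝ) / 2)))⁻¹ * x a).prod ((((gaussianPi (Upper N)).map
      fun x a => (√(2 * (N : ℝ)))⁻¹ * x a).prod ((gaussianPi (Upper N)).map
      fun x a => (√(2 * (N : ℝ)))⁻¹ * x a)).map (complexOfParts (Upper N))))
      (measurable_hermitianMatrix (N := N)).aemeasurable
  have h5 := gaussianWeight_eq h4
  have h6 : MeasurePreserving (hermitianMatrix (N := N)) _ (GUE N) :=
    ⟨measurable_hermitianMatrix, h5.symm⟩
  have hc : MeasurePreserving (complexOfParts (Upper N)) (((gaussianPi (Upper N)).map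
      fun x a => (√(2 * (N : ℝ)))⁻¹ * x a).prod ((gaussianPi (Upper N)).map
      fun x a => (√(2 * (N : ℝ)))⁻¹ * x a)) _ :=
    ⟨(measurePreserving_complexOfParts (Upper N)).measurable, rfl⟩
  have h7 := h6.comp ((measurePreserving_scale (Fin N) _).prod
    (hc.comp ((measurePreserving_scale (Upper N) _).prod (measurePreserving_scale (Upper N) _))))
  have h8 := ((h7.comp (measurePreserving_prodAssoc _ _ _)).comp
    (measurePreserving_diagUpper.prod (MeasurePreserving.id _))).comp
      (Measure.measurePreserving_swap (μ := gaussianPi (Upper N))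
        (ν := gaussianPi (Fin N × Fin N)))
  refine (congrArg (fun f => MeasurePreserving f _ (GUE N)) ?_).mp h8
  funext p
  obtain ⟨h, g⟩ := p
  have e1 : √(2 * ((N : ℝ) / 2)) = √N := by
    congr 1
    ring
  have e2 : √(2 * (N : ℝ)) = √2 * √N := Real.sqrt_mul (by norm_num) _
  have e3 : √2 * √2 = (2 : ℝ) := Real.mul_self_sqrt (by norm_num)
  have hsN : √(N : ℝ) ≠ 0 := by positivity
  ext i j
  simp only [Function.comp, Prod.map, hermitianMatrix, Matrix.of_apply, skewPart,
    Matrix.add_apply, Matrix.smul_apply, symPart, smul_eq_mul, Complex.star_def, e1, e2,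
    complexOfParts, MeasurableEquiv.prodAssoc, MeasurableEquiv.coe_mk,
    Equiv.prodAssoc_apply, id, Prod.swap]
  have key : ∀ x y : ℝ, (√2 * √N)⁻¹ * ((x + y) / √2) = 2⁻¹ / √N * (x + y) := fun x y => by
    field_simp
    linear_combination -(x + y) * e3
  have key' : ∀ x : ℝ, (√N)⁻¹ * x = 2⁻¹ / √N * (x + x) := fun x => by
    field_simp
    ring
  clear h1 h2 h2' h3 h4 h5 h6 h7 h8 hp hp' hc hs
  rcases lt_trichotomy i j with h' | h' | h'
  · simp only [h', dif_pos, key]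
    refine Complex.ext ?_ ?_ <;> simp
  · subst h'
    simp only [lt_irrefl, dif_neg, not_false_iff, key']
    refine Complex.ext ?_ ?_ <;> simp
  · simp only [h', not_lt.2 h'.le, dif_neg, not_false_iff, dif_pos, key]
    refine Complex.ext ?_ ?_ <;> simp
    exact Or.inl (add_comm _ _)

/-- A random Hermitian matrix with law `μ` is the independent sum of some Hermitian matrix and of
`σ` times a symmetrised real Gaussian matrix. -/
def HasGaussianPart (μ : Measure (Matrix (Fin N) (Fin N) ℂ)) (σ : ℝ) : Prop :=
  ∃ S : (Upper N → ℝ) → Matrix (Fin N) (Fin N) ℂ, (∀ h, (S h).IsHermitian) ∧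
    MeasurePreserving (fun p : (Upper N → ℝ) × (Fin N × Fin N → ℝ) =>
      S p.1 + (σ : ℂ) • symPart p.2)
      ((gaussianPi (Upper N)).prod (gaussianPi (Fin N × Fin N))) μ

theorem hasGaussianPart_GOE (hN : 0 < N) : HasGaussianPart (GOE N) ((√2)⁻¹ / √N) := by
  refine ⟨fun _ => 0, fun _ => Matrix.isHermitian_zero, ?_⟩
  simp only [zero_add]
  exact (measurePreserving_GOE hN).comp measurePreserving_snd

theorem hasGaussianPart_GUE (hN : 0 < N) : HasGaussianPart (GUE N) (2⁻¹ / √N) :=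
  ⟨fun h => skewPart fun q => (√(2 * (N : ℝ)))⁻¹ * h q,
    fun _ => isHermitian_hermitianMatrix _,
    measurePreserving_GUE hN⟩

/-! ### From intervals to measures, vague limits and densities -/

theorem le_smul_volume_of_Icc_le {ν : Measure ℝ} {K : ℝ≥0∞} (hK' : K ≠ ⊤)
    (h : ∀ a b, a ≤ b → ν (Set.Icc a b) ≤ K * ENNReal.ofReal (b - a)) :
    ν ≤ K • (volume : Measure ℝ) := by
  -- The case `K = 0` is separate because the argument below divides by `K`.
  rcases eq_or_ne K 0 with rfl | hK
  · have : ν = 0 := by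
      rw [← Measure.measure_univ_eq_zero, ← iUnion_Icc_intCast ℝ]
      exact measure_iUnion_null fun n => le_antisymm (by simpa using h n (n + 1) (by linarith)) bot_le
    rw [this]
    exact Measure.zero_le _
  have key : K⁻¹ • ν.toOuterMeasure ≤ StieltjesFunction.id.outer := by
    refine OuterMeasure.le_ofFunction.2 fun s => ?_
    rw [StieltjesFunction.length_eq]
    refine le_iInf fun a => le_iInf fun b => le_iInf fun hs => ?_
    -- The length of a set disregards a least element, and `ℝ` has none.
    have hs' : s ⊆ Set.Ioc a b := fun x hx => hs ⟨hx, fun hb => by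
      obtain ⟨y, hy⟩ := exists_lt x
      exact absurd (hb y) (not_le.2 hy)⟩
    rcases le_or_gt a b with hab | hab
    · have h1 : ν s ≤ K * ENNReal.ofReal (b - a) :=
        (measure_mono (hs'.trans Set.Ioc_subset_Icc_self)).trans (h a b hab)
      calc K⁻¹ * ν s ≤ K⁻¹ * (K * ENNReal.ofReal (b - a)) := by gcongr
        _ = ENNReal.ofReal (b - a) := by rw [← mul_assoc, ENNReal.inv_mul_cancel hK hK', one_mul]
    · have : s = ∅ := Set.subset_empty_iff.1 (hs'.trans (by simp [hab.le]))
      simp [this]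
  refine Measure.le_iff.2 fun s _ => ?_
  have h1 : K⁻¹ * ν s ≤ volume s := by
    rw [Real.volume_eq_stieltjes_id, StieltjesFunction.measure]
    exact key s
  calc ν s = K * (K⁻¹ * ν s) := by rw [← mul_assoc, ENNReal.mul_inv_cancel hK hK', one_mul]
    _ ≤ K * volume s := by gcongr

theorem VagueLimit.Icc_le {μ : ℕ → Measure ℝ} {ρ : Measure ℝ} [IsLocallyFiniteMeasure ρ]
    {C : ℝ} (hC : 0 ≤ C) (hμ : ∀ L, μ L ≤ ENNReal.ofReal C • (volume : Measure ℝ))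
    (h : VagueLimit μ ρ) {a b : ℝ} (hab : a ≤ b) :
    ρ (Set.Icc a b) ≤ ENNReal.ofReal C * ENNReal.ofReal (b - a) := by
  have main : ∀ δ : ℝ, 0 < δ → ρ (Set.Icc a b) ≤ ENNReal.ofReal (C * (b - a + 2 * δ)) := by
    intro δ hδ
    -- A trapezoid equal to 1 on `[a, b]` and vanishing outside its `δ`-neighbourhood; `δ → 0` at
    -- the end.
    let f : ℝ → ℝ := fun t => max 0 (1 - max 0 (max (a - t) (t - b)) / δ)
    have hf : Continuous f := by fun_prop
    have hf0 : ∀ t, 0 ≤ f t := fun t => le_max_left _ _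
    have hout : ∀ t, t ∉ Set.Icc (a - δ) (b + δ) → f t = 0 := by
      intro t ht
      refine max_eq_left (sub_nonpos.2 ((one_le_div hδ).2 (le_max_of_le_right ?_)))
      rw [Set.mem_Icc, not_and_or, not_le, not_le] at ht
      rcases ht with ht | ht
      · exact le_max_of_le_left (by linarith)
      · exact le_max_of_le_right (by linarith)
    have hin : ∀ t ∈ Set.Icc a b, f t = 1 := by
      intro t ht
      have : max 0 (max (a - t) (t - b)) = 0 :=
        max_eq_left (max_le (by linarith [ht.1]) (by linarith [ht.2]))
      simp [f, this]
    have hle : ∀ t, f t ≤ 1 := fun t =>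
      max_le zero_le_one (sub_le_self _ (div_nonneg (le_max_left _ _) hδ.le))
    have hcs : HasCompactSupport f :=
      HasCompactSupport.intro isCompact_Icc hout
    have hL : ∀ L, ∫ t, f t ∂(μ L) ≤ C * (b - a + 2 * δ) := by
      intro L
      rw [integral_eq_lintegral_of_nonneg_ae (ae_of_all _ hf0) hf.aestronglyMeasurable]
      refine ENNReal.toReal_le_of_le_ofReal (by positivity) ?_
      calc ∫⁻ t, ENNReal.ofReal (f t) ∂(μ L)
          ≤ ∫⁻ t, (Set.Icc (a - δ) (b + δ)).indicator 1 t ∂(μ L) := by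
            refine lintegral_mono fun t => ?_
            by_cases ht : t ∈ Set.Icc (a - δ) (b + δ)
            · simpa [ht] using hle t
            · simp [ht, hout t ht]
        _ = μ L (Set.Icc (a - δ) (b + δ)) := lintegral_indicator_one measurableSet_Icc
        _ ≤ (ENNReal.ofReal C • (volume : Measure ℝ)) (Set.Icc (a - δ) (b + δ)) := hμ L _
        _ = ENNReal.ofReal (C * (b - a + 2 * δ)) := by
            rw [Measure.smul_apply, Real.volume_Icc, smul_eq_mul, ← ENNReal.ofReal_mul hC]
            congr 2
            ring
    have hlim := le_of_tendsto' (h f hf hcs) hL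
    calc ρ (Set.Icc a b) = ∫⁻ t, (Set.Icc a b).indicator 1 t ∂ρ :=
          (lintegral_indicator_one measurableSet_Icc).symm
      _ ≤ ∫⁻ t, ENNReal.ofReal (f t) ∂ρ := by
          refine lintegral_mono fun t => ?_
          by_cases ht : t ∈ Set.Icc a b
          · simp [ht, hin t ht]
          · simp [ht]
      _ = ENNReal.ofReal (∫ t, f t ∂ρ) :=
          (ofReal_integral_eq_lintegral_ofReal (hf.integrable_of_hasCompactSupport hcs)
            (ae_of_all _ hf0)).symm
      _ ≤ _ := ENNReal.ofReal_le_ofReal hlim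
  have hlim : Tendsto (fun δ : ℝ => ENNReal.ofReal (C * (b - a + 2 * δ))) (𝓝[>] 0)
      (𝓝 (ENNReal.ofReal (C * (b - a)))) := by
    have : Continuous fun δ : ℝ => ENNReal.ofReal (C * (b - a + 2 * δ)) :=
      ENNReal.continuous_ofReal.comp (by fun_prop)
    simpa using (this.tendsto 0).mono_left nhdsWithin_le_nhds
  rw [← ENNReal.ofReal_mul hC]
  exact ge_of_tendsto hlim (eventually_nhdsWithin_of_forall fun δ hδ => main δ hδ)

theorem exists_density_of_le_smul_volume {ρ : Measure ℝ} {C : ℝ} (hC : 0 ≤ C)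
    (h : ρ ≤ ENNReal.ofReal C • (volume : Measure ℝ)) :
    ∃ p : ℝ → ℝ, Measurable p ∧ (∀ t, 0 ≤ p t ∧ p t ≤ C) ∧
      ρ = volume.withDensity fun t => ENNReal.ofReal (p t) := by
  have hac : ρ ≪ volume := Measure.absolutelyContinuous_of_le_smul h
  have hlf : IsLocallyFiniteMeasure ρ := ⟨fun x => by
    refine ⟨Set.Icc (x - 1) (x + 1), Icc_mem_nhds (by linarith) (by linarith),
      (h _).trans_lt ?_⟩
    rw [Measure.smul_apply, Real.volume_Icc, smul_eq_mul]
    exact ENNReal.mul_lt_top ENNReal.ofReal_lt_top ENNReal.ofReal_lt_top⟩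
  have hm := Measure.measurable_rnDeriv ρ volume
  have hbound : ∀ᵐ t, ρ.rnDeriv volume t ≤ ENNReal.ofReal C := by
    refine ae_le_of_forall_setLIntegral_le_of_sigmaFinite hm fun s _ _ => ?_
    rw [setLIntegral_const]
    exact (Measure.setLIntegral_rnDeriv_le s).trans (h s)
  -- The derivative is bounded only almost everywhere; truncating it makes the bound hold at every
  -- point without changing the measure.
  refine ⟨fun t => (min (ρ.rnDeriv volume t) (ENNReal.ofReal C)).toReal,
    (hm.min measurable_const).ennreal_toReal, fun t => ⟨ENNReal.toReal_nonneg, ?_⟩, ?_⟩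
  · exact ENNReal.toReal_le_of_le_ofReal hC (min_le_right _ _)
  · conv_lhs => rw [← Measure.withDensity_rnDeriv_eq ρ volume hac]
    refine withDensity_congr_ae ?_
    filter_upwards [hbound] with t ht
    rw [min_eq_left ht, ENNReal.ofReal_toReal (ht.trans_lt ENNReal.ofReal_lt_top).ne]

/-! ### Measurable dependence of the eigenvalues -/

section MatrixEigenvalues

variable {n : Type*} [Fintype n] [DecidableEq n]

theorem eigenvalues_toLin' {A : Matrix n n ℂ} (hA : A.IsHermitian) :
    eigenvalues (Matrix.toLin' A) = Finset.univ.val.map hA.eigenvalues := by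
  rw [eigenvalues, Matrix.charpoly_toLin', hA.roots_charpoly_eq_eigenvalues, Multiset.map_map]
  rfl

theorem eigenvalueCount_toLin' {A : Matrix n n ℂ} (hA : A.IsHermitian) (I : Set ℝ) :
    (eigenvalueCount (Matrix.toLin' A) I : ℝ)
      = ∑ i, I.indicator (fun _ => (1 : ℝ)) (hA.eigenvalues i) := by
  classical
  rw [eigenvalueCount, eigenvalues_toLin' hA, Multiset.countP_map]
  simp only [Set.indicator_apply]
  rw [Finset.sum_boole]
  rfl

theorem eigenvalueCount_Icc_toLin' {A : Matrix n n ℂ} (hA : A.IsHermitian) (a b : ℝ) :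
    eigenvalueCount (Matrix.toLin' A) (Set.Icc a b) = countIcc hA a b := by
  classical
  rw [eigenvalueCount, eigenvalues_toLin' hA, Multiset.countP_map, countIcc, Finset.card_def,
    Finset.filter_val]
  congr

/-- Continuous ramps converge pointwise to the indicator, and Weierstrass approximates the ramp of
index `m` within `1 / (m + 1)` on `[-m, m]`. -/
theorem exists_polynomial_tendsto_indicator_Ioi (a : ℝ) :
    ∃ p : ℕ → Polynomial ℝ, ∀ t, Tendsto (fun m => (p m).eval t) atTop
      (𝓝 ((Set.Ioi a).indicator (fun _ => (1 : ℝ)) t)) := by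
  let f : ℕ → ℝ → ℝ := fun m t => max 0 (min 1 (m * (t - a)))
  have hf : ∀ m, Continuous (f m) := fun m => by fun_prop
  have hp : ∀ m : ℕ, ∃ p : Polynomial ℝ, ∀ t ∈ Set.Icc (-(m : ℝ)) m,
      |p.eval t - f m t| < 1 / ((m : ℝ) + 1) := fun m =>
    exists_polynomial_near_of_continuousOn _ _ _ (hf m).continuousOn _ (by positivity)
  choose p hp using hp
  refine ⟨p, fun t => ?_⟩
  have h1 : Tendsto (fun m => (p m).eval t - f m t) atTop (𝓝 0) := by
    refine squeeze_zero_norm' ?_ (tendsto_one_div_add_atTop_nhds_zero_nat (𝕜 := ℝ))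
    filter_upwards [eventually_ge_atTop ⌈|t|⌉₊] with m hm
    exact (hp m t (abs_le.1 ((Nat.le_ceil _).trans (Nat.cast_le.2 hm)))).le
  have h2 : Tendsto (fun m => f m t) atTop
      (𝓝 ((Set.Ioi a).indicator (fun _ => (1 : ℝ)) t)) := by
    refine tendsto_const_nhds.congr' ?_
    rcases le_or_gt t a with ht | ht
    · refine Eventually.of_forall fun m => ?_
      have : (m : ℝ) * (t - a) ≤ 0 := mul_nonpos_of_nonneg_of_nonpos m.cast_nonneg (by linarith)
      rw [Set.indicator_of_notMem (by simpa using ht)]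
      exact (max_eq_left ((min_le_right _ _).trans this)).symm
    · filter_upwards [eventually_ge_atTop ⌈1 / (t - a)⌉₊] with m hm
      have h3 : 1 / (t - a) ≤ m := (Nat.le_ceil _).trans (Nat.cast_le.2 hm)
      have h4 : 1 ≤ (m : ℝ) * (t - a) := (div_le_iff₀ (by linarith)).1 h3
      rw [Set.indicator_of_mem (by simpa using ht)]
      change 1 = max 0 (min 1 ((m : ℝ) * (t - a)))
      rw [min_eq_left h4, max_eq_right zero_le_one]
  simpa using h1.add h2

/-- No measurable choice of eigenvalues is needed. Power sums of eigenvalues are traces of powers,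
hence measurable; polynomial limits give the counts in half-lines, which form a generating π-system.
-/
theorem measurable_eigenvalueMeasure {T : Type*} [MeasurableSpace T] {A : T → Matrix n n ℂ}
    (hm : ∀ i j, Measurable fun t => A t i j) (hA : ∀ t, (A t).IsHermitian) :
    Measurable fun t => eigenvalueMeasure (Matrix.toLin' (A t)) := by
  have hpow : ∀ k, Measurable fun t => ∑ i, (hA t).eigenvalues i ^ k := fun k => by
    refine (congrArg Measurable ?_).mp (Complex.measurable_re.comp (measurable_trace_pow hm k))
    funext t
    simp only [Function.comp, trace_pow_eq_sum (hA t), Complex.re_sum, ← Complex.ofReal_pow,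
      Complex.ofReal_re]
  have hpoly : ∀ p : Polynomial ℝ, Measurable fun t => ∑ i, p.eval ((hA t).eigenvalues i) := by
    intro p
    simp only [Polynomial.eval_eq_sum_range]
    have : ∀ t, ∑ i, ∑ k ∈ Finset.range (p.natDegree + 1),
        p.coeff k * (hA t).eigenvalues i ^ k = ∑ k ∈ Finset.range (p.natDegree + 1),
        p.coeff k * ∑ i, (hA t).eigenvalues i ^ k := fun t => by
      rw [Finset.sum_comm]
      simp only [Finset.mul_sum]
    simp only [this]
    exact Finset.measurable_sum _ fun k _ => (hpow k).const_mul _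
  have hIoi : ∀ a, Measurable fun t => eigenvalueMeasure (Matrix.toLin' (A t)) (Set.Ioi a) := by
    intro a
    obtain ⟨p, hp⟩ := exists_polynomial_tendsto_indicator_Ioi a
    have h1 : Measurable fun t => ∑ i,
        (Set.Ioi a).indicator (fun _ => (1 : ℝ)) ((hA t).eigenvalues i) :=
      measurable_of_tendsto_metrizable (fun m => hpoly (p m)) (tendsto_pi_nhds.2 fun t =>
        tendsto_finsetSum _ fun i _ => hp ((hA t).eigenvalues i))
    refine (congrArg Measurable ?_).mp h1.ennreal_ofReal
    funext t
    rw [eigenvalueMeasure_apply _ measurableSet_Ioi, ← eigenvalueCount_toLin' (hA t),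
      ENNReal.ofReal_natCast]
  have huniv : ∀ t, eigenvalueMeasure (Matrix.toLin' (A t)) Set.univ = Fintype.card n := by
    intro t
    rw [eigenvalueMeasure_apply _ MeasurableSet.univ]
    have := eigenvalueCount_toLin' (hA t) Set.univ
    simp only [Set.indicator_univ, Finset.sum_const, Finset.card_univ, nsmul_eq_mul,
      mul_one] at this
    exact_mod_cast this
  have hfin : ∀ t, IsFiniteMeasure (eigenvalueMeasure (Matrix.toLin' (A t))) := fun t =>
    ⟨by rw [huniv]; exact ENNReal.natCast_lt_top _⟩
  refine Measurable.measure_of_isPiSystem (S := Set.range Set.Ioi) ?_ isPiSystem_Ioi ?_ ?_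
  · rw [← borel_eq_generateFrom_Ioi]
    exact BorelSpace.measurable_eq
  · rintro _ ⟨a, rfl⟩
    exact hIoi a
  · simp only [huniv]
    exact measurable_const

end MatrixEigenvalues

/-! ### Finite-volume operators as block matrices -/

section FiniteVolume

variable {d : ℕ} {Ω : Type*} [MeasurableSpace Ω]

/-- The operator with potential `V` and hopping terms `W` on a finite set of sites, as a matrix. -/
def blockMatrix (Λ : Finset (Site d)) (V : Λ → Matrix (Fin N) (Fin N) ℂ)
    (W : Λ → Λ → Matrix (Fin N) (Fin N) ℂ) : Matrix (Λ × Fin N) (Λ × Fin N) ℂ :=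
  open Classical in
  Matrix.of fun p q => (if p.1 = q.1 then V p.1 p.2 q.2 else 0)
    + if Adj (p.1 : Site d) q.1 then W p.1 q.1 p.2 q.2 else 0

theorem Adj.symm {x y : Site d} (h : Adj x y) : Adj y x := by
  unfold Adj at h ⊢
  rw [← h]
  exact Finset.sum_congr rfl fun i _ => abs_sub_comm _ _

theorem isHermitian_blockMatrix {Λ : Finset (Site d)} {V : Λ → Matrix (Fin N) (Fin N) ℂ}
    {W : Λ → Λ → Matrix (Fin N) (Fin N) ℂ} (hV : ∀ x, (V x).IsHermitian)
    (hW : ∀ x y : Λ, Adj (x : Site d) y → W y x = (W x y).conjTranspose) :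
    (blockMatrix Λ V W).IsHermitian := by
  ext p q
  simp only [Matrix.conjTranspose_apply, blockMatrix, Matrix.of_apply, star_add]
  congr 1
  · by_cases h : p.1 = q.1
    · rw [if_pos h, if_pos h.symm, h]
      exact (hV q.1).apply _ _
    · rw [if_neg h, if_neg (Ne.symm h), star_zero]
  · by_cases h : Adj (p.1 : Site d) q.1
    · rw [if_pos h, if_pos h.symm, hW _ _ h, Matrix.conjTranspose_apply, star_star]
    · rw [if_neg h, if_neg fun h' => h h'.symm, star_zero]

theorem blockMatrix_add (Λ : Finset (Site d)) (V V' : Λ → Matrix (Fin N) (Fin N) ℂ)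
    (W : Λ → Λ → Matrix (Fin N) (Fin N) ℂ) :
    blockMatrix Λ (fun x => V x + V' x) W = blockMatrix Λ V W + blockMatrix Λ V' 0 := by
  ext p q
  simp only [blockMatrix, Matrix.of_apply, Matrix.add_apply, Pi.zero_apply, Matrix.zero_apply,
    ite_self, add_zero]
  by_cases h : p.1 = q.1
  · simp only [h, if_pos]
    ring
  · simp [h]

theorem blockMatrix_symPart (Λ : Finset (Site d)) (σ : ℝ) (g : Λ × Fin N × Fin N → ℝ) :
    blockMatrix Λ (fun x => (σ : ℂ) • symPart fun p => g (x, p)) 0 = (σ : ℂ) • symBlocks g := by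
  ext p q
  simp only [blockMatrix, Matrix.of_apply, Pi.zero_apply, Matrix.zero_apply, ite_self, add_zero,
    Matrix.smul_apply, symPart, symBlocks, smul_eq_mul, mul_ite, mul_zero]

/-- Currying intertwines the two operators, and the characteristic polynomial is invariant under
conjugation. Neighbours outside `Λ` see the extension by zero. -/
theorem eigenvalues_finiteVolume (H : OrbitalModel d N Ω) (Λ : Finset (Site d)) (ω : Ω) :
    eigenvalues (H.finiteVolume Λ ω)
      = eigenvalues (Matrix.toLin' (blockMatrix Λ (fun x => H.V x ω) fun x y => H.W x y ω)) := by
  classical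
  have h : (LinearEquiv.curry ℂ ℂ Λ (Fin N)).symm.conj (H.finiteVolume Λ ω)
      = Matrix.toLin' (blockMatrix Λ (fun x => H.V x ω) fun x y => H.W x y ω) := by
    refine LinearMap.ext fun ψ => funext fun p => ?_
    obtain ⟨x, i⟩ := p
    rw [LinearEquiv.conj_apply_apply, Matrix.toLin'_apply]
    change (H.finiteVolume Λ ω (Function.curry ψ)) x i = _
    simp only [OrbitalModel.finiteVolume, LinearMap.comp_apply, restrict,
      OrbitalModel.hamiltonian, extend, LinearMap.coe_mk, AddHom.coe_mk, Pi.add_apply,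
      Finset.sum_apply, Matrix.mulVec, dotProduct, blockMatrix, Matrix.of_apply, add_mul,
      Finset.sum_add_distrib, Fintype.sum_prod_type]
    congr 1
    · rw [Finset.sum_eq_single x]
      · simp [Function.curry]
      · intro y _ hy
        simp [hy.symm]
      · simp
    · rw [← Finset.sum_filter_add_sum_filter_not (neighbors (x : Site d)) (· ∈ Λ)]
      rw [Finset.sum_eq_zero (s := (neighbors (x : Site d)).filter fun y => ¬ y ∈ Λ)
        fun y hy => by simp [(Finset.mem_filter.1 hy).2], add_zero]
      have e : (neighbors (x : Site d)).filter (· ∈ Λ) = Λ.filter (Adj (x : Site d)) := by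
        ext y
        simp [mem_neighbors, and_comm]
      rw [e, Finset.sum_filter, ← Finset.sum_coe_sort Λ]
      refine Finset.sum_congr rfl fun y _ => ?_
      by_cases h : Adj (x : Site d) y
      · simp [h, Function.curry]
      · simp [h]
  rw [← h, eigenvalues, eigenvalues, LinearEquiv.charpoly_conj]

theorem isHermitian_blockMatrix_model (H : OrbitalModel d N Ω) (Λ : Finset (Site d)) (ω : Ω) :
    (blockMatrix Λ (fun x => H.V x ω) fun x y => H.W x y ω).IsHermitian :=
  isHermitian_blockMatrix (fun x => H.hermitian_V x ω) fun x y h => H.hermitian_W x y h ω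

theorem measurable_matrix_apply (i j : Fin N) :
    Measurable fun V : Matrix (Fin N) (Fin N) ℂ => V i j :=
  (measurable_pi_apply j).comp (measurable_pi_apply i)

theorem measurable_eigenvalueMeasure_finiteVolume (H : OrbitalModel d N Ω)
    (Λ : Finset (Site d)) : Measurable fun ω => eigenvalueMeasure (H.finiteVolume Λ ω) := by
  classical
  have := measurable_eigenvalueMeasure
    (A := fun ω => blockMatrix Λ (fun x => H.V x ω) fun x y => H.W x y ω) (fun p q => ?_)
    (isHermitian_blockMatrix_model H Λ)
  · simpa only [eigenvalueMeasure, eigenvalues_finiteVolume] using this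
  · simp only [blockMatrix, Matrix.of_apply]
    refine Measurable.add ?_ ?_
    · split_ifs
      · exact (measurable_matrix_apply _ _).comp (H.measurable_V _)
      · exact measurable_const
    · split_ifs with h
      · exact (measurable_matrix_apply _ _).comp (H.measurable_W _ _ h)
      · exact measurable_const

theorem meanEigenvalueMeasure_apply (P : Measure Ω) (H : OrbitalModel d N Ω)
    (Λ : Finset (Site d)) {I : Set ℝ} (hI : MeasurableSet I) :
    meanEigenvalueMeasure P H Λ I
      = ∫⁻ ω, (eigenvalueCount (H.finiteVolume Λ ω) I : ℝ≥0∞) ∂P := by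
  rw [meanEigenvalueMeasure, Measure.bind_apply hI
    (measurable_eigenvalueMeasure_finiteVolume H Λ).aemeasurable]
  simp only [eigenvalueMeasure_apply _ hI]

theorem measurable_eigenvalueCount_finiteVolume (H : OrbitalModel d N Ω) (Λ : Finset (Site d))
    {I : Set ℝ} (hI : MeasurableSet I) :
    Measurable fun ω => eigenvalueCount (H.finiteVolume Λ ω) I := by
  have h := (Measure.measurable_coe hI).comp (measurable_eigenvalueMeasure_finiteVolume H Λ)
  refine measurable_to_countable' fun k => ?_
  have := h (measurableSet_singleton (k : ℝ≥0∞))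
  convert this using 1
  ext ω
  simp [eigenvalueMeasure_apply _ hI]

end FiniteVolume

/-! ### Product laws and orientation of the edges -/

theorem measurePreserving_uncurry_gaussianPi (I J : Type*) [Fintype I] [Fintype J] :
    MeasurePreserving (fun (g : I → J → ℝ) (p : I × J) => g p.1 p.2)
      (Measure.pi fun _ : I => gaussianPi J) (gaussianPi (I × J)) := by
  have hm : Measurable fun (g : I → J → ℝ) (p : I × J) => g p.1 p.2 := by fun_prop
  refine ⟨hm, (Measure.pi_eq fun s hs => ?_).symm⟩
  rw [Measure.map_apply hm (MeasurableSet.univ_pi hs)]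
  have : (fun (g : I → J → ℝ) (p : I × J) => g p.1 p.2) ⁻¹' Set.univ.pi s
      = Set.univ.pi fun i => Set.univ.pi fun j => s (i, j) := by
    ext g
    simp [Set.mem_pi]
  rw [this, Measure.pi_pi, Fintype.prod_prod_type]
  refine Finset.prod_congr rfl fun i _ => ?_
  rw [gaussianPi, Measure.pi_pi]

variable {d : ℕ}

theorem HasGaussianPart.measurePreserving_pi {μ : Measure (Matrix (Fin N) (Fin N) ℂ)} {σ : ℝ}
    [SigmaFinite μ] {S : (Upper N → ℝ) → Matrix (Fin N) (Fin N) ℂ}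
    (h : MeasurePreserving (fun p : (Upper N → ℝ) × (Fin N × Fin N → ℝ) =>
      S p.1 + (σ : ℂ) • symPart p.2)
      ((gaussianPi (Upper N)).prod (gaussianPi (Fin N × Fin N))) μ) (X : Type*) [Fintype X] :
    MeasurePreserving (fun (p : (X → Upper N → ℝ) × (X × Fin N × Fin N → ℝ)) x =>
      S (p.1 x) + (σ : ℂ) • symPart fun q => p.2 (x, q))
      ((Measure.pi fun _ : X => gaussianPi (Upper N)).prod (gaussianPi (X × Fin N × Fin N)))
      (Measure.pi fun _ : X => μ) := by
  have h1 := MeasureTheory.measurePreserving_pi (ι := X) _ (fun _ => μ) fun _ => h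
  have h2 := (measurePreserving_arrowProdEquivProdArrow (Upper N → ℝ) (Fin N × Fin N → ℝ) X
    (fun _ => gaussianPi (Upper N)) (fun _ => gaussianPi (Fin N × Fin N))).symm
  have e : MeasurePreserving (MeasurableEquiv.curry X (Fin N × Fin N) ℝ)
      (gaussianPi (X × Fin N × Fin N)) (Measure.pi fun _ : X => gaussianPi (Fin N × Fin N)) :=
    MeasurePreserving.symm (MeasurableEquiv.curry X (Fin N × Fin N) ℝ).symm
      (measurePreserving_uncurry_gaussianPi X (Fin N × Fin N))
  exact (h1.comp h2).comp ((MeasurePreserving.id _).prod e)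

/-- Each `|a - b| + a + b` is even, so the two coordinate sums add up to an odd number. -/
theorem Adj.even_sum_iff {x y : Site d} (h : Adj x y) :
    Even (∑ i, y i) ↔ ¬ Even (∑ i, x i) := by
  have h1 : Even (∑ i, (|x i - y i| + (x i + y i))) := by
    refine Finset.even_sum _ fun i _ => ?_
    rcases abs_choice (x i - y i) with e | e <;> rw [e]
    · exact ⟨x i, by ring⟩
    · exact ⟨y i, by ring⟩
  rw [Finset.sum_add_distrib, h, Finset.sum_add_distrib] at h1
  have h2 : ¬ Even (1 : ℤ) := by decide
  rw [Int.even_add, Int.even_add] at h1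
  tauto

/-- The orientation of the edges of `ℤ^d` starting at the even sites. -/
abbrev EvenEdge (d : ℕ) : Type := {e : Site d × Site d // Even (∑ i, e.1 i) ∧ Adj e.1 e.2}

/-- The hopping terms determined by their values on the edges starting at even sites. -/
def hoppingOf (W : EvenEdge d → Matrix (Fin N) (Fin N) ℂ) (x y : Site d) :
    Matrix (Fin N) (Fin N) ℂ :=
  open Classical in
  if h : Adj x y then
    if he : Even (∑ i, x i) then W ⟨(x, y), he, h⟩
    else (W ⟨(y, x), h.even_sum_iff.2 he, h.symm⟩).conjTranspose
  else 0

theorem hoppingOf_symm (W : EvenEdge d → Matrix (Fin N) (Fin N) ℂ) {x y : Site d}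
    (h : Adj x y) : hoppingOf W y x = (hoppingOf W x y).conjTranspose := by
  by_cases he : Even (∑ i, x i)
  · have := h.symm.even_sum_iff.1 he
    simp only [hoppingOf, h, h.symm, he, this, dif_pos, dif_neg, not_false_iff]
  · have := h.even_sum_iff.2 he
    simp only [hoppingOf, h, h.symm, he, this, dif_pos, dif_neg, not_false_iff,
      Matrix.conjTranspose_conjTranspose]

theorem OrbitalModel.hoppingOf_eq {Ω : Type*} [MeasurableSpace Ω] (H : OrbitalModel d N Ω) (ω : Ω)
    {x y : Site d} (h : Adj x y) :
    hoppingOf (fun e : EvenEdge d => H.W e.1.1 e.1.2 ω) x y = H.W x y ω := by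
  by_cases he : Even (∑ i, x i)
  · simp only [hoppingOf, h, he, dif_pos]
  · simp only [hoppingOf, h, he, dif_pos, dif_neg, not_false_iff]
    exact (H.hermitian_W y x h.symm ω).symm

theorem measurable_conjTranspose :
    Measurable fun V : Matrix (Fin N) (Fin N) ℂ => V.conjTranspose :=
  measurable_pi_lambda _ fun i => measurable_pi_lambda _ fun j =>
    continuous_star.measurable.comp (measurable_matrix_apply j i)

theorem measurable_hoppingOf (x y : Site d) :
    Measurable fun W : EvenEdge d → Matrix (Fin N) (Fin N) ℂ => hoppingOf W x y := by
  unfold hoppingOf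
  split_ifs
  · exact measurable_pi_apply _
  · exact measurable_conjTranspose.comp (measurable_pi_apply _)
  · exact measurable_const

theorem blockMatrix_congr {Λ : Finset (Site d)} (V : Λ → Matrix (Fin N) (Fin N) ℂ)
    {W W' : Λ → Λ → Matrix (Fin N) (Fin N) ℂ}
    (h : ∀ x y : Λ, Adj (x : Site d) y → W x y = W' x y) :
    blockMatrix Λ V W = blockMatrix Λ V W' := by
  ext p q
  simp only [blockMatrix, Matrix.of_apply]
  by_cases hpq : Adj (p.1 : Site d) q.1
  · rw [h _ _ hpq]
  · simp [hpq]

/-- The Hermitian part of a matrix. -/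
def hermPart (V : Matrix (Fin N) (Fin N) ℂ) : Matrix (Fin N) (Fin N) ℂ :=
  (2⁻¹ : ℂ) • (V + V.conjTranspose)

theorem isHermitian_hermPart (V : Matrix (Fin N) (Fin N) ℂ) : (hermPart V).IsHermitian := by
  ext i j
  simp [hermPart, add_comm, mul_add]

theorem hermPart_of_isHermitian {V : Matrix (Fin N) (Fin N) ℂ} (hV : V.IsHermitian) :
    hermPart V = V := by
  rw [hermPart, hV.eq, ← two_smul ℂ V, smul_smul, inv_mul_cancel₀ two_ne_zero, one_smul]

theorem measurable_hermPart_apply (i j : Fin N) :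
    Measurable fun V : Matrix (Fin N) (Fin N) ℂ => hermPart V i j := by
  simp only [hermPart, Matrix.smul_apply, Matrix.add_apply]
  exact Measurable.const_smul ((measurable_matrix_apply i j).add
    ((measurable_matrix_apply i j).comp measurable_conjTranspose)) (2⁻¹ : ℂ)

theorem isHermitian_symPart (g : Fin N × Fin N → ℝ) : (symPart g).IsHermitian := by
  ext i j
  simp [symPart, add_comm]

/-- The even-oriented edges inside `Λ`, as indices of the random hopping terms. -/
def edgesIn (Λ : Finset (Site d)) : Finset (EvenEdge d) :=
  (Λ ×ˢ Λ).preimage Subtype.val Subtype.val_injective.injOn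

/-! ### Conditioning on the hopping terms -/

section Independence

variable {Ω : Type*} [MeasurableSpace Ω] {P : Measure Ω} [IsProbabilityMeasure P]

theorem OrbitalModel.IsIndependent.map_eq {H : OrbitalModel d N Ω} (hind : H.IsIndependent P)
    {μ : Measure (Matrix (Fin N) (Fin N) ℂ)} (hV : ∀ x, P.map (H.V x) = μ)
    (Λ : Finset (Site d)) (T : Finset (EvenEdge d)) :
    P.map (fun ω => ((fun x : Λ => H.V x ω), fun e : T => H.W e.1.1.1 e.1.1.2 ω))
      = (Measure.pi fun _ : Λ => μ).prod (P.map fun ω (e : T) => H.W e.1.1.1 e.1.1.2 ω) := by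
  classical
  have hmeas : ∀ s : Site d ⊕ EvenEdge d, Measurable (Sum.elim H.V
      (fun e : EvenEdge d => H.W e.1.1 e.1.2) s) := by
    rintro (x | e)
    · exact H.measurable_V x
    · exact H.measurable_W _ _ e.2.2
  have h1 := hind.indepFun_finset (Λ.map Function.Embedding.inl) (T.map Function.Embedding.inr)
    (by simp [Finset.disjoint_left]) hmeas
  have h2 := h1.comp
    (φ := fun (f : ↥(Λ.map (Function.Embedding.inl (β := EvenEdge d))) →
      Matrix (Fin N) (Fin N) ℂ) (x : Λ) => f ⟨.inl x.1, by simp⟩)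
    (ψ := fun (f : ↥(T.map (Function.Embedding.inr (α := Site d))) →
      Matrix (Fin N) (Fin N) ℂ) (e : T) => f ⟨.inr e.1, by simp⟩) (by fun_prop) (by fun_prop)
  have h3 := h2.map_prod_eq_prod_map_map
    (measurable_pi_lambda (fun ω (x : Λ) => H.V x ω) fun x => H.measurable_V x.1).aemeasurable
    (measurable_pi_lambda (fun ω (e : T) => H.W e.1.1.1 e.1.1.2 ω)
      fun e => H.measurable_W _ _ e.1.2.2).aemeasurable
  have h4 : iIndepFun (fun x : Λ => H.V x) P :=
    iIndepFun.precomp (g := fun x : Λ => (Sum.inl x.1 : Site d ⊕ EvenEdge d))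
      (fun x y h => Subtype.ext (Sum.inl_injective h)) hind
  have h5 := iIndepFun.map_fun_eq_pi_map (f := fun x : Λ => H.V x) (fun x => (H.measurable_V x).aemeasurable) h4
  simp only [hV] at h5
  rw [← h5]
  exact h3

/-- Independence makes the law of the data in `Λ` a product, and each potential splits as `S` plus a
symmetrised Gaussian. With the hopping terms and the arguments of `S` fixed, only the Gaussian
blocks are random and `lintegral_countIcc_le` applies, with a bound that does not depend on the
frozen data. -/
theorem lintegral_eigenvalueCount_Icc_le [NeZero N] {H : OrbitalModel d N Ω}
    (hind : H.IsIndependent P) {μ : Measure (Matrix (Fin N) (Fin N) ℂ)} [IsProbabilityMeasure μ]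
    (hV : ∀ x, P.map (H.V x) = μ) {σ : ℝ} (hσ : 0 < σ) (hμ : HasGaussianPart μ σ)
    (Λ : Finset (Site d)) (a b : ℝ) :
    ∫⁻ ω, (eigenvalueCount (H.finiteVolume Λ ω) (Set.Icc a b) : ℝ≥0∞) ∂P
      ≤ Λ.card * wegnerConst (Fin N) σ * ENNReal.ofReal (b - a) := by
  classical
  obtain ⟨S, hSh, hS⟩ := hμ
  let T := edgesIn Λ
  -- Only edges inside `Λ` enter the finite-volume matrix, so the value 0 elsewhere is immaterial.
  let ext : (T → Matrix (Fin N) (Fin N) ℂ) → EvenEdge d → Matrix (Fin N) (Fin N) ℂ :=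
    fun w e => if h : e ∈ T then w ⟨e, h⟩ else 0
  have hext : Measurable ext := by
    refine measurable_pi_lambda _ fun e => ?_
    by_cases h : e ∈ T
    · simp only [ext, h, dif_pos]
      exact measurable_pi_apply _
    · simp only [ext, h, dif_neg, not_false_iff]
      exact measurable_const
  -- `hermPart` makes `A` Hermitian for every argument, so that its eigenvalues are defined on the
  -- whole product space; it changes nothing on the actual values of the potential.
  let A : (Λ → Matrix (Fin N) (Fin N) ℂ) × (T → Matrix (Fin N) (Fin N) ℂ) →
      Matrix (Λ × Fin N) (Λ × Fin N) ℂ := fun p =>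
    blockMatrix Λ (fun x => hermPart (p.1 x)) fun x y => hoppingOf (ext p.2) x y
  have hA : ∀ p, (A p).IsHermitian := fun p =>
    isHermitian_blockMatrix (fun x => isHermitian_hermPart _) fun x y h => hoppingOf_symm _ h
  have hAm : ∀ i j, Measurable fun p => A p i j := by
    intro i j
    simp only [A, blockMatrix, Matrix.of_apply]
    refine Measurable.add ?_ ?_
    · split_ifs
      · exact (measurable_hermPart_apply _ _).comp ((measurable_pi_apply _).comp measurable_fst)
      · exact measurable_const
    · split_ifs
      · exact (measurable_matrix_apply _ _).comp
          ((measurable_hoppingOf _ _).comp (hext.comp measurable_snd))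
      · exact measurable_const
  let F : (Λ → Matrix (Fin N) (Fin N) ℂ) × (T → Matrix (Fin N) (Fin N) ℂ) → ℝ≥0∞ := fun p =>
    eigenvalueMeasure (Matrix.toLin' (A p)) (Set.Icc a b)
  have hF : Measurable F :=
    (Measure.measurable_coe measurableSet_Icc).comp (measurable_eigenvalueMeasure hAm hA)
  let Z : Ω → (Λ → Matrix (Fin N) (Fin N) ℂ) × (T → Matrix (Fin N) (Fin N) ℂ) := fun ω =>
    ((fun x => H.V x ω), fun e => H.W e.1.1.1 e.1.1.2 ω)
  have hW : Measurable fun ω (e : T) => H.W e.1.1.1 e.1.1.2 ω :=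
    measurable_pi_lambda _ fun e => H.measurable_W _ _ e.1.2.2
  have hVm : Measurable fun ω (x : Λ) => H.V x ω :=
    measurable_pi_lambda _ fun x => H.measurable_V x.1
  have hZ : Measurable Z := hVm.prodMk hW
  have hFZ : ∀ ω, (eigenvalueCount (H.finiteVolume Λ ω) (Set.Icc a b) : ℝ≥0∞) = F (Z ω) := by
    intro ω
    have e : A (Z ω) = blockMatrix Λ (fun x => H.V x ω) fun x y => H.W x y ω := by
      simp only [A, Z, hermPart_of_isHermitian (H.hermitian_V _ ω)]
      refine blockMatrix_congr _ fun x y h => ?_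
      rw [← H.hoppingOf_eq ω h]
      by_cases he : Even (∑ i, (x : Site d) i)
      · have hT : (⟨((x : Site d), (y : Site d)), he, h⟩ : EvenEdge d) ∈ T := by
          simp [T, edgesIn]
        simp only [hoppingOf, h, he, dif_pos, ext, hT]
      · have hT : (⟨((y : Site d), (x : Site d)), h.even_sum_iff.2 he, h.symm⟩ : EvenEdge d)
            ∈ T := by
          simp [T, edgesIn]
        simp only [hoppingOf, h, he, dif_pos, dif_neg, not_false_iff, ext, hT]
    simp only [F, e]
    rw [eigenvalueMeasure_apply _ measurableSet_Icc, eigenvalueCount, eigenvalueCount,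
      eigenvalues_finiteVolume]
  let τ : Measure (T → Matrix (Fin N) (Fin N) ℂ) := P.map fun ω (e : T) => H.W e.1.1.1 e.1.1.2 ω
  have hτ : IsProbabilityMeasure τ := Measure.isProbabilityMeasure_map hW.aemeasurable
  have hΦ := HasGaussianPart.measurePreserving_pi hS Λ
  have hΨ := hΦ.prod (MeasurePreserving.id τ)
  have hFΨ : Measurable fun p => F (Prod.map (fun (p : (Λ → Upper N → ℝ) ×
      (Λ × Fin N × Fin N → ℝ)) x => S (p.1 x) + (σ : ℂ) • symPart fun q => p.2 (x, q)) id p) :=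
    hF.comp hΨ.measurable
  simp only [hFZ]
  rw [← lintegral_map hF hZ, hind.map_eq hV Λ T, ← hΨ.map_eq, lintegral_map hF hΨ.measurable,
    lintegral_prod_symm _ hFΨ.aemeasurable]
  have hinner : ∀ w : T → Matrix (Fin N) (Fin N) ℂ, ∀ h : Λ → Upper N → ℝ,
      ∫⁻ g, F (Prod.map (fun (p : (Λ → Upper N → ℝ) × (Λ × Fin N × Fin N → ℝ)) x =>
        S (p.1 x) + (σ : ℂ) • symPart fun q => p.2 (x, q)) id ((h, g), w))
        ∂(gaussianPi (Λ × Fin N × Fin N))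
      ≤ Λ.card * wegnerConst (Fin N) σ * ENNReal.ofReal (b - a) := by
    intro w h
    have hK : (blockMatrix Λ (fun x => S (h x)) fun x y => hoppingOf (ext w) x y).IsHermitian :=
      isHermitian_blockMatrix (fun x => hSh _) fun x y hxy => hoppingOf_symm _ hxy
    have key := lintegral_countIcc_le hK hσ a b
    rw [Fintype.card_coe] at key
    refine (le_of_eq (lintegral_congr fun g => ?_)).trans key
    rw [← eigenvalueCount_Icc_toLin', ← eigenvalueMeasure_apply _ measurableSet_Icc]
    have hH : ∀ x, (S (h x) + (σ : ℂ) • symPart fun q => g (x, q)).IsHermitian := fun x => by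
      refine (hSh _).add ?_
      rw [Matrix.IsHermitian, Matrix.conjTranspose_smul, (isHermitian_symPart _).eq]
      simp
    simp only [F, A, Prod.map, id, hermPart_of_isHermitian (hH _)]
    rw [blockMatrix_add, blockMatrix_symPart]
  calc _ ≤ ∫⁻ _, (Λ.card * wegnerConst (Fin N) σ * ENNReal.ofReal (b - a)) ∂τ := by
        refine lintegral_mono fun w => ?_
        have hw : Measurable fun p : (Λ → Upper N → ℝ) × (Λ × Fin N × Fin N → ℝ) =>
            F (Prod.map (fun (p : (Λ → Upper N → ℝ) × (Λ × Fin N × Fin N → ℝ)) x =>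
              S (p.1 x) + (σ : ℂ) • symPart fun q => p.2 (x, q)) id (p, w)) :=
          hFΨ.comp (measurable_id.prodMk measurable_const)
        rw [lintegral_prod _ hw.aemeasurable]
        calc _ ≤ ∫⁻ _, (Λ.card * wegnerConst (Fin N) σ * ENNReal.ofReal (b - a))
              ∂(Measure.pi fun _ : Λ => gaussianPi (Upper N)) :=
              lintegral_mono fun h => hinner w h
          _ = _ := by rw [lintegral_const, measure_univ, mul_one]
    _ = _ := by rw [lintegral_const, measure_univ, mul_one]

end Independence

/-! ### Uniformity in `N` and the bounds for the model -/

/-- A bound on the density of states valid for every number of orbitals. -/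
def densityBound : ℝ := (wegnerConst Unit 2⁻¹).toReal + 1

theorem densityBound_pos : 0 < densityBound := by
  unfold densityBound
  positivity

/-- One factor `√N` comes from the variance of the entries and another from Khintchine averaging,
hence exactly `N`. What remains decreases in `τ`, so the GUE value `τ = 1 / 2` is the worst case;
the GOE has `τ = 1 / √2`. -/
theorem wegnerConst_le_densityBound {N : ℕ} (hN : 0 < N) {τ : ℝ} (hτ : 2⁻¹ ≤ τ) :
    wegnerConst (Fin N) (τ / √N) ≤ ENNReal.ofReal densityBound * N := by
  have hN' : (0 : ℝ) < N := Nat.cast_pos.2 hN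
  have h1 : wegnerConst (Fin N) (τ / √N) ≤ wegnerConst Unit 2⁻¹ * N := by
    have e : τ / √N * Real.exp (-1 / 2) / √(Fintype.card (Fin N))
        = τ * Real.exp (-1 / 2) / N := by
      have hs : √(N : ℝ) ≠ 0 := by positivity
      rw [Fintype.card_fin]
      nth_rw 3 [← Real.mul_self_sqrt hN'.le]
      field_simp
    have hN0 : (N : ℝ≥0∞) ≠ 0 := by exact_mod_cast hN.ne'
    unfold wegnerConst
    rw [e, ENNReal.ofReal_div_of_pos hN', ENNReal.ofReal_natCast]
    simp only [Fintype.card_unit, Nat.cast_one, Real.sqrt_one, div_one]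
    calc 2 / (ENNReal.ofReal (τ * Real.exp (-1 / 2)) / N * gaussianAbs)
        ≤ 2 / (ENNReal.ofReal (2⁻¹ * Real.exp (-1 / 2)) / N * gaussianAbs) := by gcongr
      _ = 2 / (ENNReal.ofReal (2⁻¹ * Real.exp (-1 / 2)) * gaussianAbs) * N := by
        generalize ENNReal.ofReal (2⁻¹ * Real.exp (-1 / 2)) = x
        simp only [div_eq_mul_inv]
        rw [mul_right_comm x, ENNReal.mul_inv (Or.inr (ENNReal.inv_ne_top.2 hN0))
          (Or.inr (by simp)), inv_inv, mul_assoc]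
  refine h1.trans ?_
  gcongr
  rw [← ENNReal.ofReal_toReal (wegnerConst_ne_top (ι := Unit) (σ := 2⁻¹) (by norm_num))]
  exact ENNReal.ofReal_le_ofReal (le_add_of_nonneg_right zero_le_one)

theorem HasGaussianPart.isProbabilityMeasure {N : ℕ} {μ : Measure (Matrix (Fin N) (Fin N) ℂ)}
    {σ : ℝ} (h : HasGaussianPart μ σ) : IsProbabilityMeasure μ := by
  obtain ⟨S, -, hS⟩ := h
  rw [← hS.map_eq]
  exact Measure.isProbabilityMeasure_map hS.measurable.aemeasurable

theorem inv_two_le_inv_sqrt_two : (2⁻¹ : ℝ) ≤ (√2)⁻¹ := by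
  have : √2 ≤ (2 : ℝ) := by
    rw [Real.sqrt_le_left (by norm_num)]
    norm_num
  exact inv_anti₀ (by positivity) this

section Model

variable {d : ℕ} {Ω : Type*} [MeasurableSpace Ω] {P : Measure Ω} [IsProbabilityMeasure P]

theorem meanEigenvalueMeasure_Icc_le (hN : 0 < N) {H : OrbitalModel d N Ω}
    (hind : H.IsIndependent P) (hH : H.IsOrthogonal P ∨ H.IsUnitary P)
    (Λ : Finset (Site d)) (a b : ℝ) :
    meanEigenvalueMeasure P H Λ (Set.Icc a b)
      ≤ ENNReal.ofReal densityBound * N * Λ.card * ENNReal.ofReal (b - a) := by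
  have : NeZero N := ⟨hN.ne'⟩
  have main : ∀ (μ : Measure (Matrix (Fin N) (Fin N) ℂ)) (τ : ℝ), 2⁻¹ ≤ τ →
      HasGaussianPart μ (τ / √N) → (∀ x, P.map (H.V x) = μ) →
      meanEigenvalueMeasure P H Λ (Set.Icc a b)
        ≤ ENNReal.ofReal densityBound * N * Λ.card * ENNReal.ofReal (b - a) := by
    intro μ τ hτ hμ hV
    have := hμ.isProbabilityMeasure
    have hτ0 : 0 < τ := lt_of_lt_of_le (by norm_num) hτ
    rw [meanEigenvalueMeasure_apply P H Λ measurableSet_Icc]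
    refine (lintegral_eigenvalueCount_Icc_le hind hV (by positivity) hμ Λ a b).trans ?_
    rw [mul_comm (Λ.card : ℝ≥0∞)]
    gcongr
    exact wegnerConst_le_densityBound hN hτ
  rcases hH with h | h
  · exact main _ _ inv_two_le_inv_sqrt_two (hasGaussianPart_GOE hN) h.1
  · exact main _ _ le_rfl (hasGaussianPart_GUE hN) h

theorem meanEigenvalueMeasure_le (hN : 0 < N) {H : OrbitalModel d N Ω}
    (hind : H.IsIndependent P) (hH : H.IsOrthogonal P ∨ H.IsUnitary P) (Λ : Finset (Site d)) :
    meanEigenvalueMeasure P H Λ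
      ≤ (ENNReal.ofReal densityBound * N * Λ.card) • (volume : Measure ℝ) := by
  refine le_smul_volume_of_Icc_le ?_ fun a b _ => meanEigenvalueMeasure_Icc_le hN hind hH Λ a b
  exact ENNReal.mul_ne_top (ENNReal.mul_ne_top ENNReal.ofReal_ne_top (by simp)) (by simp)

theorem card_box (d L : ℕ) : ((box d L).card : ℝ≥0∞) = (2 * (L : ℝ≥0∞) + 1) ^ d := by
  have h : (box d L).card = (2 * L + 1) ^ d := by
    rw [box, Pi.card_Icc]
    simp only [Int.card_Icc, Finset.prod_const, Finset.card_univ, Fintype.card_fin]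
    congr 1
    omega
  rw [h]
  push_cast
  rfl

theorem normalised_meanEigenvalueMeasure_le (hN : 0 < N) {H : OrbitalModel d N Ω}
    (hind : H.IsIndependent P) (hH : H.IsOrthogonal P ∨ H.IsUnitary P) (L : ℕ) :
    ((N : ℝ≥0∞) * (2 * (L : ℝ≥0∞) + 1) ^ d)⁻¹ • meanEigenvalueMeasure P H (box d L)
      ≤ ENNReal.ofReal densityBound • (volume : Measure ℝ) := by
  refine Measure.le_iff.2 fun s _ => ?_
  have h := meanEigenvalueMeasure_le hN hind hH (box d L) s
  rw [Measure.smul_apply, smul_eq_mul, card_box] at h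
  rw [Measure.smul_apply, Measure.smul_apply, smul_eq_mul, smul_eq_mul]
  have h0 : (N : ℝ≥0∞) * (2 * (L : ℝ≥0∞) + 1) ^ d ≠ 0 :=
    mul_ne_zero (by exact_mod_cast hN.ne') (pow_ne_zero _ (by simp))
  have h1 : (N : ℝ≥0∞) * (2 * (L : ℝ≥0∞) + 1) ^ d ≠ ⊤ :=
    ENNReal.mul_ne_top (by simp) (ENNReal.pow_ne_top (by finiteness))
  calc _ ≤ ((N : ℝ≥0∞) * (2 * (L : ℝ≥0∞) + 1) ^ d)⁻¹ * (ENNReal.ofReal densityBound * N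
        * (2 * (L : ℝ≥0∞) + 1) ^ d * volume s) := by gcongr
    _ = ((N : ℝ≥0∞) * (2 * (L : ℝ≥0∞) + 1) ^ d)⁻¹ * (N * (2 * (L : ℝ≥0∞) + 1) ^ d)
        * (ENNReal.ofReal densityBound * volume s) := by ring
    _ = _ := by rw [ENNReal.inv_mul_cancel h0 h1, one_mul]

end Model

end Orbital
end

theorem mainTheorem6 :
    ∃ C : ℝ, 0 < C ∧
      ∀ (d N : ℕ), 1 ≤ d → 1 ≤ N →
      ∀ (Ω : Type*) [MeasurableSpace Ω] (P : Measure Ω) [IsProbabilityMeasure P]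
        (H : Orbital.OrbitalModel d N Ω),
        H.IsIndependent P → (H.IsOrthogonal P ∨ H.IsUnitary P) →
        (∀ (Λ : Finset (Orbital.Site d)) (I : Set ℝ), I.OrdConnected →
          Measurable (fun ω => Orbital.eigenvalueCount (H.finiteVolume Λ ω) I) ∧
          ∫⁻ ω, (Orbital.eigenvalueCount (H.finiteVolume Λ ω) I : ℝ≥0∞) ∂P
            ≤ ENNReal.ofReal C * N * Λ.card * volume I) ∧
        (∀ (ρ : Measure ℝ) [IsLocallyFiniteMeasure ρ], Orbital.IsLimitingMeasure P H ρ →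
          ∃ p : ℝ → ℝ, Measurable p ∧ (∀ t, 0 ≤ p t ∧ p t ≤ C) ∧
            ρ = volume.withDensity (fun t => ENNReal.ofReal (p t))) := by
  refine ⟨Orbital.densityBound, Orbital.densityBound_pos,
    fun d N _ hN Ω _ P _ H hind hH => ⟨fun Λ I hI => ⟨?_, ?_⟩, fun ρ _ hρ => ?_⟩⟩
  · exact Orbital.measurable_eigenvalueCount_finiteVolume H Λ hI.measurableSet
  · rw [← Orbital.meanEigenvalueMeasure_apply P H Λ hI.measurableSet]
    exact Orbital.meanEigenvalueMeasure_le hN hind hH Λ I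
  · have hC := Orbital.densityBound_pos.le
    exact Orbital.exists_density_of_le_smul_volume hC
      (Orbital.le_smul_volume_of_Icc_le ENNReal.ofReal_ne_top fun a b hab => Orbital.VagueLimit.Icc_le hC
          (Orbital.normalised_meanEigenvalueMeasure_le hN hind hH) hρ hab)
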